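/- Let $Z$ be a complex manifold and let $U\colon Z\to\mathbb R$ be a plurisubharmonic function in $C^{\partial\bar\partial}(Z)$, that is, $U$ is continuous and the current $\partial\bar\partial U$ is represented by a continuous $(1,1)$-form, also denoted $\partial\bar\partial U$. Let $Y\subset Z$ be a one-dimensional, not necessarily closed complex submanifold such that $TY\subset\operatorname{Ker}\partial\bar\partial U$. Let $NY=(T^{1,0}Z|Y)/T^{1,0}Y$ be the normal bundle, $p\colon T^{1,0}Z|Y\to NY$ the projection, and put $$h(p\zeta)=\partial\bar\partial U(\zeta,\bar\zeta),\qquad \zeta\in T^{1,0}Z|Y .$$ Then $h$ is a well-defined, possibly degenerate continuous Hermitian metric on the holomorphic vector bundle $NY$ (in particular $h\ge 0$), and it is seminegatively curved: for every open $Y'\subset Y$ and every holomorphic section $\sigma$ of $NY$ over $Y'$, the function $\log h\circ\sigma$ (with $\log 0=-\infty$) is subharmonic on $Y'$. Further, the metric induced by $h$ on the line bundle $\det NY=\Lambda^{\dim Z-1}NY$, given by $$h^{\det}(\sigma_1\wedge\dots\wedge\sigma_r)=\det\big(h(\sigma_j,\sigma_k)\big)_{j,k=1}^{r},\qquad r=\dim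 Z-1$$ (the trivial metric $|\cdot|^2$ if $r=0$), where $h(\cdot,\cdot)$ is the Hermitian form with $h(e,e)=h(e)$, is also seminegatively curved: for every open $Y'\subset Y$ and every holomorphic section $\tau$ of $\det NY$ over $Y'$, the function $\log h^{\det}\circ\tau$ is subharmonic on $Y'$. Here functions that are identically $-\infty$ on some component of $Y'$ are not excluded from the subharmonic functions. -/

import Mathlib

open Set Topology MeasureTheory Manifold
open scoped ContDiff ENNReal ComplexConjugate

noncomputable section

/-! ### Subharmonic functions -/

/-- The mean over the circle with centre `a` and radius `r` of a function with values in
`[-∞, ∞]`, that is, the integral of the positive part minus the integral of the negative part.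
For upper semicontinuous functions without the value `∞` the first integral is finite, so that the
mean is well defined, possibly `-∞`. -/
def circleMean (u : ℂ → EReal) (a : ℂ) (r : ℝ) : EReal :=
  ((∫⁻ t in Ioc (0 : ℝ) 1, (u (circleMap a r (2 * Real.pi * t))).toENNReal : ℝ≥0∞) : EReal) -
    ((∫⁻ t in Ioc (0 : ℝ) 1, (-u (circleMap a r (2 * Real.pi * t))).toENNReal : ℝ≥0∞) : EReal)

/-- Subharmonic functions with values in `[-∞, ∞)` on an open set `Ω ⊆ ℂ`; functions which are
identically `-∞` (on some component of `Ω`) are not excluded. -/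
structure SubharmonicOn (u : ℂ → EReal) (Ω : Set ℂ) : Prop where
  ne_top : ∀ a ∈ Ω, u a ≠ ⊤
  upperSemicontinuousOn : UpperSemicontinuousOn u Ω
  le_circleMean : ∀ a r, 0 < r → Metric.closedBall a r ⊆ Ω → u a ≤ circleMean u a r

/-- Subharmonic functions on an open subset `Ω` of a one-dimensional complex manifold: the function
is subharmonic when written in any holomorphic local coordinate. -/
def SubharmonicOnCurve {Y : Type*} [TopologicalSpace Y] [ChartedSpace ℂ Y]
    (u : Y → EReal) (Ω : Set Y) : Prop :=
  ∀ e ∈ IsManifold.maximalAtlas 𝓘(ℂ, ℂ) ω Y,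
    SubharmonicOn (fun x => u (e.symm x)) (e.target ∩ e.symm ⁻¹' Ω)

/-! ### Complex manifolds, plurisubharmonic functions, the form `∂∂̄U`

An `n`-dimensional complex manifold is a space `Z` with holomorphic charts in `Fin n → ℂ`. Its
holomorphic tangent space `T^{1,0}_z Z` is `TangentSpace 𝓘(ℂ, Fin n → ℂ) z`. -/

section Manifolds

variable {n : ℕ} {Z : Type*} [TopologicalSpace Z] [ChartedSpace (Fin n → ℂ) Z]

/-- Plurisubharmonic functions on a complex manifold: upper semicontinuous functions with values
in `[-∞, ∞)` which become subharmonic when composed with any holomorphic map from an open subset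
of `ℂ`. -/
structure Plurisubharmonic (n : ℕ) {Z : Type*} [TopologicalSpace Z] [ChartedSpace (Fin n → ℂ) Z]
    (u : Z → EReal) : Prop where
  upperSemicontinuous : UpperSemicontinuous u
  comp_holomorphic : ∀ (Ω : Set ℂ) (f : ℂ → Z), IsOpen Ω →
    MDifferentiableOn 𝓘(ℂ, ℂ) 𝓘(ℂ, Fin n → ℂ) f Ω → SubharmonicOn (fun x => u (f x)) Ω

/-- The Wirtinger derivative `∂φ/∂z_j`. -/
def dz (j : Fin n) (φ : (Fin n → ℂ) → ℂ) (x : Fin n → ℂ) : ℂ :=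
  (fderiv ℝ φ x (Pi.single j 1) - Complex.I * fderiv ℝ φ x (Pi.single j Complex.I)) / 2

/-- The Wirtinger derivative `∂φ/∂z̄_k`. -/
def dzbar (k : Fin n) (φ : (Fin n → ℂ) → ℂ) (x : Fin n → ℂ) : ℂ :=
  (fderiv ℝ φ x (Pi.single k 1) + Complex.I * fderiv ℝ φ x (Pi.single k Complex.I)) / 2

/-- Forms of bidegree `(1,1)` on `Z`, without any regularity. In local coordinates the form
`∑ ψ_{jk} dz_j ∧ dz̄_k` is the family of sesquilinear forms
`ψ z ζ η = ψ(ζ, η̄) = ∑ ψ_{jk} dz_j(ζ) conj(dz_k(η))`, for `ζ η : T^{1,0}_z Z`. -/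
abbrev Form11 (n : ℕ) (Z : Type*) [TopologicalSpace Z] [ChartedSpace (Fin n → ℂ) Z] : Type _ :=
  ∀ z : Z, TangentSpace 𝓘(ℂ, Fin n → ℂ) z →ₗ[ℂ] TangentSpace 𝓘(ℂ, Fin n → ℂ) z →ₗ⋆[ℂ] ℂ

/-- The coefficient of `dz_j ∧ dz̄_k` of the form `ψ`, in the local coordinates given by the chart
`e`: the value of `ψ` on `∂/∂z_j` and (the conjugate of) `∂/∂z_k`. -/
def Form11.coeff (ψ : Form11 n Z) (e : OpenPartialHomeomorph Z (Fin n → ℂ)) (j k : Fin n)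
    (x : Fin n → ℂ) : ℂ :=
  ψ (e.symm x)
    (mfderiv 𝓘(ℂ, Fin n → ℂ) 𝓘(ℂ, Fin n → ℂ) e.symm x (Pi.single j (1 : ℂ) : Fin n → ℂ))
    (mfderiv 𝓘(ℂ, Fin n → ℂ) 𝓘(ℂ, Fin n → ℂ) e.symm x (Pi.single k (1 : ℂ) : Fin n → ℂ))

/-- `U` is in `C^{∂∂̄}(Z)` and `∂∂̄U = ψ`: the function `U` and the `(1,1)`-form `ψ` are
continuous, and `ψ` represents the current `∂∂̄U`. In terms of local coordinates, the continuous
coefficient `ψ_{jk}` of `ψ` is the distributional derivative `∂²U/∂z_j∂z̄_k`. By continuity, `ψ` is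
uniquely determined by `U`. -/
structure HasContinuousDDbar (U : Z → ℝ) (ψ : Form11 n Z) : Prop where
  continuous : Continuous U
  continuousOn_coeff : ∀ e ∈ IsManifold.maximalAtlas 𝓘(ℂ, Fin n → ℂ) ω Z, ∀ j k,
    ContinuousOn (ψ.coeff e j k) e.target
  integral_eq : ∀ e ∈ IsManifold.maximalAtlas 𝓘(ℂ, Fin n → ℂ) ω Z, ∀ j k,
    ∀ φ : (Fin n → ℂ) → ℂ, ContDiff ℝ ∞ φ → HasCompactSupport φ → tsupport φ ⊆ e.target →
      ∫ x, (U (e.symm x) : ℂ) * dz j (dzbar k φ) x = ∫ x, ψ.coeff e j k x * φ x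

/-! ### The normal bundle of a curve and the induced metrics

A one-dimensional complex submanifold of `Z` is given by an injective holomorphic immersion
`ι : Y → Z` of a one-dimensional complex manifold `Y`, the inclusion. -/

variable {Y : Type*} [TopologicalSpace Y] [ChartedSpace ℂ Y]

/-- The holomorphic tangent space `T^{1,0}_y Y` as a subspace of `T^{1,0}_y Z`. -/
abbrev tangentOf (n : ℕ) {Z : Type*} [TopologicalSpace Z] [ChartedSpace (Fin n → ℂ) Z]
    {Y : Type*} [TopologicalSpace Y] [ChartedSpace ℂ Y] (ι : Y → Z) (y : Y) :
    Submodule ℂ (TangentSpace 𝓘(ℂ, Fin n → ℂ) (ι y)) :=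
  LinearMap.range (mfderiv 𝓘(ℂ, ℂ) 𝓘(ℂ, Fin n → ℂ) ι y).toLinearMap

/-- The fibre `T^{1,0}_y Z / T^{1,0}_y Y` of the normal bundle `NY`. -/
abbrev NormalFiber (n : ℕ) {Z : Type*} [TopologicalSpace Z] [ChartedSpace (Fin n → ℂ) Z]
    {Y : Type*} [TopologicalSpace Y] [ChartedSpace ℂ Y] (ι : Y → Z) (y : Y) : Type :=
  TangentSpace 𝓘(ℂ, Fin n → ℂ) (ι y) ⧸ tangentOf n ι y

/-- `TY ⊆ Ker ψ`: contracting the 2-form `ψ` with a tangent vector of `Y` gives zero. -/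
def TangentSubsetKer (ι : Y → Z) (ψ : Form11 n Z) : Prop :=
  ∀ y, ∀ v ∈ tangentOf n ι y, (∀ w, ψ (ι y) v w = 0) ∧ (∀ w, ψ (ι y) w v = 0)

/-- A sesquilinear form on `V` whose kernel contains `p` induces one on `V / p`. -/
def quotientForm {V : Type*} [AddCommGroup V] [Module ℂ V] (p : Submodule ℂ V)
    (B : V →ₗ[ℂ] V →ₗ⋆[ℂ] ℂ) (h : ∀ v ∈ p, (∀ w, B v w = 0) ∧ (∀ w, B w v = 0)) :
    (V ⧸ p) →ₗ[ℂ] (V ⧸ p) →ₗ⋆[ℂ] ℂ :=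
  p.liftQ
    { toFun := fun v => p.liftQ (B v) (fun w hw => (h w hw).2 v)
      map_add' := fun v v' => by
        refine Submodule.linearMap_qext _ (LinearMap.ext fun w => ?_)
        exact congrArg (fun L => L w) (map_add B v v')
      map_smul' := fun c v => by
        refine Submodule.linearMap_qext _ (LinearMap.ext fun w => ?_)
        exact congrArg (fun L => L w) (map_smul B c v) }
    (fun v hv => by
      rw [LinearMap.mem_ker]
      exact Submodule.linearMap_qext _ (LinearMap.ext fun w => (h v hv).1 w))

@[simp] theorem quotientForm_mk {V : Type*} [AddCommGroup V] [Module ℂ V] (p : Submodule ℂ V)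
    (B : V →ₗ[ℂ] V →ₗ⋆[ℂ] ℂ) (h : ∀ v ∈ p, (∀ w, B v w = 0) ∧ (∀ w, B w v = 0)) (v w : V) :
    quotientForm p B h (p.mkQ v) (p.mkQ w) = B v w := rfl

/-- The sesquilinear form `h` which `ψ` induces on the normal bundle of `Y`, when `TY ⊆ Ker ψ`:
`h(pζ, pη) = ψ(ζ, η̄)`, where `p` is the projection to the normal bundle. -/
def normalForm (ι : Y → Z) (ψ : Form11 n Z) (hψ : TangentSubsetKer ι ψ) (y : Y) :
    NormalFiber n ι y →ₗ[ℂ] NormalFiber n ι y →ₗ⋆[ℂ] ℂ :=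
  quotientForm (tangentOf n ι y) (ψ (ι y)) (hψ y)

/-- Holomorphic sections of the normal bundle over an open set `Y' ⊆ Y` (the values of `σ` outside
`Y'` play no role): locally, `σ = pζ` with a holomorphic section `ζ` of `T^{1,0}Z|Y`. -/
def IsHolomorphicNormalSection [IsManifold 𝓘(ℂ, Fin n → ℂ) ω Z] (ι : Y → Z)
    (σ : ∀ y, NormalFiber n ι y) (Y' : Set Y) : Prop :=
  ∀ y₀ ∈ Y', ∃ V : Set Y, IsOpen V ∧ y₀ ∈ V ∧ V ⊆ Y' ∧
    ∃ ζ : ∀ y, TangentSpace 𝓘(ℂ, Fin n → ℂ) (ι y),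
      MDifferentiableOn 𝓘(ℂ, ℂ) (𝓘(ℂ, Fin n → ℂ).tangent)
        (fun y => (⟨ι y, ζ y⟩ : TangentBundle 𝓘(ℂ, Fin n → ℂ) Z)) V ∧
      ∀ y ∈ V, σ y = (tangentOf n ι y).mkQ (ζ y)

/-- `h` is a possibly degenerate continuous Hermitian metric on the normal bundle. Continuity is
expressed through `h(σ, σ)` for local holomorphic sections `σ`; by polarization this is the
continuity of the matrix of `h` in any local holomorphic frame. -/
structure IsDegenerateHermitianMetric [IsManifold 𝓘(ℂ, Fin n → ℂ) ω Z] (ι : Y → Z)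
    (h : ∀ y, NormalFiber n ι y →ₗ[ℂ] NormalFiber n ι y →ₗ⋆[ℂ] ℂ) : Prop where
  conj_symm : ∀ y v w, h y v w = conj (h y w v)
  nonneg : ∀ y v, 0 ≤ (h y v v).re
  continuousOn : ∀ (Y' : Set Y) (σ : ∀ y, NormalFiber n ι y), IsOpen Y' →
    IsHolomorphicNormalSection ι σ Y' → ContinuousOn (fun y => (h y (σ y) (σ y)).re) Y'

/-- For a fixed family `w`, the alternating map `v ↦ det (conj H(w_k, v_j))`. -/
def gramAlternating {V : Type*} [AddCommGroup V] [Module ℂ V] (H : V →ₗ[ℂ] V →ₗ⋆[ℂ] ℂ) {r : ℕ}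
    (w : Fin r → V) : V [⋀^Fin r]→ₗ[ℂ] ℂ :=
  Matrix.detRowAlternating.compLinearMap
    { toFun := fun v k => conj (H (w k) v)
      map_add' := fun v v' => by
        ext k
        simp
      map_smul' := fun c v => by
        ext k
        simp }

theorem gramAlternating_apply {V : Type*} [AddCommGroup V] [Module ℂ V]
    (H : V →ₗ[ℂ] V →ₗ⋆[ℂ] ℂ) {r : ℕ} (w v : Fin r → V) :
    gramAlternating H w v = conj (Matrix.of fun j k => H (w j) (v k)).det := by
  rw [RingHom.map_det, ← Matrix.det_transpose]
  rfl

theorem gramAlternating_update_add {V : Type*} [AddCommGroup V] [Module ℂ V]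
    (H : V →ₗ[ℂ] V →ₗ⋆[ℂ] ℂ) {r : ℕ} [DecidableEq (Fin r)] (w : Fin r → V) (i : Fin r) (a b : V) :
    gramAlternating H (Function.update w i (a + b)) =
      gramAlternating H (Function.update w i a) + gramAlternating H (Function.update w i b) := by
  obtain rfl := Subsingleton.elim ‹DecidableEq (Fin r)› (instDecidableEqFin r)
  ext v
  have key : ∀ c, (Matrix.of fun j k => H (Function.update w i c j) (v k)) =
      (Matrix.of fun j k => H (w j) (v k)).updateRow i (fun k => H c (v k)) := by
    intro c
    ext j k
    by_cases hj : j = i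
    · subst hj; simp
    · simp [hj]
  have h2 : (fun k => H (a + b) (v k)) = (fun k => H a (v k)) + (fun k => H b (v k)) := by
    ext k
    simp
  rw [AlternatingMap.add_apply, gramAlternating_apply, gramAlternating_apply,
    gramAlternating_apply, key, key, key, h2, Matrix.det_updateRow_add, map_add]

theorem gramAlternating_update_smul {V : Type*} [AddCommGroup V] [Module ℂ V]
    (H : V →ₗ[ℂ] V →ₗ⋆[ℂ] ℂ) {r : ℕ} [DecidableEq (Fin r)] (w : Fin r → V) (i : Fin r) (c : ℂ)
    (a : V) :
    gramAlternating H (Function.update w i (c • a)) =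
      conj c • gramAlternating H (Function.update w i a) := by
  obtain rfl := Subsingleton.elim ‹DecidableEq (Fin r)› (instDecidableEqFin r)
  ext v
  have key : ∀ c, (Matrix.of fun j k => H (Function.update w i c j) (v k)) =
      (Matrix.of fun j k => H (w j) (v k)).updateRow i (fun k => H c (v k)) := by
    intro c
    ext j k
    by_cases hj : j = i
    · subst hj; simp
    · simp [hj]
  have h2 : (fun k => H (c • a) (v k)) = c • (fun k => H a (v k)) := by
    ext k
    simp
  rw [AlternatingMap.smul_apply, gramAlternating_apply, gramAlternating_apply, key, key, h2,
    Matrix.det_updateRow_smul, map_mul, smul_eq_mul]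

theorem gramAlternating_eq_zero {V : Type*} [AddCommGroup V] [Module ℂ V]
    (H : V →ₗ[ℂ] V →ₗ⋆[ℂ] ℂ) {r : ℕ} (w : Fin r → V) {i j : Fin r} (hw : w i = w j)
    (hij : i ≠ j) : gramAlternating H w = 0 := by
  ext v
  rw [gramAlternating_apply, Matrix.det_zero_of_row_eq hij]
  · simp
  · ext k
    simp [hw]

/-- The sesquilinear form induced on the `r`-th exterior power: it is characterized by
`(w₁ ∧ … ∧ w_r, v₁ ∧ … ∧ v_r) ↦ det (H(w_j, v_k))`. -/
def exteriorForm {V : Type*} [AddCommGroup V] [Module ℂ V] (H : V →ₗ[ℂ] V →ₗ⋆[ℂ] ℂ) (r : ℕ) :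
    ⋀[ℂ]^r V →ₗ[ℂ] ⋀[ℂ]^r V →ₗ⋆[ℂ] ℂ :=
  exteriorPower.alternatingMapLinearEquiv
    { toFun := fun w =>
        (starLinearEquiv ℂ (A := ℂ)).toLinearMap.comp
          (exteriorPower.alternatingMapLinearEquiv (gramAlternating H w))
      map_update_add' := fun w i a b => by
        rw [gramAlternating_update_add, map_add, LinearMap.comp_add]
      map_update_smul' := fun w i c a => by
        rw [gramAlternating_update_smul, map_smul]
        ext t
        simp
      map_eq_zero_of_eq' := fun w i j hw hij => by
        rw [gramAlternating_eq_zero H w hw hij, map_zero, LinearMap.comp_zero] }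

theorem exteriorForm_ιMulti {V : Type*} [AddCommGroup V] [Module ℂ V]
    (H : V →ₗ[ℂ] V →ₗ⋆[ℂ] ℂ) (r : ℕ) (w v : Fin r → V) :
    exteriorForm H r (exteriorPower.ιMulti ℂ r w) (exteriorPower.ιMulti ℂ r v) =
      (Matrix.of fun j k => H (w j) (v k)).det := by
  simp [exteriorForm, gramAlternating_apply]

end Manifolds

/-- Holomorphic sections over an open set `Y' ⊆ Y` of the line bundle `det NY`, the top exterior
power of the normal bundle: locally, `τ = f σ₁ ∧ … ∧ σ_m` with a holomorphic function `f` and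
holomorphic sections `σ_i` of the normal bundle, whose rank is `m` as `Z` has dimension `m + 1`. -/
def IsHolomorphicDetSection {m : ℕ} {Z : Type*} [TopologicalSpace Z]
    [ChartedSpace (Fin (m + 1) → ℂ) Z] [IsManifold 𝓘(ℂ, Fin (m + 1) → ℂ) ω Z]
    {Y : Type*} [TopologicalSpace Y] [ChartedSpace ℂ Y] (ι : Y → Z)
    (τ : ∀ y, ⋀[ℂ]^m (NormalFiber (m + 1) ι y)) (Y' : Set Y) : Prop :=
  ∀ y₀ ∈ Y', ∃ V : Set Y, IsOpen V ∧ y₀ ∈ V ∧ V ⊆ Y' ∧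
    ∃ (f : Y → ℂ) (σ : Fin m → ∀ y, NormalFiber (m + 1) ι y),
      MDifferentiableOn 𝓘(ℂ, ℂ) 𝓘(ℂ, ℂ) f V ∧
      (∀ i, IsHolomorphicNormalSection ι (σ i) V) ∧
      ∀ y ∈ V, τ y = f y • exteriorPower.ιMulti ℂ m (fun i => σ i y)

/-- The function `log H(v, v)` with values in `[-∞, ∞)`, where `log 0 = -∞`. -/
def logNormSq {V : Type*} [AddCommGroup V] [Module ℂ V] (H : V →ₗ[ℂ] V →ₗ⋆[ℂ] ℂ) (v : V) : EReal :=
  ENNReal.log (ENNReal.ofReal (H v v).re)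

end

/-!
The Hermitian form `h` is a limit of functions whose mean value properties are known. In coordinates
in which the immersed curve is a piece `γ` of a complex line (`IsStraightening`), let `ζ` be a
holomorphic vector field along `γ`. As `∂∂̄U` is continuous, `∂∂̄U(ζ, ζ̄)` at `γ x` is the limit for
`ε → 0` of `ε⁻²` times the mean of `U (γ x + l ζ x) - U (γ x)` over the circle `|l| = ε`
(`add_le_circleAverage_line`, `circleAverage_line_le_add`). For fixed `l`, the first term is
subharmonic in `x`, since `U` is plurisubharmonic; the second one is harmonic, since the tangent
vectors of `γ` are null for `∂∂̄U`. Hence `h(pζ)` has the submean value property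
(`coeffForm_le_circleAverage`).

This holds for all holomorphic `ζ`, so that it may be applied to `e^{G/2} ζ`: if `G` is holomorphic,
then `h(pζ) |e^G|` has the submean value property too, and is therefore locally constant near its
local maxima. A continuous function `v ≥ 0` such that all products `v |e^G|` have this property is
logarithmically subharmonic (`subharmonicOn_log`, `subharmonicOnCurve_log`): on a circle, `log (v + ε)`
is approximated by the real part of a polynomial `p`, and the maximum principle for `v |e^{-p}|`
bounds `v` at the centre. The criterion does not depend on the choice of the local coordinate.

For the determinant, let `S` be the Gram matrix of holomorphic vector fields `ζ_1, …, ζ_m` along `γ`.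
By what was said above, `q* S q`, at the centre of a disc, is at most its mean over the boundary
circle, for all vectors `q` of polynomials. By `det_le_integral_det` this implies the same inequality
for `det S`. This is an inequality of Szegő type: the quadratic form `q ↦ N⁻¹ ∑ q* S q`, where `q` has
degree less than `N` and the sum extends over `N` equidistributed points of the circle, has the
determinant `∏ det S`, and its pivots are minima of the form over the `q` with given lowest
coefficient. If `S` is a trigonometric polynomial of degree `d`, then for the `q` of degree less than
`N - d` these sums are means over the circle, which bounds all but `m d` pivots from below; the
inequality between the geometric and the arithmetic mean, and the limit `N → ∞`, give the claim.
Multiplying `ζ_1` by a holomorphic function, one obtains the weights which the criterion asks for.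
-/

/-! ### Trigonometric polynomials -/

/-- The exponential monomial `θ ↦ exp (i l θ)`. -/
noncomputable def expMonomial (l : ℤ) (θ : ℝ) : ℂ := Complex.exp (l * θ * Complex.I)

/-- Trigonometric polynomials of degree at most `d`, as functions of the angle. -/
noncomputable def trigPoly (d : ℕ) : Submodule ℂ (ℝ → ℂ) :=
  Submodule.span ℂ (expMonomial '' {l | l.natAbs ≤ d})

theorem expMonomial_mul (k l : ℤ) : expMonomial k * expMonomial l = expMonomial (k + l) := by
  ext θ
  simp only [expMonomial, Pi.mul_apply, ← Complex.exp_add]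
  congr 1
  push_cast
  ring

theorem expMonomial_zero : expMonomial 0 = 1 := by
  ext θ
  simp [expMonomial]

theorem continuous_expMonomial (l : ℤ) : Continuous (expMonomial l) := by
  unfold expMonomial
  fun_prop

theorem conj_expMonomial (l : ℤ) (θ : ℝ) : conj (expMonomial l θ) = expMonomial (-l) θ := by
  simp [expMonomial, ← Complex.exp_conj]

theorem expMonomial_natCast (l : ℕ) (θ : ℝ) :
    expMonomial l θ = Complex.exp (θ * Complex.I) ^ l := by
  rw [← Complex.exp_nat_mul]
  simp [expMonomial, mul_assoc]

theorem expMonomial_mem {l : ℤ} {d : ℕ} (h : l.natAbs ≤ d) : expMonomial l ∈ trigPoly d :=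
  Submodule.subset_span ⟨l, h, rfl⟩

theorem trigPoly_mono {d e : ℕ} (h : d ≤ e) : trigPoly d ≤ trigPoly e :=
  Submodule.span_mono (image_mono fun _ hl => le_trans (Set.mem_ofPred.1 hl) h)

theorem trigPoly_const (c : ℂ) (d : ℕ) : (fun _ => c) ∈ trigPoly d := by
  have : (fun _ : ℝ => c) = c • expMonomial 0 := by
    ext
    simp [expMonomial_zero]
  rw [this]
  exact Submodule.smul_mem _ _ (expMonomial_mem (by simp))

theorem trigPoly_mul {d e : ℕ} {f g : ℝ → ℂ} (hf : f ∈ trigPoly d) (hg : g ∈ trigPoly e) :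
    f * g ∈ trigPoly (d + e) := by
  induction hf using Submodule.span_induction with
  | zero => simp
  | add f₁ f₂ _ _ h₁ h₂ => rw [add_mul]; exact Submodule.add_mem _ h₁ h₂
  | smul c f _ h => rw [smul_mul_assoc]; exact Submodule.smul_mem _ _ h
  | mem f hf =>
    obtain ⟨k, hk, rfl⟩ := hf
    induction hg using Submodule.span_induction with
    | zero => simp
    | add f₁ f₂ _ _ h₁ h₂ => rw [mul_add]; exact Submodule.add_mem _ h₁ h₂
    | smul c f _ h => rw [mul_smul_comm]; exact Submodule.smul_mem _ _ h
    | mem g hg =>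
      obtain ⟨l, hl, rfl⟩ := hg
      rw [expMonomial_mul]
      exact expMonomial_mem ((Int.natAbs_add_le k l).trans (add_le_add hk hl))

theorem trigPoly_conj {d : ℕ} {f : ℝ → ℂ} (hf : f ∈ trigPoly d) :
    (fun θ => conj (f θ)) ∈ trigPoly d := by
  induction hf using Submodule.span_induction with
  | zero => simpa only [Pi.zero_apply, map_zero] using trigPoly_const 0 d
  | add f₁ f₂ _ _ h₁ h₂ =>
    simp only [Pi.add_apply, map_add]
    exact Submodule.add_mem _ h₁ h₂
  | smul c f _ h =>
    simp only [Pi.smul_apply, smul_eq_mul, map_mul]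
    exact Submodule.smul_mem _ (conj c) h
  | mem f hf =>
    obtain ⟨l, hl, rfl⟩ := hf
    have : (fun θ => conj (expMonomial l θ)) = expMonomial (-l) := funext (conj_expMonomial l)
    rw [this]
    exact expMonomial_mem (by simpa using hl)

theorem trigPoly_prod {d : ℕ} {ι : Type*} (s : Finset ι) {f : ι → ℝ → ℂ}
    (hf : ∀ i ∈ s, f i ∈ trigPoly d) : ∏ i ∈ s, f i ∈ trigPoly (s.card * d) := by
  classical
  induction s using Finset.induction_on with
  | empty => exact trigPoly_const 1 _
  | insert i s hi ih =>
    rw [Finset.prod_insert hi, Finset.card_insert_of_notMem hi, add_mul, one_mul, add_comm]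
    exact trigPoly_mul (hf i (by simp)) (ih fun j hj => hf j (by simp [hj]))

theorem continuous_of_mem_trigPoly {d : ℕ} {f : ℝ → ℂ} (hf : f ∈ trigPoly d) : Continuous f := by
  induction hf using Submodule.span_induction with
  | zero => exact continuous_zero
  | add f₁ f₂ _ _ h₁ h₂ => exact h₁.add h₂
  | smul c f _ h => exact h.const_smul c
  | mem f hf =>
    obtain ⟨l, hl, rfl⟩ := hf
    exact continuous_expMonomial l

/-- Real parts of trigonometric polynomials are real parts of polynomials in `exp (iθ)`. -/
theorem exists_polynomial_re_eq {d : ℕ} {f : ℝ → ℂ} (hf : f ∈ trigPoly d) :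
    ∃ p : Polynomial ℂ, ∀ θ : ℝ, (f θ).re = (p.eval (Complex.exp (θ * Complex.I))).re := by
  suffices ∃ p q : Polynomial ℂ, ∀ θ : ℝ, f θ = p.eval (Complex.exp (θ * Complex.I)) +
      conj (q.eval (Complex.exp (θ * Complex.I))) by
    obtain ⟨p, q, h⟩ := this
    exact ⟨p + q, fun θ => by simp [h]⟩
  induction hf using Submodule.span_induction with
  | zero => exact ⟨0, 0, by simp⟩
  | add f₁ f₂ _ _ h₁ h₂ =>
    obtain ⟨p₁, q₁, h₁⟩ := h₁
    obtain ⟨p₂, q₂, h₂⟩ := h₂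
    refine ⟨p₁ + p₂, q₁ + q₂, fun θ => ?_⟩
    simp only [Pi.add_apply, h₁, h₂, Polynomial.eval_add, map_add]
    ring
  | smul c f _ h =>
    obtain ⟨p, q, h⟩ := h
    refine ⟨Polynomial.C c * p, Polynomial.C (conj c) * q, fun θ => ?_⟩
    simp [h, mul_add]
  | mem f hf =>
    obtain ⟨l, hl, rfl⟩ := hf
    obtain ⟨n, rfl | rfl⟩ := l.eq_nat_or_neg
    · exact ⟨Polynomial.X ^ n, 0, fun θ => by simp [expMonomial_natCast]⟩
    · exact ⟨0, Polynomial.X ^ n, fun θ => by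
        simp only [Polynomial.eval_zero, zero_add, Polynomial.eval_pow, Polynomial.eval_X]
        rw [← expMonomial_natCast, conj_expMonomial]⟩

/-- The `N` equidistributed angles. -/
noncomputable def rootAngle (N : ℕ) (k : Fin N) : ℝ := 2 * Real.pi * k / N

theorem sum_expMonomial_rootAngle {N : ℕ} {l : ℤ} (hl : l.natAbs < N) :
    (N : ℂ)⁻¹ * ∑ k, expMonomial l (rootAngle N k) = if l = 0 then 1 else 0 := by
  have hN : (N : ℂ) ≠ 0 := by
    have : N ≠ 0 := by omega
    exact_mod_cast this
  split_ifs with h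
  · subst h
    simp [expMonomial_zero, hN]
  · set w : ℂ := Complex.exp (2 * Real.pi * Complex.I * (l / N)) with hw
    have hterm : ∀ k : Fin N, expMonomial l (rootAngle N k) = w ^ (k : ℕ) := by
      intro k
      rw [hw, ← Complex.exp_nat_mul, expMonomial, rootAngle]
      congr 1
      push_cast
      ring
    have hw1 : w ≠ 1 := by
      intro h1
      rw [hw, Complex.exp_eq_one_iff] at h1
      obtain ⟨n, hn⟩ := h1
      have hpi : (2 * Real.pi * Complex.I : ℂ) ≠ 0 := Complex.two_pi_I_ne_zero
      have h2 : (l : ℂ) / N = n := by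
        apply mul_left_cancel₀ hpi
        rw [hn]
        ring
      rw [div_eq_iff hN] at h2
      have h3 : l = n * N := by exact_mod_cast h2
      have h4 : n ≠ 0 := by
        rintro rfl
        simp at h3
        exact h h3
      rw [h3, Int.natAbs_mul, Int.natAbs_natCast] at hl
      have : 1 ≤ n.natAbs := Int.natAbs_pos.2 h4
      nlinarith
    have hwN : w ^ N = 1 := by
      rw [hw, ← Complex.exp_nat_mul, Complex.exp_eq_one_iff]
      exact ⟨l, by field_simp⟩
    simp only [hterm]
    rw [Fin.sum_univ_eq_sum_range (fun k => w ^ k) N, geom_sum_eq hw1, hwN]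
    simp

theorem integral_expMonomial (l : ℤ) :
    (2 * Real.pi)⁻¹ • ∫ θ in (0 : ℝ)..2 * Real.pi, expMonomial l θ = if l = 0 then 1 else 0 := by
  have hpi : (2 * Real.pi : ℝ) ≠ 0 := by positivity
  split_ifs with h
  · subst h
    simp only [expMonomial_zero, Pi.one_apply, intervalIntegral.integral_const, sub_zero]
    rw [smul_smul, inv_mul_cancel₀ hpi, one_smul]
  · have hl : (l : ℂ) * Complex.I ≠ 0 := by simp [h]
    have : ∀ θ : ℝ, expMonomial l θ = Complex.exp (l * Complex.I * θ) := fun θ => by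
      rw [expMonomial]
      congr 1
      ring
    simp only [this]
    rw [integral_exp_mul_complex hl]
    have h1 : Complex.exp (l * Complex.I * ((2 * Real.pi : ℝ) : ℂ)) = 1 := by
      rw [Complex.exp_eq_one_iff]
      exact ⟨l, by push_cast; ring⟩
    rw [h1]
    simp

/-- The mean of a trigonometric polynomial of degree less than `N` over `N` equidistributed points
is its mean over the circle. -/
theorem sum_rootAngle_eq_integral {N d : ℕ} (hd : d < N) {f : ℝ → ℂ} (hf : f ∈ trigPoly d) :
    (N : ℂ)⁻¹ * ∑ k, f (rootAngle N k) =
      (2 * Real.pi)⁻¹ • ∫ θ in (0 : ℝ)..2 * Real.pi, f θ := by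
  induction hf using Submodule.span_induction with
  | zero => simp
  | add f₁ f₂ m₁ m₂ h₁ h₂ =>
    simp only [Pi.add_apply]
    rw [Finset.sum_add_distrib, mul_add, h₁, h₂, intervalIntegral.integral_add, smul_add]
    · exact (continuous_of_mem_trigPoly m₁).intervalIntegrable _ _
    · exact (continuous_of_mem_trigPoly m₂).intervalIntegrable _ _
  | smul c f _ h =>
    simp only [Pi.smul_apply, smul_eq_mul]
    rw [← Finset.mul_sum, intervalIntegral.integral_const_mul, ← mul_smul_comm, ← h]
    ring
  | mem f hf =>
    obtain ⟨l, hl, rfl⟩ := hf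
    rw [sum_expMonomial_rootAngle (lt_of_le_of_lt hl hd), integral_expMonomial]

/-- Weierstrass: continuous periodic functions are uniform limits of trigonometric polynomials. -/
theorem exists_trigPoly_near {g : ℝ → ℂ} (hg : Continuous g)
    (hper : Function.Periodic g (2 * Real.pi)) {ε : ℝ} (hε : 0 < ε) :
    ∃ d, ∃ f ∈ trigPoly d, ∀ θ, ‖f θ - g θ‖ < ε := by
  have : Fact (0 < 2 * Real.pi) := ⟨Real.two_pi_pos⟩
  let G : C(AddCircle (2 * Real.pi), ℂ) :=
    ⟨hper.lift, by
      apply continuous_quot_lift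
      exact hg⟩
  have hG : G ∈ (Submodule.span ℂ (range <| @fourier (2 * Real.pi))).topologicalClosure := by
    rw [span_fourier_closure_eq_top]
    trivial
  rw [← SetLike.mem_coe, Submodule.topologicalClosure_coe, Metric.mem_closure_iff] at hG
  obtain ⟨F, hF, hFG⟩ := hG ε hε
  have key : ∃ d, (fun θ : ℝ => F (θ : AddCircle (2 * Real.pi))) ∈ trigPoly d := by
    rw [SetLike.mem_coe] at hF
    clear hFG
    induction hF using Submodule.span_induction with
    | zero => exact ⟨0, trigPoly_const 0 0⟩
    | add f₁ f₂ _ _ h₁ h₂ =>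
      obtain ⟨d₁, h₁⟩ := h₁
      obtain ⟨d₂, h₂⟩ := h₂
      refine ⟨max d₁ d₂, ?_⟩
      exact Submodule.add_mem _ (trigPoly_mono (le_max_left _ _) h₁)
        (trigPoly_mono (le_max_right _ _) h₂)
    | smul c f _ h =>
      obtain ⟨d, h⟩ := h
      exact ⟨d, Submodule.smul_mem _ c h⟩
    | mem f hf =>
      obtain ⟨l, rfl⟩ := hf
      refine ⟨l.natAbs, ?_⟩
      convert! expMonomial_mem (le_refl l.natAbs) using 1
      ext θ
      rw [fourier_coe_apply, expMonomial]
      congr 1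
      have : (Real.pi : ℂ) ≠ 0 := by exact_mod_cast Real.pi_ne_zero
      push_cast
      field_simp
  obtain ⟨d, hd⟩ := key
  refine ⟨d, _, hd, fun θ => ?_⟩
  rw [dist_comm] at hFG
  have := (ContinuousMap.dist_lt_iff hε).1 hFG (θ : AddCircle (2 * Real.pi))
  rw [dist_eq_norm] at this
  exact this

/-! ### Determinants of positive matrices and triangular lower bounds -/

section ToeplitzLinearAlgebra

open scoped Kronecker ComplexOrder

/-- The real number `x* A x`, for a Hermitian matrix `A`. -/
noncomputable def hermQuad {n : Type*} [Fintype n] (A : Matrix n n ℂ) (x : n → ℂ) : ℝ :=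
  (star x ⬝ᵥ A.mulVec x).re

theorem hermQuad_eq_sum {n : Type*} [Fintype n] (A : Matrix n n ℂ) (x : n → ℂ) :
    hermQuad A x = (∑ i, ∑ j, conj (x i) * A i j * x j).re := by
  simp only [hermQuad, dotProduct, Matrix.mulVec, Pi.star_apply, RCLike.star_def, Finset.mul_sum,
    mul_assoc]

theorem hermQuad_conj {n k : Type*} [Fintype n] [Fintype k] (A : Matrix n n ℂ) (B : Matrix n k ℂ)
    (x : k → ℂ) : hermQuad (B.conjTranspose * A * B) x = hermQuad A (B.mulVec x) := by
  simp only [hermQuad]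
  rw [Matrix.star_mulVec, ← Matrix.mulVec_mulVec, ← Matrix.mulVec_mulVec,
    Matrix.dotProduct_mulVec]

theorem hermQuad_one {n : Type*} [Fintype n] [DecidableEq n] (x : n → ℂ) :
    hermQuad (1 : Matrix n n ℂ) x = ∑ i, ‖x i‖ ^ 2 := by
  simp only [hermQuad, Matrix.one_mulVec, dotProduct, Complex.re_sum, Pi.star_apply,
    RCLike.star_def, Complex.conj_mul']
  norm_cast

theorem hermQuad_diagonal {n : Type*} [Fintype n] [DecidableEq n] (l : n → ℝ) (x : n → ℂ) :
    hermQuad (Matrix.diagonal fun i => (l i : ℂ)) x = ∑ i, l i * ‖x i‖ ^ 2 := by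
  simp only [hermQuad, Matrix.mulVec_diagonal, dotProduct, Complex.re_sum, Pi.star_apply,
    RCLike.star_def]
  refine Finset.sum_congr rfl fun i _ => ?_
  rw [mul_left_comm, Complex.conj_mul']
  norm_cast

theorem hermQuad_blockDiagonal {n o : Type*} [Fintype n] [Fintype o] [DecidableEq o]
    (t : o → Matrix n n ℂ) (x : n × o → ℂ) :
    hermQuad (Matrix.blockDiagonal t) x = ∑ k, hermQuad (t k) (fun i => x (i, k)) := by
  simp only [hermQuad_eq_sum, ← Complex.re_sum]
  congr 1
  simp only [Fintype.sum_prod_type, Matrix.blockDiagonal_apply]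
  rw [Finset.sum_comm]
  refine Finset.sum_congr rfl fun k _ => Finset.sum_congr rfl fun i _ =>
    Finset.sum_congr rfl fun j _ => ?_
  simp [mul_ite, ite_mul]

theorem posDef_of_hermQuad {n : Type*} [Fintype n] {A : Matrix n n ℂ} (hA : A.IsHermitian)
    {c : ℝ} (hc : 0 < c) (h : ∀ x, c * ∑ i, ‖x i‖ ^ 2 ≤ hermQuad A x) : A.PosDef := by
  refine Matrix.PosDef.of_dotProduct_mulVec_pos hA fun x hx => ?_
  have him : (star x ⬝ᵥ A.mulVec x).im = 0 := by
    simpa using hA.im_star_dotProduct_mulVec_self x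
  rw [Complex.lt_def]
  refine ⟨lt_of_lt_of_le ?_ (h x), by simpa using him.symm⟩
  obtain ⟨i, hi⟩ := Function.ne_iff.1 hx
  have : 0 < ‖x i‖ ^ 2 := by
    have : x i ≠ 0 := hi
    positivity
  have h2 : ‖x i‖ ^ 2 ≤ ∑ i, ‖x i‖ ^ 2 :=
    Finset.single_le_sum (f := fun i => ‖x i‖ ^ 2) (fun i _ => by positivity) (Finset.mem_univ i)
  exact mul_pos hc (this.trans_le h2)

/-- If `x* S x ≥ c_i |x_i|²` for the vectors `x` supported on the indices `≤ i`, then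
`det S ≥ ∏ c_i`: the numbers `c_i` bound the pivots from below. -/
theorem prod_le_det_of_triangular {n : Type*} [Fintype n] [LinearOrder n] {S : Matrix n n ℂ}
    (hS : S.PosDef) (c : n → ℝ) (hc : ∀ i, 0 ≤ c i)
    (h : ∀ i x, (∀ j, i < j → x j = 0) → c i * ‖x i‖ ^ 2 ≤ hermQuad S x) :
    ∏ i, c i ≤ S.det.re := by
  let _ : LocallyFiniteOrder n := Fintype.toLocallyFiniteOrder
  let _ : LocallyFiniteOrderBot n :=
    LocallyFiniteOrderBot.ofIic n (fun i => Finset.univ.filter (· ≤ i)) (by simp)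
  -- the rows of `P` are supported on the indices `≤ i`, and `S ↦ P S P*` diagonalizes
  set P := LDL.lowerInv hS with hP
  have hdet : (LDL.diag hS).det = P.det * S.det * conj P.det := by
    rw [LDL.diag_eq_lowerInv_conj, Matrix.det_mul, Matrix.det_mul, Matrix.det_conjTranspose]
    rfl
  have hPdet : P.det = ∏ i, P i i :=
    Matrix.det_of_isLowerTriangular P fun i j hij => LDL.lowerInv_triangular hS hij
  have hPne : P.det ≠ 0 := by
    have : IsUnit P := isUnit_of_invertible _
    exact ((Matrix.isUnit_iff_isUnit_det _).1 this).ne_zero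
  have hentry : ∀ i, LDL.diagEntries hS i = ((hermQuad S (star (P i)) : ℝ) : ℂ) := by
    intro i
    have him : (star (star (P i)) ⬝ᵥ S.mulVec (star (P i))).im = 0 := by
      simpa using hS.isHermitian.im_star_dotProduct_mulVec_self (star (P i))
    rw [LDL.diagEntries, EuclideanSpace.inner_toLp_toLp, dotProduct_comm]
    exact Complex.ext (by simp [hermQuad, hP]) (by simpa using him)
  have hD : (LDL.diag hS).det = ((∏ i, hermQuad S (star (P i)) : ℝ) : ℂ) := by
    rw [LDL.diag, Matrix.det_diagonal]
    push_cast
    exact Finset.prod_congr rfl fun i _ => hentry i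
  have hle : (∏ i, c i) * ‖P.det‖ ^ 2 ≤ ∏ i, hermQuad S (star (P i)) := by
    rw [hPdet, norm_prod, ← Finset.prod_pow, ← Finset.prod_mul_distrib]
    refine Finset.prod_le_prod (fun i _ => mul_nonneg (hc i) (by positivity)) fun i _ => ?_
    have := h i (star (P i)) fun j hij => by
      simp [hP, LDL.lowerInv_triangular hS hij]
    simpa using this
  have hre : (∏ i, hermQuad S (star (P i))) = ‖P.det‖ ^ 2 * S.det.re := by
    have h1 : ((∏ i, hermQuad S (star (P i)) : ℝ) : ℂ) = ((‖P.det‖ ^ 2 : ℝ) : ℂ) * S.det := by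
      rw [← hD, hdet]
      push_cast
      rw [← Complex.mul_conj']
      ring
    have h2 := congrArg Complex.re h1
    rwa [Complex.ofReal_re, Complex.re_ofReal_mul] at h2
  rw [hre, mul_comm] at hle
  exact le_of_mul_le_mul_left hle (by positivity)

/-- The unitary matrix which takes a polynomial in `exp (iθ)` of degree less than `N`, given by its
coefficients in descending order, to its normalized values at the `N` equidistributed angles. -/
noncomputable def rootMatrix (N : ℕ) : Matrix (Fin N) (Fin N) ℂ :=
  Matrix.of fun k j => ((Real.sqrt N)⁻¹ : ℝ) *
    expMonomial ((N : ℤ) - 1 - (j : ℤ)) (rootAngle N k)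

theorem rootMatrix_unitary (N : ℕ) :
    (rootMatrix N).conjTranspose * rootMatrix N = 1 := by
  ext i j
  have hterm : ∀ k, conj (rootMatrix N k i) * rootMatrix N k j =
      (N : ℂ)⁻¹ * expMonomial ((i : ℤ) - j) (rootAngle N k) := by
    intro k
    have h1 : (i : ℤ) - j = -((N : ℤ) - 1 - (i : ℤ)) + ((N : ℤ) - 1 - (j : ℤ)) := by ring
    have h2 : ((Real.sqrt N)⁻¹ : ℝ) * (((Real.sqrt N)⁻¹ : ℝ) : ℂ) = (N : ℂ)⁻¹ := by
      rw [← Complex.ofReal_mul, ← mul_inv, Real.mul_self_sqrt (by positivity)]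
      simp
    simp only [rootMatrix, Matrix.of_apply, map_mul, Complex.conj_ofReal, conj_expMonomial]
    rw [h1, ← expMonomial_mul, Pi.mul_apply, ← h2]
    ring
  rw [Matrix.mul_apply]
  simp only [Matrix.conjTranspose_apply, RCLike.star_def, hterm]
  rw [← Finset.mul_sum, sum_expMonomial_rootAngle (by omega), Matrix.one_apply]
  refine if_congr ?_ rfl rfl
  rw [sub_eq_zero, Fin.ext_iff]
  norm_cast

/-- The Hermitian form `p ↦ N⁻¹ ∑_k p(θ_k)* t_k p(θ_k)` on vector valued polynomials of degree less
than `N` in `exp (iθ)`, in terms of the coefficients. -/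
noncomputable def sampleMatrix {m N : ℕ} (t : Fin N → Matrix (Fin m) (Fin m) ℂ) :
    Matrix (Fin m × Fin N) (Fin m × Fin N) ℂ :=
  ((1 : Matrix (Fin m) (Fin m) ℂ) ⊗ₖ rootMatrix N).conjTranspose * Matrix.blockDiagonal t *
    ((1 : Matrix (Fin m) (Fin m) ℂ) ⊗ₖ rootMatrix N)

theorem kronecker_rootMatrix_unitary (m N : ℕ) :
    ((1 : Matrix (Fin m) (Fin m) ℂ) ⊗ₖ rootMatrix N).conjTranspose *
      ((1 : Matrix (Fin m) (Fin m) ℂ) ⊗ₖ rootMatrix N) = 1 := by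
  rw [Matrix.conjTranspose_kronecker, ← Matrix.mul_kronecker_mul, rootMatrix_unitary]
  simp

theorem det_sampleMatrix {m N : ℕ} (t : Fin N → Matrix (Fin m) (Fin m) ℂ) :
    (sampleMatrix t).det = ∏ k, (t k).det := by
  have h := congrArg Matrix.det (kronecker_rootMatrix_unitary m N)
  rw [Matrix.det_mul, Matrix.det_one] at h
  rw [sampleMatrix, Matrix.det_mul, Matrix.det_mul, mul_right_comm, h, one_mul,
    Matrix.det_blockDiagonal]

theorem kronecker_rootMatrix_mulVec {m N : ℕ} (x : Fin m × Fin N → ℂ) (a : Fin m) (k : Fin N) :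
    ((1 : Matrix (Fin m) (Fin m) ℂ) ⊗ₖ rootMatrix N).mulVec x (a, k) =
      ∑ j, rootMatrix N k j * x (a, j) := by
  simp [Matrix.mulVec, dotProduct, Fintype.sum_prod_type, Matrix.kroneckerMap_apply,
    Matrix.one_apply, ite_mul]

theorem hermQuad_sampleMatrix {m N : ℕ} (t : Fin N → Matrix (Fin m) (Fin m) ℂ)
    (x : Fin m × Fin N → ℂ) : hermQuad (sampleMatrix t) x =
      ∑ k, hermQuad (t k) (fun a => ∑ j, rootMatrix N k j * x (a, j)) := by
  rw [sampleMatrix, hermQuad_conj, hermQuad_blockDiagonal]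
  simp only [kronecker_rootMatrix_mulVec]

theorem sum_sq_norm_rootMatrix {m N : ℕ} (x : Fin m × Fin N → ℂ) :
    ∑ k, ∑ a, ‖∑ j, rootMatrix N k j * x (a, j)‖ ^ 2 = ∑ i, ‖x i‖ ^ 2 := by
  have h := hermQuad_sampleMatrix (fun _ : Fin N => (1 : Matrix (Fin m) (Fin m) ℂ)) x
  have h1 : sampleMatrix (fun _ : Fin N => (1 : Matrix (Fin m) (Fin m) ℂ)) = 1 := by
    have : Matrix.blockDiagonal (fun _ : Fin N => (1 : Matrix (Fin m) (Fin m) ℂ)) = 1 :=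
      Matrix.blockDiagonal_one
    rw [sampleMatrix, this, Matrix.mul_one, kronecker_rootMatrix_unitary]
  rw [h1, hermQuad_one] at h
  simp only [hermQuad_one] at h
  exact h.symm

theorem isHermitian_sampleMatrix {m N : ℕ} {t : Fin N → Matrix (Fin m) (Fin m) ℂ}
    (ht : ∀ k, (t k).IsHermitian) : (sampleMatrix t).IsHermitian := by
  have : (Matrix.blockDiagonal t).IsHermitian := by
    rw [Matrix.IsHermitian, Matrix.blockDiagonal_conjTranspose]
    exact congrArg _ (funext ht)
  exact Matrix.isHermitian_conjTranspose_mul_mul _ this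

end ToeplitzLinearAlgebra

/-! ### A determinantal inequality of Szegő type -/

section Szego

open scoped ComplexOrder

theorem trigPoly_conj_eval_mul_eval {n : ℕ} {p q : Polynomial ℂ} (hp : p.natDegree ≤ n)
    (hq : q.natDegree ≤ n) :
    (fun θ : ℝ => conj (p.eval (Complex.exp (θ * Complex.I))) *
      q.eval (Complex.exp (θ * Complex.I))) ∈ trigPoly n := by
  have : (fun θ : ℝ => conj (p.eval (Complex.exp (θ * Complex.I))) *
      q.eval (Complex.exp (θ * Complex.I))) =
      ∑ i ∈ Finset.range (n + 1), ∑ j ∈ Finset.range (n + 1),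
        (conj (p.coeff i) * q.coeff j) • expMonomial (-(i : ℤ) + j) := by
    ext θ
    rw [Polynomial.eval_eq_sum_range' (Nat.lt_succ_of_le hp),
      Polynomial.eval_eq_sum_range' (Nat.lt_succ_of_le hq), map_sum, Finset.sum_mul_sum]
    simp only [Finset.sum_apply, Pi.smul_apply, smul_eq_mul, ← expMonomial_mul, Pi.mul_apply,
      ← expMonomial_natCast, map_mul, conj_expMonomial]
    refine Finset.sum_congr rfl fun i _ => Finset.sum_congr rfl fun j _ => by ring
  rw [this]
  refine Submodule.sum_mem _ fun i hi => Submodule.sum_mem _ fun j hj =>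
    Submodule.smul_mem _ _ (expMonomial_mem ?_)
  rw [Finset.mem_range] at hi hj
  omega

/-- If `t` is a trigonometric polynomial of degree `d`, then `q* t q` is the real part of one of degree
`n + d` (not `2n + d`), for polynomials `q` of degree `n` in `exp (iθ)`. -/
theorem trigPoly_hermQuad {m d n : ℕ} {t : ℝ → Matrix (Fin m) (Fin m) ℂ}
    (ht : ∀ a b, (fun θ => t θ a b) ∈ trigPoly d) {q : Fin m → Polynomial ℂ}
    (hq : ∀ a, (q a).natDegree ≤ n) :
    ∃ f ∈ trigPoly (n + d), ∀ θ : ℝ,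
      hermQuad (t θ) (fun a => (q a).eval (Complex.exp (θ * Complex.I))) = (f θ).re := by
  refine ⟨∑ a, ∑ b, (fun θ : ℝ => conj ((q a).eval (Complex.exp (θ * Complex.I))) *
      (q b).eval (Complex.exp (θ * Complex.I))) * (fun θ => t θ a b),
    Submodule.sum_mem _ fun a _ => Submodule.sum_mem _ fun b _ =>
      trigPoly_mul (trigPoly_conj_eval_mul_eval (hq a) (hq b)) (ht a b), fun θ => ?_⟩
  rw [hermQuad_eq_sum]
  simp only [Finset.sum_apply, Pi.mul_apply]
  congr 1
  refine Finset.sum_congr rfl fun i _ => Finset.sum_congr rfl fun j _ => by ring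

theorem sum_rootAngle_re_eq_integral {N d : ℕ} (hd : d < N) {f : ℝ → ℂ} (hf : f ∈ trigPoly d) :
    (N : ℝ)⁻¹ * ∑ k, (f (rootAngle N k)).re =
      (2 * Real.pi)⁻¹ * ∫ θ in (0 : ℝ)..2 * Real.pi, (f θ).re := by
  have h := congrArg Complex.re (sum_rootAngle_eq_integral hd hf)
  have hi : (∫ θ in (0 : ℝ)..2 * Real.pi, (f θ).re) = (∫ θ in (0 : ℝ)..2 * Real.pi, f θ).re := by
    have := Complex.reCLM.intervalIntegral_comp_comm
      ((continuous_of_mem_trigPoly hf).intervalIntegrable (μ := volume) 0 (2 * Real.pi))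
    simpa using this
  rw [Complex.smul_re, ← hi, ← Complex.ofReal_natCast, ← Complex.ofReal_inv,
    Complex.re_ofReal_mul, Complex.re_sum] at h
  exact h

/-- The determinant of the form `sampleMatrix` is bounded from below by means of its pivots: for
the indices of the `d` lowest powers the pivots are at least `c`, and for the other ones the mean
over the equidistributed angles is a mean over the circle. -/
theorem pow_mul_pow_le_prod_det {m d : ℕ} {t : ℝ → Matrix (Fin m) (Fin m) ℂ}
    (ht : ∀ a b, (fun θ => t θ a b) ∈ trigPoly d) (hherm : ∀ θ, (t θ).IsHermitian)
    {c : ℝ} (hc : 0 < c) (hpos : ∀ θ x, c * ∑ i, ‖x i‖ ^ 2 ≤ hermQuad (t θ) x)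
    {l : Fin m → ℝ} (hl : ∀ a, 0 ≤ l a)
    (hsub : ∀ q : Fin m → Polynomial ℂ, ∑ a, l a * ‖(q a).eval 0‖ ^ 2 ≤ (2 * Real.pi)⁻¹ *
      ∫ θ in (0 : ℝ)..2 * Real.pi,
        hermQuad (t θ) (fun a => (q a).eval (Complex.exp (θ * Complex.I)))) (M : ℕ) :
    (∏ a, l a) ^ M * (c ^ m) ^ d ≤ ∏ k, (t (rootAngle (M + d) k)).det.re := by
  set N := M + d with hN
  set F := sampleMatrix fun k => t (rootAngle N k) with hF
  have hFherm : F.IsHermitian := isHermitian_sampleMatrix fun k => hherm _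
  have hFpos : ∀ x, c * ∑ i, ‖x i‖ ^ 2 ≤ hermQuad F x := fun x => by
    rw [hF, hermQuad_sampleMatrix, ← sum_sq_norm_rootMatrix, Finset.mul_sum]
    exact Finset.sum_le_sum fun k _ => hpos _ _
  -- the indices are ordered by descending powers of `exp (iθ)`
  let e : Fin N ×ₗ Fin m ≃ Fin m × Fin N := ofLex.trans (Equiv.prodComm _ _)
  have hS : (F.submatrix e e).PosDef := (posDef_of_hermQuad hFherm hc hFpos).submatrix e.injective
  have hquad : ∀ x : Fin N ×ₗ Fin m → ℂ, hermQuad (F.submatrix e e) x =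
      hermQuad F (fun i => x (e.symm i)) := fun x => by
    rw [hermQuad_eq_sum, hermQuad_eq_sum, ← Equiv.sum_comp e]
    simp only [Matrix.submatrix_apply, Equiv.symm_apply_apply]
    congr 1
    refine Finset.sum_congr rfl fun i _ => ?_
    rw [← Equiv.sum_comp e]
    simp
  let cc : Fin N ×ₗ Fin m → ℝ := fun i => if ((ofLex i).1 : ℕ) < M then l (ofLex i).2 else c
  have key := prod_le_det_of_triangular hS cc (fun i => by
    simp only [cc]
    split_ifs
    exacts [hl _, hc.le]) (fun i x hx => by
    rw [hquad]
    simp only [cc]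
    obtain ⟨i, a⟩ := i
    change (if (i : ℕ) < M then l a else c) * ‖x (toLex (i, a))‖ ^ 2 ≤ _
    split_ifs with hi
    · -- in this case `x` is a polynomial vector, times a power of `exp (iθ)`
      let q : Fin m → Polynomial ℂ := fun b => ∑ j : Fin N,
        if j ≤ i then Polynomial.monomial ((i : ℕ) - j) (x (toLex (j, b))) else 0
      have hqdeg : ∀ b, (q b).natDegree ≤ (i : ℕ) := fun b =>
        Polynomial.natDegree_sum_le_of_forall_le _ _ fun j _ => by
          split_ifs
          · exact (Polynomial.natDegree_monomial_le _).trans (Nat.sub_le _ _)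
          · simp
      have hq0 : ∀ b, (q b).eval 0 = x (toLex (i, b)) := fun b => by
        simp only [q, Polynomial.eval_finsetSum]
        rw [Finset.sum_eq_single i]
        · simp
        · intro j _ hj
          split_ifs with hji
          · have : (i : ℕ) - j ≠ 0 := by
              have : j < i := lt_of_le_of_ne hji hj
              have : (j : ℕ) < i := this
              omega
            simp [this]
          · simp
        · simp
      have hval : ∀ (k : Fin N) (b : Fin m), ∑ j, rootMatrix N k j * x (e.symm (b, j)) =
          (((Real.sqrt N)⁻¹ : ℝ) * expMonomial ((N : ℤ) - 1 - (i : ℤ)) (rootAngle N k)) *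
            (q b).eval (Complex.exp (rootAngle N k * Complex.I)) := by
        intro k b
        simp only [q, Polynomial.eval_finsetSum, Finset.mul_sum]
        refine Finset.sum_congr rfl fun j _ => ?_
        have hex : e.symm (b, j) = toLex (j, b) := rfl
        rw [hex]
        split_ifs with hji
        · have hji' : (j : ℕ) ≤ i := hji
          have h1 : (N : ℤ) - 1 - (j : ℤ) =
              ((N : ℤ) - 1 - (i : ℤ)) + (((i : ℕ) - j : ℕ) : ℤ) := by
            push_cast [hji']
            ring
          rw [Polynomial.eval_monomial, rootMatrix, Matrix.of_apply, h1, ← expMonomial_mul,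
            Pi.mul_apply, expMonomial_natCast]
          ring
        · rw [hx]
          · simp
          · exact Prod.Lex.toLex_lt_toLex.2 (Or.inl (not_le.1 hji))
      have hNpos : 0 < (N : ℝ) := by
        have : 0 < N := by have := i.2; omega
        exact_mod_cast this
      have hscale : ∀ (A : Matrix (Fin m) (Fin m) ℂ) (z : ℂ) (v : Fin m → ℂ),
          hermQuad A (fun b => z * v b) = ‖z‖ ^ 2 * hermQuad A v := by
        intro A z v
        rw [hermQuad_eq_sum, hermQuad_eq_sum, ← Complex.re_ofReal_mul]
        congr 1
        push_cast
        rw [← Complex.conj_mul', Finset.mul_sum]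
        refine Finset.sum_congr rfl fun i _ => ?_
        rw [Finset.mul_sum]
        refine Finset.sum_congr rfl fun j _ => ?_
        rw [map_mul]
        ring
      have hnorm : ∀ k : Fin N, ‖(((Real.sqrt N)⁻¹ : ℝ) *
          expMonomial ((N : ℤ) - 1 - (i : ℤ)) (rootAngle N k) : ℂ)‖ ^ 2 = (N : ℝ)⁻¹ := by
        intro k
        have : ‖expMonomial ((N : ℤ) - 1 - (i : ℤ)) (rootAngle N k)‖ = 1 := by
          rw [expMonomial]
          have := Complex.norm_exp_ofReal_mul_I
            (((N : ℤ) - 1 - (i : ℤ) : ℤ) * rootAngle N k : ℝ)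
          push_cast at this ⊢
          exact this
        rw [norm_mul, this, mul_one, Complex.norm_real, Real.norm_eq_abs, sq_abs, inv_pow,
          Real.sq_sqrt hNpos.le]
      obtain ⟨f, hf, hfq⟩ := trigPoly_hermQuad ht hqdeg
      have hlt : (i : ℕ) + d < N := by omega
      rw [hF, hermQuad_sampleMatrix]
      simp only [hval, hscale, hnorm, hfq]
      rw [← Finset.mul_sum, sum_rootAngle_re_eq_integral hlt hf]
      have h2 := hsub q
      simp only [hfq, hq0] at h2
      refine le_trans ?_ h2
      exact Finset.single_le_sum (f := fun a => l a * ‖x (toLex (i, a))‖ ^ 2)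
        (fun a _ => mul_nonneg (hl a) (by positivity)) (Finset.mem_univ a)
    · refine le_trans ?_ (hFpos _)
      refine mul_le_mul_of_nonneg_left ?_ hc.le
      exact Finset.single_le_sum (f := fun j => ‖x (e.symm j)‖ ^ 2)
        (fun a _ => by positivity) (Finset.mem_univ (a, i)))
  have hdetF : F.det = ∏ k, (t (rootAngle N k)).det := det_sampleMatrix _
  have hreal : ∀ θ, (t θ).det = (((t θ).det.re : ℝ) : ℂ) := fun θ => by
    have := (posDef_of_hermQuad (hherm θ) hc (hpos θ)).det_pos
    rw [Complex.lt_def] at this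
    exact Complex.ext (by simp) (by simpa using this.2.symm)
  have hdetre : (F.submatrix e e).det.re = ∏ k, (t (rootAngle N k)).det.re := by
    rw [Matrix.det_submatrix_equiv_self, hdetF, Finset.prod_congr rfl fun k _ => hreal _]
    rw [← Complex.ofReal_prod, Complex.ofReal_re]
  rw [hdetre] at key
  refine le_of_eq_of_le ?_ key
  have : ∏ i, cc i = ∏ i : Fin N, ∏ a : Fin m, if (i : ℕ) < M then l a else c := by
    rw [← Fintype.prod_prod_type' (fun (i : Fin N) (a : Fin m) => if (i : ℕ) < M then l a else c)]
    exact (Equiv.prod_comp ofLex (fun p : Fin N × Fin m => if (p.1 : ℕ) < M then l p.2 else c))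
  rw [this, hN, Fin.prod_univ_add]
  simp

/-- The determinantal inequality for trigonometric polynomials: let the number of sample points tend
to infinity in `pow_mul_pow_le_prod_det`. -/
theorem prod_le_integral_det_of_trigPoly {m d : ℕ} {t : ℝ → Matrix (Fin m) (Fin m) ℂ}
    (ht : ∀ a b, (fun θ => t θ a b) ∈ trigPoly d) (hherm : ∀ θ, (t θ).IsHermitian)
    {c : ℝ} (hc : 0 < c) (hpos : ∀ θ x, c * ∑ i, ‖x i‖ ^ 2 ≤ hermQuad (t θ) x)
    {l : Fin m → ℝ} (hl : ∀ a, 0 ≤ l a)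
    (hsub : ∀ q : Fin m → Polynomial ℂ, ∑ a, l a * ‖(q a).eval 0‖ ^ 2 ≤ (2 * Real.pi)⁻¹ *
      ∫ θ in (0 : ℝ)..2 * Real.pi,
        hermQuad (t θ) (fun a => (q a).eval (Complex.exp (θ * Complex.I)))) :
    ∏ a, l a ≤ (2 * Real.pi)⁻¹ * ∫ θ in (0 : ℝ)..2 * Real.pi, (t θ).det.re := by
  set A := (2 * Real.pi)⁻¹ * ∫ θ in (0 : ℝ)..2 * Real.pi, (t θ).det.re with hA
  set Λ := ∏ a, l a with hΛ
  have hΛ0 : 0 ≤ Λ := Finset.prod_nonneg fun a _ => hl a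
  have hdet0 : ∀ θ, 0 ≤ (t θ).det.re := fun θ => by
    have := (posDef_of_hermQuad (hherm θ) hc (hpos θ)).det_pos
    rw [Complex.lt_def] at this
    exact this.1.le
  have hdetT : (fun θ => (t θ).det) ∈ trigPoly (m * d) := by
    have : (fun θ => (t θ).det) =
        ∑ σ : Equiv.Perm (Fin m), ((Equiv.Perm.sign σ : ℤ) : ℂ) •
          ∏ i, fun θ => t θ (σ i) i := by
      ext θ
      simp [Matrix.det_apply', Finset.sum_apply, Finset.prod_apply]
    rw [this]
    refine Submodule.sum_mem _ fun σ _ => Submodule.smul_mem _ _ ?_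
    simpa using trigPoly_prod Finset.univ (f := fun i θ => t θ (σ i) i) (d := d)
      fun i _ => ht _ _
  have hA0 : 0 ≤ A := mul_nonneg (by positivity)
    (intervalIntegral.integral_nonneg (by positivity) fun θ _ => hdet0 θ)
  -- the mean of `det t` over more than `m * d` equidistributed angles is its mean over the circle
  have hbound : ∀ M : ℕ, m * d < M → Λ ^ M * (c ^ m) ^ d ≤ A ^ (M + d) := fun M hM => by
    refine (pow_mul_pow_le_prod_det ht hherm hc hpos hl hsub M).trans ?_
    have hN : 0 < M + d := by omega
    have h1 := sum_rootAngle_re_eq_integral (N := M + d) (d := m * d) (by omega) hdetT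
    rw [hA, ← h1]
    have h2 := Real.geom_mean_le_arith_mean_weighted Finset.univ
      (fun _ : Fin (M + d) => ((M + d : ℕ) : ℝ)⁻¹) (fun k => (t (rootAngle (M + d) k)).det.re)
      (fun _ _ => by positivity) (by
        have : ((M + d : ℕ) : ℝ) ≠ 0 := by positivity
        simp only [Finset.sum_const, Finset.card_univ, Fintype.card_fin, nsmul_eq_mul]
        exact mul_inv_cancel₀ this) (fun k _ => hdet0 _)
    rw [Real.finsetProd_rpow _ _ (fun k _ => hdet0 _), ← Finset.mul_sum] at h2
    have h3 := pow_le_pow_left₀ (Real.rpow_nonneg (Finset.prod_nonneg fun k _ => hdet0 _) _) h2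
      (M + d)
    rwa [Real.rpow_inv_natCast_pow (Finset.prod_nonneg fun k _ => hdet0 _) hN.ne'] at h3
  by_contra hlt
  rw [not_le] at hlt
  have hΛpos : 0 < Λ := hA0.trans_lt hlt
  have hC : 0 < (c ^ m) ^ d := by positivity
  obtain hA1 | hA1 := hA0.eq_or_lt
  · have := hbound (m * d + 1) (by omega)
    rw [← hA1, zero_pow (by omega)] at this
    have : 0 < Λ ^ (m * d + 1) * (c ^ m) ^ d := by positivity
    linarith
  · have hr : 1 < Λ / A := by rwa [one_lt_div hA1]
    obtain ⟨M, hM⟩ := ((tendsto_pow_atTop_atTop_of_one_lt hr).eventually_gt_atTop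
      (A ^ d / (c ^ m) ^ d)).and (Filter.eventually_gt_atTop (m * d)) |>.exists
    have h1 := hbound M hM.2
    have h2 := hM.1
    rw [div_pow, div_lt_div_iff₀ hC (by positivity)] at h2
    rw [pow_add] at h1
    linarith

/-- Continuous families of positive semidefinite matrices are limits from above of positive definite
families of trigonometric polynomials. -/
theorem exists_trigPoly_matrix_near {m : ℕ} {H : ℝ → Matrix (Fin m) (Fin m) ℂ}
    (hcont : Continuous H) (hper : Function.Periodic H (2 * Real.pi))
    (hherm : ∀ θ, (H θ).IsHermitian) {ε : ℝ} (hε : 0 < ε) :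
    ∃ (d : ℕ) (t : ℝ → Matrix (Fin m) (Fin m) ℂ), (∀ a b, (fun θ => t θ a b) ∈ trigPoly d) ∧
      (∀ θ, (t θ).IsHermitian) ∧
      (∀ θ x, hermQuad (H θ) x + ε * ∑ i, ‖x i‖ ^ 2 ≤ hermQuad (t θ) x) ∧
      ∀ θ a b, ‖t θ a b - H θ a b‖ ≤ (m + 2) * ε := by
  have h1 : ∀ a b, ∃ d, ∃ f ∈ trigPoly d, ∀ θ, ‖f θ - H θ a b‖ < ε := fun a b =>
    exists_trigPoly_near (hcont.matrix_elem a b) (fun θ => congrFun (congrFun (hper θ) a) b) hε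
  choose D f hf hfH using h1
  obtain ⟨d, hd⟩ : ∃ d, ∀ a b, D a b ≤ d :=
    ⟨∑ a, ∑ b, D a b, fun a b => (Finset.single_le_sum (f := fun b => D a b)
      (fun _ _ => Nat.zero_le _) (Finset.mem_univ b)).trans
        (Finset.single_le_sum (f := fun a => ∑ b, D a b) (fun _ _ => Nat.zero_le _)
          (Finset.mem_univ a))⟩
  -- the approximations of the entries are made Hermitian, then `(m + 1) ε` is added
  let s : ℝ → Matrix (Fin m) (Fin m) ℂ := fun θ =>
    Matrix.of fun a b => (f a b θ + conj (f b a θ)) / 2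
  have hsH : ∀ θ a b, ‖s θ a b - H θ a b‖ ≤ ε := fun θ a b => by
    have h2 : H θ a b = conj (H θ b a) := ((hherm θ).apply a b).symm
    have h3 : s θ a b - H θ a b =
        ((f a b θ - H θ a b) + conj (f b a θ - H θ b a)) / 2 := by
      rw [map_sub, ← h2]
      simp only [s, Matrix.of_apply]
      ring
    rw [h3, norm_div, Complex.norm_ofNat]
    have := norm_add_le (f a b θ - H θ a b) (conj (f b a θ - H θ b a))
    rw [Complex.norm_conj] at this
    have h4 := hfH a b θ
    have h5 := hfH b a θ
    linarith
  have hdist : ∀ θ x, hermQuad (H θ) x - m * ε * ∑ i, ‖x i‖ ^ 2 ≤ hermQuad (s θ) x := fun θ x => by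
    have h2 : hermQuad (H θ) x - hermQuad (s θ) x =
        (∑ i, ∑ j, conj (x i) * (H θ i j - s θ i j) * x j).re := by
      rw [hermQuad_eq_sum, hermQuad_eq_sum, ← Complex.sub_re, ← Finset.sum_sub_distrib]
      simp only [← Finset.sum_sub_distrib]
      congr 1
      refine Finset.sum_congr rfl fun i _ => Finset.sum_congr rfl fun j _ => by ring
    have h3 : (∑ i, ∑ j, conj (x i) * (H θ i j - s θ i j) * x j).re ≤
        ∑ i, ∑ j, ε * ((‖x i‖ ^ 2 + ‖x j‖ ^ 2) / 2) := by
      refine (Complex.re_le_norm _).trans ((norm_sum_le _ _).trans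
        (Finset.sum_le_sum fun i _ => (norm_sum_le _ _).trans (Finset.sum_le_sum fun j _ => ?_)))
      rw [norm_mul, norm_mul, Complex.norm_conj, norm_sub_rev]
      have h4 := hsH θ i j
      have h5 : ‖x i‖ * ‖x j‖ ≤ (‖x i‖ ^ 2 + ‖x j‖ ^ 2) / 2 := by
        nlinarith [sq_nonneg (‖x i‖ - ‖x j‖)]
      calc ‖x i‖ * ‖s θ i j - H θ i j‖ * ‖x j‖ = ‖s θ i j - H θ i j‖ * (‖x i‖ * ‖x j‖) := by ring
        _ ≤ ε * ((‖x i‖ ^ 2 + ‖x j‖ ^ 2) / 2) := by gcongr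
    have h6 : ∑ i, ∑ j, ε * ((‖x i‖ ^ 2 + ‖x j‖ ^ 2) / 2) = m * ε * ∑ i, ‖x i‖ ^ 2 := by
      simp only [← Finset.mul_sum, ← Finset.sum_div, Finset.sum_add_distrib, Finset.sum_const,
        Finset.card_univ, Fintype.card_fin, nsmul_eq_mul]
      ring
    linarith
  have hsum : ∀ (A : Matrix (Fin m) (Fin m) ℂ) (r : ℝ) x,
      hermQuad (A + (r : ℂ) • (1 : Matrix (Fin m) (Fin m) ℂ)) x =
        hermQuad A x + r * ∑ i, ‖x i‖ ^ 2 := fun A r x => by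
    rw [← hermQuad_one]
    simp only [hermQuad, Matrix.add_mulVec, dotProduct_add, Complex.add_re, Matrix.smul_mulVec,
      dotProduct_smul, smul_eq_mul, Complex.re_ofReal_mul]
  refine ⟨d, fun θ => s θ + (((m + 1) * ε : ℝ) : ℂ) • (1 : Matrix (Fin m) (Fin m) ℂ),
    fun a b => ?_, fun θ => ?_, fun θ x => ?_, fun θ a b => ?_⟩
  · have : (fun θ => (s θ + (((m + 1) * ε : ℝ) : ℂ) • (1 : Matrix (Fin m) (Fin m) ℂ)) a b) =
        (1 / 2 : ℂ) • (f a b + fun θ => conj (f b a θ)) +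
          fun _ => (((m + 1) * ε : ℝ) : ℂ) * (1 : Matrix (Fin m) (Fin m) ℂ) a b := by
      ext θ
      simp only [s, Matrix.add_apply, Matrix.of_apply, Matrix.smul_apply, smul_eq_mul,
        Pi.add_apply, Pi.smul_apply]
      ring
    rw [this]
    exact Submodule.add_mem _ (Submodule.smul_mem _ _ (Submodule.add_mem _
      (trigPoly_mono (hd a b) (hf a b)) (trigPoly_conj (trigPoly_mono (hd b a) (hf b a)))))
        (trigPoly_const _ _)
  · refine Matrix.IsHermitian.ext fun i j => ?_
    simp only [s, Matrix.add_apply, Matrix.of_apply, Matrix.smul_apply, smul_eq_mul,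
      Matrix.one_apply, star_add, RCLike.star_def, map_div₀, map_mul, map_add, Complex.conj_conj,
      Complex.conj_ofReal, eq_comm (a := j) (b := i)]
    have h2 : conj (2 : ℂ) = 2 := Complex.conj_ofNat 2
    split_ifs <;> simp [add_comm, h2]
  · rw [hsum]
    have := hdist θ x
    nlinarith
  · have h2 : (s θ + (((m + 1) * ε : ℝ) : ℂ) • (1 : Matrix (Fin m) (Fin m) ℂ)) a b - H θ a b =
        (s θ a b - H θ a b) + (((m + 1) * ε : ℝ) : ℂ) * (1 : Matrix (Fin m) (Fin m) ℂ) a b := by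
      simp only [Matrix.add_apply, Matrix.smul_apply, smul_eq_mul]
      ring
    rw [h2]
    refine (norm_add_le _ _).trans ?_
    have h3 : ‖(((m + 1) * ε : ℝ) : ℂ) * (1 : Matrix (Fin m) (Fin m) ℂ) a b‖ ≤ (m + 1) * ε := by
      rw [norm_mul, Complex.norm_real, Real.norm_of_nonneg (by positivity), Matrix.one_apply]
      split_ifs
      · simp
      · simp only [norm_zero, mul_zero]
        positivity
    have := hsH θ a b
    linarith

/-- The determinantal inequality with a diagonal matrix in place of `H₀`. -/
theorem prod_le_integral_det {m : ℕ} {H : ℝ → Matrix (Fin m) (Fin m) ℂ}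
    (hcont : Continuous H) (hper : Function.Periodic H (2 * Real.pi))
    (hherm : ∀ θ, (H θ).IsHermitian) (hpos : ∀ θ x, 0 ≤ hermQuad (H θ) x)
    {l : Fin m → ℝ} (hl : ∀ a, 0 ≤ l a)
    (hsub : ∀ q : Fin m → Polynomial ℂ, ∑ a, l a * ‖(q a).eval 0‖ ^ 2 ≤ (2 * Real.pi)⁻¹ *
      ∫ θ in (0 : ℝ)..2 * Real.pi,
        hermQuad (H θ) (fun a => (q a).eval (Complex.exp (θ * Complex.I)))) :
    ∏ a, l a ≤ (2 * Real.pi)⁻¹ * ∫ θ in (0 : ℝ)..2 * Real.pi, (H θ).det.re := by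
  choose d t ht htherm htpos htH using fun n : ℕ =>
    exists_trigPoly_matrix_near hcont hper hherm (Nat.one_div_pos_of_nat (α := ℝ) (n := n))
  have htcont : ∀ n, Continuous (t n) := fun n =>
    continuous_matrix fun a b => continuous_of_mem_trigPoly (ht n a b)
  have hquadcont : ∀ {A : ℝ → Matrix (Fin m) (Fin m) ℂ}, Continuous A →
      ∀ q : Fin m → Polynomial ℂ, Continuous fun θ : ℝ =>
        hermQuad (A θ) (fun a => (q a).eval (Complex.exp (θ * Complex.I))) := by
    intro A hA q
    have : Continuous fun θ : ℝ => fun a => (q a).eval (Complex.exp (θ * Complex.I)) :=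
      continuous_pi fun a => (q a).continuous.comp (by fun_prop)
    exact Complex.continuous_re.comp (this.star.dotProduct (hA.matrix_mulVec this))
  have hn : ∀ n, ∏ a, l a ≤ (2 * Real.pi)⁻¹ * ∫ θ in (0 : ℝ)..2 * Real.pi, (t n θ).det.re := by
    intro n
    have h0 : (0 : ℝ) < 1 / ((n : ℝ) + 1) := Nat.one_div_pos_of_nat
    refine prod_le_integral_det_of_trigPoly (ht n) (htherm n) h0 (fun θ x => ?_) hl fun q => ?_
    · have h1 := htpos n θ x
      have h2 := hpos θ x
      linarith
    · refine (hsub q).trans (mul_le_mul_of_nonneg_left ?_ (by positivity))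
      refine intervalIntegral.integral_mono_on (by positivity)
        ((hquadcont hcont q).intervalIntegrable _ _)
        ((hquadcont (htcont n) q).intervalIntegrable _ _) fun θ _ => ?_
      refine le_trans ?_ (htpos n θ _)
      exact le_add_of_nonneg_right (mul_nonneg h0.le (Finset.sum_nonneg fun _ _ => by positivity))
  suffices hT : Filter.Tendsto (fun n => ∫ θ in (0 : ℝ)..2 * Real.pi, (t n θ).det.re) Filter.atTop
      (𝓝 (∫ θ in (0 : ℝ)..2 * Real.pi, (H θ).det.re)) from ge_of_tendsto' (hT.const_mul _) hn
  have hlim : ∀ θ a b, Filter.Tendsto (fun n => t n θ a b) Filter.atTop (𝓝 (H θ a b)) := by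
    intro θ a b
    rw [tendsto_iff_norm_sub_tendsto_zero]
    refine squeeze_zero (fun _ => norm_nonneg _) (fun n => htH n θ a b) ?_
    simpa using (tendsto_one_div_add_atTop_nhds_zero_nat (𝕜 := ℝ)).const_mul ((m : ℝ) + 2)
  obtain ⟨C, hC⟩ : ∃ C : ℝ, ∀ θ ∈ Icc 0 (2 * Real.pi), ∀ a b, ‖H θ a b‖ ≤ C := by
    have h1 : ∀ a b, ∃ C : ℝ, ∀ θ ∈ Icc 0 (2 * Real.pi), ‖H θ a b‖ ≤ C := fun a b =>
      isCompact_Icc.exists_bound_of_continuousOn (hcont.matrix_elem a b).continuousOn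
    choose C hC using h1
    refine ⟨∑ a, ∑ b, |C a b|, fun θ hθ a b => (hC a b θ hθ).trans ((le_abs_self _).trans ?_)⟩
    exact (Finset.single_le_sum (f := fun b => |C a b|)
      (fun _ _ => abs_nonneg _) (Finset.mem_univ b)).trans
        (Finset.single_le_sum (f := fun a => ∑ b, |C a b|)
          (fun _ _ => Finset.sum_nonneg fun _ _ => abs_nonneg _) (Finset.mem_univ a))
  refine intervalIntegral.tendsto_integral_filter_of_dominated_convergence
    (fun _ => (Nat.factorial m : ℝ) * (C + (m + 2)) ^ m) ?_ ?_ ?_ ?_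
  · exact Filter.Eventually.of_forall fun n =>
      (Complex.continuous_re.comp (htcont n).matrix_det).aestronglyMeasurable
  · refine Filter.Eventually.of_forall fun n => Filter.Eventually.of_forall fun θ hθ => ?_
    rw [uIoc_of_le (by positivity)] at hθ
    refine (Complex.abs_re_le_norm _).trans ?_
    have := Matrix.det_le (A := t n θ) (abv := IsAbsoluteValue.toAbsoluteValue (norm : ℂ → ℝ))
      (x := C + (m + 2)) fun a b => ?_
    · simpa using this
    · have h1 := htH n θ a b
      have h2 := hC θ ⟨hθ.1.le, hθ.2⟩ a b
      have h3 := norm_sub_norm_le (t n θ a b) (H θ a b)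
      have h4 : (1 : ℝ) / (n + 1) ≤ 1 := by
        rw [div_le_one (by positivity)]
        have : (0 : ℝ) ≤ n := n.cast_nonneg
        linarith
      have h5 : ((m : ℝ) + 2) * (1 / (n + 1)) ≤ (m + 2) * 1 := by gcongr
      change ‖t n θ a b‖ ≤ _
      linarith
  · exact intervalIntegrable_const
  · refine Filter.Eventually.of_forall fun θ _ => ?_
    have : Filter.Tendsto (fun n => t n θ) Filter.atTop (𝓝 (H θ)) :=
      tendsto_pi_nhds.2 fun a => tendsto_pi_nhds.2 fun b => hlim θ a b
    exact ((Complex.continuous_re.comp (continuous_id.matrix_det)).tendsto (H θ)).comp this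

/-- Let `H` be a continuous positive semidefinite matrix valued function on the circle, and `H₀` a
positive semidefinite matrix such that `q(0)* H₀ q(0)` is at most the mean of `q* H q`, for all
vector valued polynomials `q`. Then `det H₀` is at most the mean of `det H`. -/
theorem det_le_integral_det {m : ℕ} {H : ℝ → Matrix (Fin m) (Fin m) ℂ}
    (hcont : Continuous H) (hper : Function.Periodic H (2 * Real.pi))
    (hherm : ∀ θ, (H θ).IsHermitian) (hpos : ∀ θ x, 0 ≤ hermQuad (H θ) x)
    {H₀ : Matrix (Fin m) (Fin m) ℂ} (hherm₀ : H₀.IsHermitian) (hpos₀ : ∀ x, 0 ≤ hermQuad H₀ x)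
    (hsub : ∀ q : Fin m → Polynomial ℂ, hermQuad H₀ (fun a => (q a).eval 0) ≤ (2 * Real.pi)⁻¹ *
      ∫ θ in (0 : ℝ)..2 * Real.pi,
        hermQuad (H θ) (fun a => (q a).eval (Complex.exp (θ * Complex.I)))) :
    H₀.det.re ≤ (2 * Real.pi)⁻¹ * ∫ θ in (0 : ℝ)..2 * Real.pi, (H θ).det.re := by
  -- diagonalize `H₀` by a constant unitary change of frame
  set V : Matrix (Fin m) (Fin m) ℂ := (hherm₀.eigenvectorUnitary).1 with hV
  set l := hherm₀.eigenvalues with hl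
  have hVV : V.conjTranspose * V = 1 := by
    have := (Unitary.mem_iff.1 hherm₀.eigenvectorUnitary.2).1
    exact this
  have hdiag : V.conjTranspose * H₀ * V = Matrix.diagonal fun i => (l i : ℂ) := by
    have := hherm₀.conjStarAlgAut_star_eigenvectorUnitary
    rw [Unitary.conjStarAlgAut_apply] at this
    simpa [hV, Matrix.star_eq_conjTranspose, Function.comp_def] using this
  have hdet : ∀ A : Matrix (Fin m) (Fin m) ℂ, (V.conjTranspose * A * V).det = A.det := fun A => by
    have h := congrArg Matrix.det hVV
    rw [Matrix.det_mul, Matrix.det_one] at h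
    rw [Matrix.det_mul, Matrix.det_mul, mul_right_comm, h, one_mul]
  have hl0 : ∀ a, 0 ≤ l a := fun a => by
    have h1 := hpos₀ (V.mulVec (Pi.single a 1))
    rw [← hermQuad_conj, hdiag, hermQuad_diagonal, Finset.sum_eq_single a] at h1
    · simpa using h1
    · intro b _ hb
      simp [hb]
    · simp
  have key := prod_le_integral_det (H := fun θ => V.conjTranspose * H θ * V)
    ((continuous_const.matrix_mul hcont).matrix_mul continuous_const) (fun θ => by
      simp only [hper θ])
    (fun θ => Matrix.isHermitian_conjTranspose_mul_mul _ (hherm θ))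
    (fun θ x => by rw [hermQuad_conj]; exact hpos _ _) hl0 fun q => by
      let q' : Fin m → Polynomial ℂ := fun a => ∑ b, Polynomial.C (V a b) * q b
      have hq' : ∀ z, (fun a => (q' a).eval z) = V.mulVec fun a => (q a).eval z := fun z => by
        ext a
        simp [q', Polynomial.eval_finsetSum, Matrix.mulVec, dotProduct]
      have := hsub q'
      simp only [hq', ← hermQuad_conj, hdiag, hermQuad_diagonal] at this
      exact this
  simp only [hdet] at key
  refine le_of_eq_of_le ?_ key
  rw [← hdet, hdiag, Matrix.det_diagonal, ← Complex.ofReal_prod, Complex.ofReal_re]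

end Szego

/-! ### Maximum principle and mean values in one variable -/

section OneVariable

open Metric Real

/-- Continuous functions on a circle are approximated from above by the real parts of polynomials,
that is, the Dirichlet problem has approximate solutions. -/
theorem exists_polynomial_re_near {a : ℂ} {r : ℝ} (hr : 0 < r) {g : ℂ → ℝ}
    (hg : ContinuousOn g (sphere a r)) {ε : ℝ} (hε : 0 < ε) :
    ∃ p : Polynomial ℂ, ∀ z ∈ sphere a r, g z ≤ (p.eval z).re ∧ (p.eval z).re ≤ g z + ε := by
  have hcont : Continuous fun θ : ℝ => (g (circleMap a r θ) : ℂ) :=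
    Complex.continuous_ofReal.comp (hg.comp_continuous (continuous_circleMap a r) fun θ =>
      circleMap_mem_sphere a hr.le θ)
  have hper : Function.Periodic (fun θ : ℝ => (g (circleMap a r θ) : ℂ)) (2 * π) := fun θ => by
    simp only [periodic_circleMap a r θ]
  obtain ⟨d, f, hf, hfg⟩ := exists_trigPoly_near hcont hper (half_pos hε)
  obtain ⟨p, hp⟩ := exists_polynomial_re_eq hf
  refine ⟨p.comp (Polynomial.C ((r : ℂ)⁻¹) * (Polynomial.X - Polynomial.C a)) +
    Polynomial.C ((ε / 2 : ℝ) : ℂ), fun z hz => ?_⟩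
  obtain ⟨θ, rfl⟩ : ∃ θ, circleMap a r θ = z := by
    have := range_circleMap a r
    rw [abs_of_pos hr] at this
    rw [← this] at hz
    exact hz
  have hrC : (r : ℂ) ≠ 0 := by exact_mod_cast hr.ne'
  have h1 : (r : ℂ)⁻¹ * (circleMap a r θ - a) = Complex.exp (θ * Complex.I) := by
    rw [circleMap_sub_center, circleMap_zero, inv_mul_cancel_left₀ hrC]
  simp only [Polynomial.eval_add, Polynomial.eval_comp, Polynomial.eval_mul, Polynomial.eval_C,
    Polynomial.eval_sub, Polynomial.eval_X, h1, Complex.add_re, ← hp, Complex.ofReal_re]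
  have h2 := hfg θ
  have h3 := (Complex.abs_re_le_norm _).trans_lt h2
  rw [Complex.sub_re, Complex.ofReal_re, abs_lt] at h3
  constructor <;> linarith [h3.1, h3.2]

/-- The weak maximum principle for functions which are locally constant near their local maxima. -/
theorem le_of_le_sphere_of_isLocalMax {a : ℂ} {r : ℝ} (hr : 0 < r) {F : ℂ → ℝ}
    (hF : ContinuousOn F (closedBall a r))
    (hmax : ∀ x ∈ ball a r, IsLocalMax F x → ∀ᶠ y in 𝓝 x, F y = F x) {M : ℝ}
    (hM : ∀ z ∈ sphere a r, F z ≤ M) : F a ≤ M := by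
  obtain ⟨x₀, hx₀, hx₀max⟩ := (isCompact_closedBall a r).exists_isMaxOn
    ⟨a, mem_closedBall_self hr.le⟩ hF
  refine (hx₀max (mem_closedBall_self hr.le)).trans ?_
  by_contra! hlt
  -- the set of maximum points is open and closed in the plane
  let S : Set ℂ := {z | z ∈ closedBall a r ∧ F z = F x₀}
  have hSball : ∀ z ∈ S, z ∈ ball a r := fun z hz => by
    rcases (mem_closedBall.1 hz.1).lt_or_eq with h | h
    · exact h
    · have := hM z h
      rw [hz.2] at this
      linarith
  have hclosed : IsClosed S := by
    have : S = closedBall a r ∩ F ⁻¹' {F x₀} := rfl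
    rw [this]
    exact hF.preimage_isClosed_of_isClosed isClosed_closedBall isClosed_singleton
  have hopen : IsOpen S := by
    rw [isOpen_iff_mem_nhds]
    intro z hz
    have hzb := isOpen_ball.mem_nhds (hSball z hz)
    have hloc : IsLocalMax F z := by
      filter_upwards [hzb] with y hy
      rw [hz.2]
      exact hx₀max (ball_subset_closedBall hy)
    filter_upwards [hmax z (hSball z hz) hloc, hzb] with y hy hyb
    exact ⟨ball_subset_closedBall hyb, hy.trans hz.2⟩
  have huniv : S = univ := IsClopen.eq_univ ⟨hclosed, hopen⟩ ⟨x₀, hx₀, rfl⟩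
  have hout : a + (r : ℂ) ∈ S := by rw [huniv]; trivial
  have := hSball _ hout
  simp [abs_of_pos hr] at this

theorem circleAverage_re_polynomial (p : Polynomial ℂ) (a : ℂ) (r : ℝ) :
    circleAverage (fun z => (p.eval z).re) a r = (p.eval a).re := by
  have h1 : circleAverage (fun z => p.eval z) a r = p.eval a :=
    DiffContOnCl.circleAverage p.differentiable.diffContOnCl
  have h2 := Complex.reCLM.circleAverage_comp_comm (f := fun z => p.eval z) (c := a) (R := r)
    (p.continuous.continuousOn.circleIntegrable')
  rw [h1] at h2
  exact h2

/-- The strong maximum principle, in the form needed here: only the means over circles around the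
maximum point `a` matter. -/
theorem eq_of_isMax_of_le_circleAverage {a : ℂ} {R : ℝ} {F : ℂ → ℝ}
    (hF : ContinuousOn F (ball a R)) (hsub : ∀ r, 0 < r → r < R → F a ≤ circleAverage F a r)
    (hmax : ∀ z ∈ ball a R, F z ≤ F a) : ∀ z ∈ ball a R, F z = F a := by
  intro z hz
  refine le_antisymm (hmax z hz) ?_
  by_contra! hlt
  have hza : z ≠ a := by
    rintro rfl
    exact lt_irrefl _ hlt
  set r := dist z a with hr
  have hr0 : 0 < r := dist_pos.2 hza
  have hrR : r < R := hz
  have hsph : sphere a r ⊆ ball a R := fun w hw => by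
    rw [mem_ball, mem_sphere.1 hw]
    exact hrR
  have hcont : Continuous fun θ : ℝ => F a - F (circleMap a r θ) :=
    continuous_const.sub ((hF.mono hsph).comp_continuous (continuous_circleMap a r)
      fun θ => circleMap_mem_sphere a hr0.le θ)
  obtain ⟨θ, hθ, hθz⟩ : ∃ θ ∈ Ioc 0 (2 * π), circleMap a r θ = z := by
    have : z ∈ circleMap a r '' Ioc 0 (2 * π) := by
      rw [image_circleMap_Ioc]
      rw [abs_of_pos hr0]
      exact rfl
    exact this
  have hpos : 0 < ∫ θ in 0..2 * π, (F a - F (circleMap a r θ)) := by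
    refine intervalIntegral.integral_pos two_pi_pos hcont.continuousOn (fun θ _ => ?_)
      ⟨θ, ⟨hθ.1.le, hθ.2⟩, ?_⟩
    · exact sub_nonneg.2 (hmax _ (hsph (circleMap_mem_sphere a hr0.le θ)))
    · rw [hθz]
      exact sub_pos.2 hlt
  have hint : IntervalIntegrable (fun θ => F (circleMap a r θ)) volume 0 (2 * π) :=
    ((hF.mono hsph).comp_continuous (continuous_circleMap a r)
      fun θ => circleMap_mem_sphere a hr0.le θ).intervalIntegrable _ _
  rw [intervalIntegral.integral_sub intervalIntegrable_const hint,
    intervalIntegral.integral_const, sub_zero, smul_eq_mul] at hpos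
  have h1 := hsub r hr0 hrR
  rw [circleAverage_def, smul_eq_mul, ← div_eq_inv_mul, le_div_iff₀ two_pi_pos] at h1
  linarith

theorem deriv_deriv_nonpos_of_isLocalMax {g : ℝ → ℝ} (hg : ContinuousAt g 0) (hmax : IsLocalMax g 0) :
    deriv (deriv g) 0 ≤ 0 := by
  by_contra! hpos
  have hd : deriv g 0 = 0 := hmax.deriv_eq_zero
  have hmin := isLocalMin_of_deriv_deriv_pos hpos hd hg
  have heq : g =ᶠ[𝓝 0] fun _ => g 0 := by
    filter_upwards [hmax, hmin] with t h1 h2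
    exact le_antisymm h1 h2
  have h2 := heq.deriv.deriv_eq
  simp only [deriv_const'] at h2
  rw [h2] at hpos
  simp at hpos

/-- The derivative of `f` in the direction `v`. -/
noncomputable def dirDeriv {E : Type*} [NormedAddCommGroup E] [NormedSpace ℝ E] (v : E)
    (f : E → ℝ) (x : E) : ℝ := fderiv ℝ f x v

theorem dirDeriv_dirDeriv_eq_deriv {E : Type*} [NormedAddCommGroup E] [NormedSpace ℝ E] {v : E}
    {f : E → ℝ} (hf : ContDiff ℝ 2 f) (x : E) :
    deriv (deriv fun t : ℝ => f (x + t • v)) 0 = dirDeriv v (dirDeriv v f) x := by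
  have hline : ∀ t : ℝ, HasDerivAt (fun t : ℝ => x + t • v) v t := fun t => by
    simpa using ((hasDerivAt_id t).smul_const v).const_add x
  have h1 : (deriv fun t : ℝ => f (x + t • v)) = fun t => dirDeriv v f (x + t • v) := by
    ext t
    exact (((hf.differentiable (by norm_num)) _).hasFDerivAt.comp_hasDerivAt t (hline t)).deriv
  have hd : Differentiable ℝ (dirDeriv v f) := by
    have : ContDiff ℝ 1 (dirDeriv v f) :=
      (hf.fderiv_right (m := 1) (by norm_num)).clm_apply contDiff_const
    exact this.differentiable (by norm_num)
  rw [h1]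
  have := ((hd (x + (0 : ℝ) • v)).hasFDerivAt.comp_hasDerivAt 0 (hline 0)).deriv
  simpa [dirDeriv, Function.comp_def] using this

theorem dirDeriv_dirDeriv_nonpos_of_isLocalMax {E : Type*} [NormedAddCommGroup E] [NormedSpace ℝ E] {v : E}
    {f : E → ℝ} (hf : ContDiff ℝ 2 f) {x : E} (hmax : IsLocalMax f x) :
    dirDeriv v (dirDeriv v f) x ≤ 0 := by
  rw [← dirDeriv_dirDeriv_eq_deriv hf]
  have hc : Continuous fun t : ℝ => x + t • v := by fun_prop
  have hc0 : Filter.Tendsto (fun t : ℝ => x + t • v) (𝓝 0) (𝓝 x) := by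
    simpa using hc.tendsto 0
  refine deriv_deriv_nonpos_of_isLocalMax (hf.continuous.comp hc).continuousAt ?_
  have := hc0.eventually hmax
  simpa [IsLocalMax, IsMaxFilter] using this

theorem dirDeriv_dirDeriv_add {E : Type*} [NormedAddCommGroup E] [NormedSpace ℝ E] {v : E}
    {f g : E → ℝ} (hf : ContDiff ℝ 2 f) (hg : ContDiff ℝ 2 g) (x : E) :
    dirDeriv v (dirDeriv v fun y => f y + g y) x =
      dirDeriv v (dirDeriv v f) x + dirDeriv v (dirDeriv v g) x := by
  have hd : ∀ {h : E → ℝ}, ContDiff ℝ 2 h → Differentiable ℝ (dirDeriv v h) := fun hh =>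
    ((hh.fderiv_right (m := 1) (by norm_num)).clm_apply contDiff_const).differentiable
      (by norm_num)
  have h1 : dirDeriv v (fun y => f y + g y) = fun y => dirDeriv v f y + dirDeriv v g y := by
    ext y
    simp only [dirDeriv]
    rw [fderiv_fun_add (hf.differentiable (by norm_num) y) (hg.differentiable (by norm_num) y)]
    rfl
  rw [h1]
  simp only [dirDeriv]
  have := fderiv_fun_add (hd hf x) (hd hg x)
  simp only [dirDeriv] at this
  rw [this]
  rfl

theorem laplacian_re_polynomial (p : Polynomial ℂ) (x : ℂ) :
    dirDeriv 1 (dirDeriv 1 fun z => (p.eval z).re) x +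
      dirDeriv Complex.I (dirDeriv Complex.I fun z => (p.eval z).re) x = 0 := by
  have h1 : ∀ (q : Polynomial ℂ) (v w x : ℂ),
      dirDeriv v (fun z => (q.eval z * w).re) x = (q.derivative.eval x * w * v).re := by
    intro q v w x
    have h2 : HasFDerivAt (𝕜 := ℝ) (fun z => (q.eval z * w).re)
        (Complex.reCLM.comp (((ContinuousLinearMap.toSpanSingleton ℂ
          (q.derivative.eval x * w)).restrictScalars ℝ))) x :=
      Complex.reCLM.hasFDerivAt.comp (f := fun z => q.eval z * w) x
        (((q.hasDerivAt x).mul_const w).hasFDerivAt.restrictScalars ℝ)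
    rw [dirDeriv, h2.fderiv]
    simp [mul_comm]
  have h3 : ∀ v, dirDeriv v (fun z => (p.eval z).re) = fun z => (p.derivative.eval z * v).re := by
    intro v
    ext z
    have := h1 p v 1 z
    simpa using this
  rw [h3, h3, h1, h1]
  simp [mul_assoc]

theorem laplacian_normSq (c : ℝ) (a x : ℂ) :
    dirDeriv 1 (dirDeriv 1 fun z => c * Complex.normSq (z - a)) x +
      dirDeriv Complex.I (dirDeriv Complex.I fun z => c * Complex.normSq (z - a)) x = 4 * c := by
  have hre : ∀ z : ℂ, HasFDerivAt (fun z : ℂ => (z - a).re) Complex.reCLM z := fun z =>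
    Complex.reCLM.hasFDerivAt.comp z ((hasFDerivAt_id z).sub_const a)
  have him : ∀ z : ℂ, HasFDerivAt (fun z : ℂ => (z - a).im) Complex.imCLM z := fun z =>
    Complex.imCLM.hasFDerivAt.comp z ((hasFDerivAt_id z).sub_const a)
  have h1 : ∀ v : ℂ, dirDeriv v (fun z => c * Complex.normSq (z - a)) =
      fun z => c * (2 * (z - a).re * v.re + 2 * (z - a).im * v.im) := by
    intro v
    ext z
    have : HasFDerivAt (fun z => c * Complex.normSq (z - a)) _ z :=
      (((hre z).mul (hre z)).add ((him z).mul (him z))).const_mul c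
    rw [dirDeriv, this.fderiv]
    simp
    ring
  have h2 : ∀ v : ℂ, dirDeriv v (fun z => c * (2 * (z - a).re * v.re + 2 * (z - a).im * v.im)) x =
      c * (2 * v.re ^ 2 + 2 * v.im ^ 2) := by
    intro v
    have : HasFDerivAt (fun z => c * (2 * (z - a).re * v.re + 2 * (z - a).im * v.im)) _ x :=
      ((((hre x).const_mul 2).mul_const v.re).add
        (((him x).const_mul 2).mul_const v.im)).const_mul c
    rw [dirDeriv, this.fderiv]
    simp
    ring
  rw [h1, h1, h2, h2]
  simp
  ring

theorem contDiff_re_polynomial (p : Polynomial ℂ) : ContDiff ℝ 2 fun z : ℂ => (p.eval z).re :=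
  have h : ContDiff ℂ 2 fun z : ℂ => p.eval z := by
    simpa using Polynomial.contDiff_aeval (𝕜 := ℂ) p 2
  Complex.reCLM.contDiff.comp (h.restrict_scalars ℝ)

theorem contDiff_normSq (c : ℝ) (a : ℂ) : ContDiff ℝ 2 fun z : ℂ => c * Complex.normSq (z - a) := by
  have hre : ContDiff ℝ 2 fun z : ℂ => (z - a).re :=
    Complex.reCLM.contDiff.comp (contDiff_id.sub contDiff_const)
  have him : ContDiff ℝ 2 fun z : ℂ => (z - a).im :=
    Complex.imCLM.contDiff.comp (contDiff_id.sub contDiff_const)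
  exact contDiff_const.mul ((hre.mul hre).add (him.mul him))

/-- Functions with `∂∂̄f ≥ c`, that is, with Laplacian at least `4c`, satisfy a sharpened submean
value property. -/
theorem add_le_circleAverage_of_laplacian {f : ℂ → ℝ} (hf : ContDiff ℝ 2 f) {a : ℂ} {r : ℝ}
    (hr : 0 < r) {c : ℝ}
    (hlap : ∀ x ∈ ball a r, 4 * c ≤ dirDeriv 1 (dirDeriv 1 f) x +
      dirDeriv Complex.I (dirDeriv Complex.I f) x) :
    f a + c * r ^ 2 ≤ circleAverage f a r := by
  refine le_of_forall_pos_le_add fun ε hε => ?_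
  obtain ⟨κ, hκ, hκr⟩ : ∃ κ : ℝ, 0 < κ ∧ κ * r ^ 2 = ε / 2 :=
    ⟨ε / 2 / r ^ 2, by positivity, by field_simp⟩
  obtain ⟨p, hp⟩ := exists_polynomial_re_near hr hf.continuous.continuousOn (half_pos hε)
    (a := a)
  -- the polynomial `p` almost has the values of `f` on the circle; the term with `κ` makes the Laplacian
  -- of `F` positive, which excludes local maxima
  let F : ℂ → ℝ := fun z => f z + ((-p).eval z).re + (κ - c) * Complex.normSq (z - a)
  have hF2 : ContDiff ℝ 2 fun z => f z + ((-p).eval z).re := hf.add (contDiff_re_polynomial _)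
  have hF : ContDiff ℝ 2 F := hF2.add (contDiff_normSq _ _)
  have hFmax : F a ≤ (κ - c) * r ^ 2 := by
    refine le_of_le_sphere_of_isLocalMax hr hF.continuous.continuousOn (fun x hx hmax => ?_)
      fun z hz => ?_
    · exfalso
      have h1 := dirDeriv_dirDeriv_nonpos_of_isLocalMax (v := 1) hF hmax
      have h2 := dirDeriv_dirDeriv_nonpos_of_isLocalMax (v := Complex.I) hF hmax
      rw [dirDeriv_dirDeriv_add hF2 (contDiff_normSq _ _),
        dirDeriv_dirDeriv_add hf (contDiff_re_polynomial _)] at h1 h2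
      have h3 := laplacian_re_polynomial (-p) x
      have h4 := laplacian_normSq (κ - c) a x
      have h5 := hlap x hx
      linarith
    · have h1 : Complex.normSq (z - a) = r ^ 2 := by
        rw [Complex.normSq_eq_norm_sq, ← dist_eq_norm, mem_sphere.1 hz]
      simp only [F, h1, Polynomial.eval_neg, Complex.neg_re]
      linarith [(hp z hz).1]
  have h2 : circleAverage (fun z => (p.eval z).re) a r ≤ circleAverage f a r + ε / 2 := by
    have h3 : circleAverage (fun z => f z + ε / 2) a r = circleAverage f a r + ε / 2 := by
      rw [circleAverage_fun_add (hf.continuous.continuousOn.circleIntegrable')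
        continuousOn_const.circleIntegrable', circleAverage_const]
    rw [← h3]
    refine circleAverage_mono (contDiff_re_polynomial p).continuous.continuousOn.circleIntegrable'
      (hf.continuous.add continuous_const).continuousOn.circleIntegrable' fun z hz => ?_
    rw [abs_of_pos hr] at hz
    exact (hp z hz).2
  rw [circleAverage_re_polynomial] at h2
  simp only [F, sub_self, map_zero, mul_zero, add_zero, Polynomial.eval_neg,
    Complex.neg_re] at hFmax
  linarith

end OneVariable

/-! ### Subharmonicity of logarithms -/

section LogSubharmonic

open Metric Real

theorem circleAverage_eq_integral_unit (w : ℂ → ℝ) (a : ℂ) (r : ℝ) :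
    circleAverage w a r = ∫ t in Ioc (0 : ℝ) 1, w (circleMap a r (2 * π * t)) := by
  rw [circleAverage_def, ← intervalIntegral.integral_of_le zero_le_one,
    intervalIntegral.integral_comp_mul_left (fun θ => w (circleMap a r θ)) two_pi_pos.ne']
  simp

theorem continuous_circle_unit {X : Type*} [TopologicalSpace X] {w : ℂ → X} {a : ℂ} {r : ℝ}
    (hr : 0 < r) (hw : ContinuousOn w (sphere a r)) :
    Continuous fun t : ℝ => w (circleMap a r (2 * π * t)) :=
  hw.comp_continuous ((continuous_circleMap a r).comp (by fun_prop)) fun _ =>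
    circleMap_mem_sphere a hr.le _

theorem lintegral_unit_ne_top {g : ℝ → ℝ} (hg : Continuous g) :
    ∫⁻ t in Ioc (0 : ℝ) 1, ENNReal.ofReal (g t) ≠ ⊤ := by
  have hint : IntegrableOn g (Ioc 0 1) := hg.integrableOn_Ioc
  exact hint.lintegral_lt_top.ne

theorem circleMean_coe {w : ℂ → ℝ} {a : ℂ} {r : ℝ} (hr : 0 < r)
    (hw : ContinuousOn w (sphere a r)) :
    circleMean (fun x => (w x : EReal)) a r = ((circleAverage w a r : ℝ) : EReal) := by
  have hg := continuous_circle_unit hr hw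
  have hint : IntegrableOn (fun t : ℝ => w (circleMap a r (2 * π * t))) (Ioc 0 1) :=
    hg.integrableOn_Ioc
  rw [circleAverage_eq_integral_unit, integral_eq_lintegral_pos_part_sub_lintegral_neg_part hint]
  simp only [circleMean, ← EReal.coe_neg, EReal.real_coe_toENNReal]
  rw [EReal.coe_sub, EReal.coe_ennreal_toReal (lintegral_unit_ne_top hg),
    EReal.coe_ennreal_toReal (lintegral_unit_ne_top
      (g := fun t => -w (circleMap a r (2 * π * t))) hg.neg)]

theorem SubharmonicOn.le_circleAverage {w : ℂ → ℝ} {Ω : Set ℂ}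
    (h : SubharmonicOn (fun x => (w x : EReal)) Ω) (hw : ContinuousOn w Ω) {a : ℂ} {r : ℝ}
    (hr : 0 < r) (hΩ : closedBall a r ⊆ Ω) : w a ≤ circleAverage w a r := by
  have := h.le_circleMean a r hr hΩ
  rw [circleMean_coe hr (hw.mono (sphere_subset_closedBall.trans hΩ))] at this
  exact_mod_cast this

/-- The submean value inequality for `log v` follows from those for the functions `log (v + ε)` on
the circle, by monotone convergence. -/
theorem log_le_circleMean {v : ℂ → ℝ} {a : ℂ} {r : ℝ} (hr : 0 < r)
    (hv : ContinuousOn v (sphere a r)) (h0 : ∀ z ∈ sphere a r, 0 ≤ v z)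
    (h : ∀ ε, 0 < ε → v a ≤ exp (circleAverage (fun z => log (v z + ε)) a r)) :
    ENNReal.log (ENNReal.ofReal (v a)) ≤
      circleMean (fun z => ENNReal.log (ENNReal.ofReal (v z))) a r := by
  rcases le_or_gt (v a) 0 with ha | ha
  · rw [ENNReal.ofReal_of_nonpos ha, ENNReal.log_zero]
    exact bot_le
  set ε : ℕ → ℝ := fun n => 1 / ((n : ℝ) + 1) with hε
  have hεpos : ∀ n, 0 < ε n := fun n => Nat.one_div_pos_of_nat
  have hεlim : Filter.Tendsto ε Filter.atTop (𝓝 0) := tendsto_one_div_add_atTop_nhds_zero_nat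
  have hεanti : Antitone ε := fun m n hmn => Nat.one_div_le_one_div hmn
  set g : ℝ → ℝ := fun t => v (circleMap a r (2 * π * t)) with hg
  have hgcont : Continuous g := continuous_circle_unit hr hv
  have hg0 : ∀ t, 0 ≤ g t := fun t => h0 _ (circleMap_mem_sphere a hr.le _)
  let Φ : ℝ≥0∞ → ℝ≥0∞ := fun y => (ENNReal.log y).toENNReal
  let Ψ : ℝ≥0∞ → ℝ≥0∞ := fun y => (-ENNReal.log y).toENNReal
  have hΦ : Continuous Φ := EReal.continuous_toENNReal.comp ENNReal.continuous_log
  have hΨ : Continuous Ψ :=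
    EReal.continuous_toENNReal.comp (continuous_neg.comp ENNReal.continuous_log)
  have hΦmono : Monotone Φ := fun x y hxy => EReal.toENNReal_le_toENNReal (ENNReal.log_monotone hxy)
  have hΨanti : Antitone Ψ := fun x y hxy =>
    EReal.toENNReal_le_toENNReal (EReal.neg_le_neg_iff.2 (ENNReal.log_monotone hxy))
  let P : ℕ → ℝ≥0∞ := fun n => ∫⁻ t in Ioc (0 : ℝ) 1, Φ (ENNReal.ofReal (g t + ε n))
  let N : ℕ → ℝ≥0∞ := fun n => ∫⁻ t in Ioc (0 : ℝ) 1, Ψ (ENNReal.ofReal (g t + ε n))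
  have hpt : ∀ t, Filter.Tendsto (fun n => ENNReal.ofReal (g t + ε n)) Filter.atTop
      (𝓝 (ENNReal.ofReal (g t))) := fun t =>
    (ENNReal.continuous_ofReal.tendsto _).comp (by simpa using hεlim.const_add (g t))
  have hmeas : ∀ n, Measurable fun t => ENNReal.ofReal (g t + ε n) := fun n =>
    ENNReal.continuous_ofReal.measurable.comp (hgcont.add continuous_const).measurable
  have hP : Filter.Tendsto P Filter.atTop
      (𝓝 (∫⁻ t in Ioc (0 : ℝ) 1, Φ (ENNReal.ofReal (g t)))) := by
    refine tendsto_lintegral_of_dominated_convergence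
      (fun t => Φ (ENNReal.ofReal (g t + ε 0))) (fun n => hΦ.measurable.comp (hmeas n)) (fun n => ?_)
      ?_ (Filter.Eventually.of_forall fun t => (hΦ.tendsto _).comp (hpt t))
    · refine Filter.Eventually.of_forall fun t => hΦmono (ENNReal.ofReal_le_ofReal ?_)
      exact add_le_add_right (hεanti (Nat.zero_le n)) _
    · have h1 : ∀ t, Φ (ENNReal.ofReal (g t + ε 0)) = ENNReal.ofReal (log (g t + ε 0)) := fun t => by
        simp only [Φ]
        rw [ENNReal.log_ofReal_of_pos (add_pos_of_nonneg_of_pos (hg0 t) (hεpos 0)),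
          EReal.real_coe_toENNReal]
      simp only [h1]
      exact lintegral_unit_ne_top ((hgcont.add continuous_const).log fun t =>
        (add_pos_of_nonneg_of_pos (hg0 t) (hεpos 0)).ne')
  have hN : Filter.Tendsto N Filter.atTop
      (𝓝 (∫⁻ t in Ioc (0 : ℝ) 1, Ψ (ENNReal.ofReal (g t)))) := by
    refine lintegral_tendsto_of_tendsto_of_monotone
      (fun n => (hΨ.measurable.comp (hmeas n)).aemeasurable)
      (Filter.Eventually.of_forall fun t m n hmn => hΨanti (ENNReal.ofReal_le_ofReal ?_))
      (Filter.Eventually.of_forall fun t => (hΨ.tendsto _).comp (hpt t))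
    exact add_le_add_right (hεanti hmn) _
  have hNmono : Monotone N := fun m n hmn => lintegral_mono fun t =>
    hΨanti (ENNReal.ofReal_le_ofReal (add_le_add_right (hεanti hmn) _))
  have hstep : ∀ n, ((log (v a) : ℝ) : EReal) + N n ≤ P n := fun n => by
    have hpos : ∀ z ∈ sphere a r, 0 < v z + ε n := fun z hz =>
      add_pos_of_nonneg_of_pos (h0 z hz) (hεpos n)
    have h1 : log (v a) ≤ circleAverage (fun z => log (v z + ε n)) a r := by
      rw [Real.log_le_iff_le_exp ha]
      exact h _ (hεpos n)
    have h2 := circleMean_coe hr (w := fun z => log (v z + ε n))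
      ((hv.add continuousOn_const).log fun z hz => (hpos z hz).ne')
    have h3 : circleMean (fun z => ((log (v z + ε n) : ℝ) : EReal)) a r = (P n : EReal) - N n := by
      simp only [circleMean, P, N, Φ, Ψ]
      congr 3 <;>
      · ext t
        rw [ENNReal.log_ofReal_of_pos (add_pos_of_nonneg_of_pos (hg0 t) (hεpos n))]
    refine EReal.add_le_of_le_sub ?_
    rw [← h3, h2]
    exact_mod_cast h1
  have hlim1 : ∀ k, ((log (v a) : ℝ) : EReal) + N k ≤
      (∫⁻ t in Ioc (0 : ℝ) 1, Φ (ENNReal.ofReal (g t)) : ℝ≥0∞) := fun k => by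
    refine ge_of_tendsto ((continuous_coe_ennreal_ereal.tendsto _).comp hP) ?_
    filter_upwards [Filter.eventually_ge_atTop k] with n hn
    refine le_trans ?_ (hstep n)
    gcongr
    exact EReal.coe_ennreal_le_coe_ennreal_iff.2 (hNmono hn)
  have hlim2 : ((log (v a) : ℝ) : EReal) + (∫⁻ t in Ioc (0 : ℝ) 1, Ψ (ENNReal.ofReal (g t)) : ℝ≥0∞) ≤
      (∫⁻ t in Ioc (0 : ℝ) 1, Φ (ENNReal.ofReal (g t)) : ℝ≥0∞) := by
    have hc : ContinuousAt (fun p : EReal × EReal => p.1 + p.2) (((log (v a) : ℝ) : EReal),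
        ((∫⁻ t in Ioc (0 : ℝ) 1, Ψ (ENNReal.ofReal (g t)) : ℝ≥0∞) : EReal)) :=
      EReal.continuousAt_add (.inl (EReal.coe_ne_top _)) (.inl (EReal.coe_ne_bot _))
    exact le_of_tendsto' (hc.tendsto.comp (tendsto_const_nhds.prodMk_nhds
      ((continuous_coe_ennreal_ereal.tendsto _).comp hN))) hlim1
  have hfin : ∫⁻ t in Ioc (0 : ℝ) 1, Φ (ENNReal.ofReal (g t)) ≠ ⊤ := by
    refine ne_top_of_le_ne_top (b := ∫⁻ t in Ioc (0 : ℝ) 1, ENNReal.ofReal (g t))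
      (lintegral_unit_ne_top hgcont) (lintegral_mono fun t => ?_)
    simp only [Φ, ENNReal.log_ofReal]
    split_ifs with ht
    · simp
    · rw [EReal.real_coe_toENNReal]
      exact ENNReal.ofReal_le_ofReal (log_le_self (hg0 t))
  rw [ENNReal.log_ofReal_of_pos ha]
  change _ ≤ ((∫⁻ t in Ioc (0 : ℝ) 1, Φ (ENNReal.ofReal (g t)) : ℝ≥0∞) : EReal) -
    ((∫⁻ t in Ioc (0 : ℝ) 1, Ψ (ENNReal.ofReal (g t)) : ℝ≥0∞) : EReal)
  rw [EReal.le_sub_iff_add_le (.inl (EReal.coe_ennreal_ne_bot _))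
    (.inr (by simpa using hfin))]
  exact hlim2

/-- A continuous function `v ≥ 0` is logarithmically subharmonic, if for all polynomials `p` the
function `v |exp p|` is locally constant near its local maxima. -/
theorem subharmonicOn_log {v : ℂ → ℝ} {Ω : Set ℂ} (hv : ContinuousOn v Ω)
    (h0 : ∀ z ∈ Ω, 0 ≤ v z)
    (hmax : ∀ x ∈ Ω, ∀ p : Polynomial ℂ, IsLocalMax (fun z => v z * exp (p.eval z).re) x →
      ∀ᶠ y in 𝓝 x, v y * exp (p.eval y).re = v x * exp (p.eval x).re) :
    SubharmonicOn (fun z => ENNReal.log (ENNReal.ofReal (v z))) Ω := by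
  refine ⟨fun a _ => ENNReal.log_eq_top_iff.not.2 ENNReal.ofReal_ne_top, ?_, fun a r hr hΩ => ?_⟩
  · exact ((ENNReal.continuous_log.comp ENNReal.continuous_ofReal).comp_continuousOn
      hv).upperSemicontinuousOn
  · have hsph := sphere_subset_closedBall.trans hΩ
    refine log_le_circleMean hr (hv.mono hsph) (fun z hz => h0 z (hsph hz)) fun ε hε => ?_
    have hpos : ∀ z ∈ sphere a r, 0 < v z + ε := fun z hz =>
      add_pos_of_nonneg_of_pos (h0 z (hsph hz)) hε
    have hlogc : ContinuousOn (fun z => log (v z + ε)) (sphere a r) :=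
      ((hv.mono hsph).add continuousOn_const).log fun z hz => (hpos z hz).ne'
    have key : ∀ δ, 0 < δ → v a ≤ exp (circleAverage (fun z => log (v z + ε)) a r + δ) := by
      intro δ hδ
      -- `v |exp (-p)| ≤ 1` on the circle, hence at the centre, by the maximum principle
      obtain ⟨p, hp⟩ := exists_polynomial_re_near hr hlogc hδ
      have h1 : v a * exp ((-p).eval a).re ≤ 1 := by
        refine le_of_le_sphere_of_isLocalMax hr (F := fun z => v z * exp ((-p).eval z).re) ?_
          (fun x hx hx' => hmax x (hΩ (ball_subset_closedBall hx)) (-p) hx') fun z hz => ?_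
        · exact (hv.mono hΩ).mul
            (continuous_exp.comp (Complex.continuous_re.comp (-p).continuous)).continuousOn
        · have h2 := (hp z hz).1
          rw [log_le_iff_le_exp (hpos z hz)] at h2
          rw [Polynomial.eval_neg, Complex.neg_re, exp_neg, ← div_eq_mul_inv,
            div_le_one (exp_pos _)]
          linarith
      rw [Polynomial.eval_neg, Complex.neg_re, exp_neg, ← div_eq_mul_inv,
        div_le_one (exp_pos _)] at h1
      refine h1.trans (exp_le_exp.2 ?_)
      rw [← circleAverage_re_polynomial p a r]
      have h3 : circleAverage (fun z => log (v z + ε) + δ) a r =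
          circleAverage (fun z => log (v z + ε)) a r + δ := by
        rw [circleAverage_fun_add (hlogc.circleIntegrable hr.le)
          continuousOn_const.circleIntegrable', circleAverage_const]
      rw [← h3]
      refine circleAverage_mono (contDiff_re_polynomial p).continuous.continuousOn.circleIntegrable'
        ((hlogc.add continuousOn_const).circleIntegrable hr.le) fun z hz => ?_
      rw [abs_of_pos hr] at hz
      exact (hp z hz).2
    have hlim : Filter.Tendsto (fun δ : ℝ => exp (circleAverage (fun z => log (v z + ε)) a r + δ))
        (𝓝[>] 0) (𝓝 (exp (circleAverage (fun z => log (v z + ε)) a r + 0))) :=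
      ((continuous_exp.comp (continuous_const.add continuous_id)).tendsto 0).mono_left
        nhdsWithin_le_nhds
    rw [add_zero] at hlim
    exact ge_of_tendsto hlim (Filter.eventually_of_mem self_mem_nhdsWithin key)

end LogSubharmonic

/-! ### Restriction of weak `∂∂̄`-equations to complex lines -/

section Mollification

open Metric

variable {n : ℕ}

/-- The values on the diagonal of the sesquilinear form `∑ b_{jk} dz_j ∧ dz̄_k`. -/
noncomputable def coeffForm (b : Fin n → Fin n → (Fin n → ℂ) → ℂ) (x ζ : Fin n → ℂ) : ℂ :=
  ∑ j, ∑ k, b j k x * (ζ j * conj (ζ k))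

/-- The weak equation `∂∂̄u = b` in an open subset of `ℂⁿ`. -/
def WeakDDbar (u : (Fin n → ℂ) → ℝ) (b : Fin n → Fin n → (Fin n → ℂ) → ℂ)
    (O : Set (Fin n → ℂ)) : Prop :=
  ∀ j k, ∀ φ : (Fin n → ℂ) → ℂ, ContDiff ℝ ∞ φ → HasCompactSupport φ → tsupport φ ⊆ O →
    ∫ x, (u x : ℂ) * dz j (dzbar k φ) x = ∫ x, b j k x * φ x

theorem WeakDDbar.neg {u : (Fin n → ℂ) → ℝ} {b : Fin n → Fin n → (Fin n → ℂ) → ℂ}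
    {O : Set (Fin n → ℂ)} (h : WeakDDbar u b O) :
    WeakDDbar (fun x => -u x) (fun j k x => -b j k x) O := fun j k φ h1 h2 h3 => by
  have := h j k φ h1 h2 h3
  simp only [Complex.ofReal_neg, neg_mul, integral_neg, this]

theorem dz_dzbar_ofReal {φ : (Fin n → ℂ) → ℝ} (hφ : ContDiff ℝ 2 φ) (j k : Fin n)
    (x : Fin n → ℂ) :
    dz j (dzbar k fun y => (φ y : ℂ)) x =
      (1 / 4 : ℂ) * ((dirDeriv (Pi.single j 1) (dirDeriv (Pi.single k 1) φ) x +
        dirDeriv (Pi.single j Complex.I) (dirDeriv (Pi.single k Complex.I) φ) x : ℝ) +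
      Complex.I * (dirDeriv (Pi.single j 1) (dirDeriv (Pi.single k Complex.I) φ) x -
        dirDeriv (Pi.single j Complex.I) (dirDeriv (Pi.single k 1) φ) x : ℝ)) := by
  have hof : ∀ {f : (Fin n → ℂ) → ℝ} {y : Fin n → ℂ}, DifferentiableAt ℝ f y → ∀ v,
      fderiv ℝ (fun y => (f y : ℂ)) y v = (dirDeriv v f y : ℂ) := fun hf v => by
    have := (Complex.ofRealCLM.hasFDerivAt.comp _ hf.hasFDerivAt).fderiv
    rw [dirDeriv]
    exact congrArg (fun L => L v) this
  have hd : ∀ v, Differentiable ℝ (dirDeriv v φ) := fun v =>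
    ((hφ.fderiv_right (m := 1) (by norm_num)).clm_apply contDiff_const).differentiable
      (by norm_num)
  have h1 : dzbar k (fun y => (φ y : ℂ)) = fun y =>
      (dirDeriv (Pi.single k 1) φ y : ℂ) * (1 / 2) +
        (dirDeriv (Pi.single k Complex.I) φ y : ℂ) * (Complex.I / 2) := by
    ext y
    rw [dzbar, hof (hφ.differentiable (by norm_num) y), hof (hφ.differentiable (by norm_num) y)]
    ring
  have h2 : ∀ v, fderiv ℝ (fun y => (dirDeriv (Pi.single k 1) φ y : ℂ) * (1 / 2) +
        (dirDeriv (Pi.single k Complex.I) φ y : ℂ) * (Complex.I / 2)) x v =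
      (dirDeriv v (dirDeriv (Pi.single k 1) φ) x : ℂ) * (1 / 2) +
        (dirDeriv v (dirDeriv (Pi.single k Complex.I) φ) x : ℂ) * (Complex.I / 2) := by
    intro v
    have hc : ∀ w, DifferentiableAt ℝ (fun y => (dirDeriv w φ y : ℂ)) x := fun w =>
      (Complex.ofRealCLM.differentiableAt.comp x (hd w x))
    rw [fderiv_fun_add ((hc _).mul_const _) ((hc _).mul_const _), fderiv_mul_const (hc _),
      fderiv_mul_const (hc _)]
    simp only [add_apply, smul_apply, hof (hd _ x),
      smul_eq_mul]
    ring
  rw [h1, dz, h2, h2]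
  push_cast
  linear_combination (-(1 / 4 : ℂ)) * (dirDeriv (Pi.single j Complex.I)
    (dirDeriv (Pi.single k Complex.I) φ) x : ℂ) * Complex.I_sq

theorem dirDeriv_smul_add_smul {φ : (Fin n → ℂ) → ℝ} (hφ : ContDiff ℝ 2 φ)
    (a b : Fin n → ℝ) (x : Fin n → ℂ) :
    dirDeriv (fun j => (a j : ℂ) + b j * Complex.I)
      (dirDeriv (fun j => (a j : ℂ) + b j * Complex.I) φ) x =
    ∑ j, ∑ k, (a j * a k * dirDeriv (Pi.single j 1) (dirDeriv (Pi.single k 1) φ) x +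
      a j * b k * dirDeriv (Pi.single j 1) (dirDeriv (Pi.single k Complex.I) φ) x +
      b j * a k * dirDeriv (Pi.single j Complex.I) (dirDeriv (Pi.single k 1) φ) x +
      b j * b k * dirDeriv (Pi.single j Complex.I) (dirDeriv (Pi.single k Complex.I) φ) x) := by
  have hd : ∀ v, Differentiable ℝ (dirDeriv v φ) := fun v =>
    ((hφ.fderiv_right (m := 1) (by norm_num)).clm_apply contDiff_const).differentiable
      (by norm_num)
  have hv : (fun j => (a j : ℂ) + b j * Complex.I : Fin n → ℂ) =
      ∑ j, (a j • (Pi.single j 1 : Fin n → ℂ) + b j • (Pi.single j Complex.I : Fin n → ℂ)) := by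
    ext i
    simp only [Finset.sum_apply, Pi.add_apply, Pi.smul_apply, Finset.sum_add_distrib]
    simp [Pi.single_apply]
  have hexp : ∀ (f : (Fin n → ℂ) → ℝ) y,
      dirDeriv (fun j => (a j : ℂ) + b j * Complex.I) f y =
      ∑ j, (a j * dirDeriv (Pi.single j 1) f y + b j * dirDeriv (Pi.single j Complex.I) f y) := by
    intro f y
    simp only [dirDeriv]
    rw [hv, map_sum]
    simp only [map_add, map_smul, smul_eq_mul]
  have hlin : ∀ v, dirDeriv v (dirDeriv (fun j => (a j : ℂ) + b j * Complex.I) φ) x =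
      ∑ k, (a k * dirDeriv v (dirDeriv (Pi.single k 1) φ) x +
        b k * dirDeriv v (dirDeriv (Pi.single k Complex.I) φ) x) := by
    intro v
    have h1 : dirDeriv (fun j => (a j : ℂ) + b j * Complex.I) φ = fun y =>
      ∑ k, (a k * dirDeriv (Pi.single k 1) φ y + b k * dirDeriv (Pi.single k Complex.I) φ y) :=
      funext (hexp φ)
    have h2 : HasFDerivAt (fun y => ∑ k, (a k * dirDeriv (Pi.single k 1) φ y +
        b k * dirDeriv (Pi.single k Complex.I) φ y))
        (∑ k, (a k • fderiv ℝ (dirDeriv (Pi.single k 1) φ) x +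
          b k • fderiv ℝ (dirDeriv (Pi.single k Complex.I) φ) x)) x :=
      HasFDerivAt.fun_sum fun k _ => (((hd _ x).hasFDerivAt.const_mul _).add
        ((hd _ x).hasFDerivAt.const_mul _))
    rw [h1, dirDeriv, h2.fderiv]
    simp [dirDeriv]
  rw [hexp]
  simp only [hlin, Finset.mul_sum, ← Finset.sum_add_distrib]
  refine Finset.sum_congr rfl fun j _ => Finset.sum_congr rfl fun k _ => by ring

theorem re_sum_dz_dzbar {φ : (Fin n → ℂ) → ℝ} (hφ : ContDiff ℝ 2 φ) (ζ x : Fin n → ℂ) :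
    (∑ j, ∑ k, dz j (dzbar k fun y => (φ y : ℂ)) x * (ζ j * conj (ζ k))).re =
      (1 / 4) * (dirDeriv ζ (dirDeriv ζ φ) x +
        dirDeriv (Complex.I • ζ) (dirDeriv (Complex.I • ζ) φ) x) := by
  have h1 : ζ = fun j => ((ζ j).re : ℂ) + (ζ j).im * Complex.I := by
    ext j
    exact (Complex.re_add_im _).symm
  have h2 : Complex.I • ζ = fun j => ((-(ζ j).im : ℝ) : ℂ) + ((ζ j).re : ℝ) * Complex.I := by
    ext j
    apply Complex.ext <;> simp
  have e1 := dirDeriv_smul_add_smul hφ (fun j => (ζ j).re) (fun j => (ζ j).im) x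
  have e2 := dirDeriv_smul_add_smul hφ (fun j => -(ζ j).im) (fun j => (ζ j).re) x
  rw [← h1] at e1
  rw [← h2] at e2
  rw [e1, e2, ← Finset.sum_add_distrib, Finset.mul_sum, Complex.re_sum]
  refine Finset.sum_congr rfl fun j _ => ?_
  rw [← Finset.sum_add_distrib, Finset.mul_sum, Complex.re_sum]
  refine Finset.sum_congr rfl fun k _ => ?_
  rw [dz_dzbar_ofReal hφ]
  have h4 : (1 / 4 : ℂ) = ((1 / 4 : ℝ) : ℂ) := by norm_num
  rw [h4, mul_assoc, Complex.re_ofReal_mul]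
  congr 1
  simp only [Complex.mul_re, Complex.mul_im, Complex.add_re, Complex.add_im, Complex.ofReal_re,
    Complex.ofReal_im, Complex.I_re, Complex.I_im, Complex.conj_re, Complex.conj_im]
  ring

theorem integrable_mul_of_tsupport {E F : Type*} [NormedAddCommGroup E] [MeasurableSpace E]
    [BorelSpace E] {μ : Measure E} [IsFiniteMeasureOnCompacts μ] [NormedRing F]
    [SecondCountableTopologyEither E F]
    {O : Set E} {u g : E → F} (hu : ContinuousOn u O) (hg : Continuous g)
    (hc : HasCompactSupport g) (hO : tsupport g ⊆ O) : Integrable (fun x => u x * g x) μ := by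
  rw [← integrableOn_iff_integrable_of_support_subset (s := tsupport g)]
  · exact ((hu.mono hO).mul hg.continuousOn).integrableOn_compact hc
  · intro x hx
    refine subset_tsupport _ ?_
    intro h
    simp [h] at hx

/-- The weak equation `∂∂̄u = b` contracted with `ζ` and its conjugate: the Laplacian along the
complex lines with direction `ζ`, taken by the test function, is `4 b(ζ, ζ)`. -/
theorem integral_mul_laplacian {u : (Fin n → ℂ) → ℝ} {b : Fin n → Fin n → (Fin n → ℂ) → ℂ}
    {O : Set (Fin n → ℂ)} (hu : ContinuousOn u O) (hb : ∀ j k, ContinuousOn (b j k) O)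
    (hw : WeakDDbar u b O) (ζ : Fin n → ℂ) {φ : (Fin n → ℂ) → ℝ} (hφ : ContDiff ℝ ∞ φ)
    (hc : HasCompactSupport φ) (hO : tsupport φ ⊆ O) :
    ∫ x, u x * ((1 / 4) * (dirDeriv ζ (dirDeriv ζ φ) x +
        dirDeriv (Complex.I • ζ) (dirDeriv (Complex.I • ζ) φ) x)) =
      ∫ x, (coeffForm b x ζ).re * φ x := by
  set Φ : (Fin n → ℂ) → ℂ := fun y => (φ y : ℂ) with hΦ
  have hΦd : ContDiff ℝ ∞ Φ := Complex.ofRealCLM.contDiff.comp hφ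
  have hsupp : Function.support Φ = Function.support φ := by
    ext y
    simp [hΦ]
  have htsupp : tsupport Φ = tsupport φ := by rw [tsupport, hsupp, tsupport]
  have hΦc : HasCompactSupport Φ := by rw [HasCompactSupport, htsupp]; exact hc
  have hΦO : tsupport Φ ⊆ O := by rw [htsupp]; exact hO
  have hcontd : ∀ {f : (Fin n → ℂ) → ℂ}, ContDiff ℝ ∞ f → ∀ v, ContDiff ℝ ∞ fun x => fderiv ℝ f x v :=
    fun hf v => (hf.fderiv_right (m := ∞) (by simp)).clm_apply contDiff_const
  have hdz : ∀ {f : (Fin n → ℂ) → ℂ}, ContDiff ℝ ∞ f → ∀ k, ContDiff ℝ ∞ (dz k f) := fun hf k =>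
    ((hcontd hf _).sub (contDiff_const.mul (hcontd hf _))).div_const 2
  have hdzbar : ∀ {f : (Fin n → ℂ) → ℂ}, ContDiff ℝ ∞ f → ∀ k, ContDiff ℝ ∞ (dzbar k f) :=
    fun hf k => ((hcontd hf _).add (contDiff_const.mul (hcontd hf _))).div_const 2
  have hzero : ∀ {f : (Fin n → ℂ) → ℂ} k x, x ∉ tsupport f → dz k f x = 0 ∧ dzbar k f x = 0 := by
    intro f k x hx
    have : fderiv ℝ f x = 0 := by
      have h1 := fun h => hx (tsupport_fderiv_subset ℝ (f := f) (subset_tsupport _ h))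
      simpa using h1
    simp [dz, dzbar, this]
  have hts : ∀ j k, tsupport (dz j (dzbar k Φ)) ⊆ tsupport Φ := fun j k => by
    have h1 : tsupport (dzbar k Φ) ⊆ tsupport Φ :=
      closure_minimal (fun x hx => by_contra fun h => hx (hzero k x h).2) (isClosed_tsupport _)
    have h2 : tsupport (dz j (dzbar k Φ)) ⊆ tsupport (dzbar k Φ) :=
      closure_minimal (fun x hx => by_contra fun h => hx (hzero j x h).1) (isClosed_tsupport _)
    exact h2.trans h1
  have huC : ContinuousOn (fun x => (u x : ℂ)) O := Complex.continuous_ofReal.comp_continuousOn hu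
  have hint1 : ∀ j k, Integrable fun x => (u x : ℂ) * dz j (dzbar k Φ) x := fun j k =>
    integrable_mul_of_tsupport huC (hdz (hdzbar hΦd k) j).continuous
      (hΦc.mono' (subset_closure.trans (hts j k))) ((hts j k).trans hΦO)
  have hint2 : ∀ j k, Integrable fun x => b j k x * Φ x := fun j k =>
    integrable_mul_of_tsupport (hb j k) hΦd.continuous hΦc hΦO
  have hsum : ∫ x, (∑ j, ∑ k, ((u x : ℂ) * dz j (dzbar k Φ) x) * (ζ j * conj (ζ k))) =
      ∫ x, (∑ j, ∑ k, (b j k x * Φ x) * (ζ j * conj (ζ k))) := by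
    rw [integral_finsetSum _ fun j _ => integrable_finsetSum _ fun k _ => (hint1 j k).mul_const _,
      integral_finsetSum _ fun j _ => integrable_finsetSum _ fun k _ => (hint2 j k).mul_const _]
    refine Finset.sum_congr rfl fun j _ => ?_
    rw [integral_finsetSum _ fun k _ => (hint1 j k).mul_const _,
      integral_finsetSum _ fun k _ => (hint2 j k).mul_const _]
    refine Finset.sum_congr rfl fun k _ => ?_
    rw [integral_mul_const, integral_mul_const, hw j k Φ hΦd hΦc hΦO]
  have hre : ∀ {f : (Fin n → ℂ) → ℂ}, Integrable f → ∫ x, (f x).re = (∫ x, f x).re := fun hf =>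
    integral_re hf
  have h1 := congrArg Complex.re hsum
  rw [← hre (integrable_finsetSum _ fun j _ => integrable_finsetSum _ fun k _ =>
      (hint1 j k).mul_const _),
    ← hre (integrable_finsetSum _ fun j _ => integrable_finsetSum _ fun k _ =>
      (hint2 j k).mul_const _)] at h1
  have e1 : ∀ x, (∑ j, ∑ k, ((u x : ℂ) * dz j (dzbar k Φ) x) * (ζ j * conj (ζ k))).re =
      u x * ((1 / 4) * (dirDeriv ζ (dirDeriv ζ φ) x +
        dirDeriv (Complex.I • ζ) (dirDeriv (Complex.I • ζ) φ) x)) := fun x => by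
    rw [← re_sum_dz_dzbar (by exact_mod_cast contDiff_infty.1 hφ 2), ← Complex.re_ofReal_mul]
    simp only [Finset.mul_sum, mul_assoc]
    rfl
  have e2 : ∀ x, (∑ j, ∑ k, (b j k x * Φ x) * (ζ j * conj (ζ k))).re =
      (coeffForm b x ζ).re * φ x := fun x => by
    rw [mul_comm, ← Complex.re_ofReal_mul, coeffForm]
    simp only [Finset.mul_sum, hΦ]
    congr 1
    refine Finset.sum_congr rfl fun j _ => Finset.sum_congr rfl fun k _ => by ring
  simp only [e1, e2] at h1
  exact h1

/-- The mollification of `w` with kernel `χ`. -/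
noncomputable def mollify {E : Type*} [NormedAddCommGroup E] [MeasureSpace E] (χ w : E → ℝ)
    (x : E) : ℝ := ∫ t, w t * χ (x - t)

theorem contDiff_mollify {χ w : (Fin n → ℂ) → ℝ} (hw : LocallyIntegrable w)
    (hχ : ContDiff ℝ ∞ χ) (hc : HasCompactSupport χ) : ContDiff ℝ ∞ (mollify χ w) :=
  hc.contDiff_convolution_right (ContinuousLinearMap.mul ℝ ℝ) hw hχ

theorem dirDeriv_mollify {χ w : (Fin n → ℂ) → ℝ} (hw : LocallyIntegrable w)
    (hχ : ContDiff ℝ ∞ χ) (hc : HasCompactSupport χ) (v : Fin n → ℂ) :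
    dirDeriv v (mollify χ w) = mollify (dirDeriv v χ) w := by
  ext x
  have hχ1 : ContDiff ℝ 1 χ := by exact_mod_cast contDiff_infty.1 hχ 1
  have h := hc.hasFDerivAt_convolution_right (ContinuousLinearMap.mul ℝ ℝ) hw hχ1 x
  have h2 := convolution_precompR_apply (ContinuousLinearMap.mul ℝ ℝ) hw (hc.fderiv ℝ)
    (hχ1.continuous_fderiv (by norm_num)) x v
  exact (congrArg (fun L => L v) h.fderiv).trans h2

theorem contDiff_dirDeriv {χ : (Fin n → ℂ) → ℝ} (hχ : ContDiff ℝ ∞ χ) (v : Fin n → ℂ) :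
    ContDiff ℝ ∞ (dirDeriv v χ) :=
  (hχ.fderiv_right (m := ∞) (by simp)).clm_apply contDiff_const

theorem hasCompactSupport_dirDeriv {χ : (Fin n → ℂ) → ℝ} (hc : HasCompactSupport χ)
    (v : Fin n → ℂ) : HasCompactSupport (dirDeriv v χ) := by
  refine (hc.fderiv ℝ).mono fun x hx h => hx ?_
  simp [dirDeriv, h]

theorem dirDeriv_comp_sub (χ : (Fin n → ℂ) → ℝ) (hχ : Differentiable ℝ χ) (x v t : Fin n → ℂ) :
    dirDeriv v (fun t => χ (x - t)) t = -dirDeriv v χ (x - t) := by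
  have h : HasFDerivAt (fun t => x - t) (-ContinuousLinearMap.id ℝ (Fin n → ℂ)) t :=
    (hasFDerivAt_id t).const_sub x
  have := ((hχ (x - t)).hasFDerivAt.comp t h).fderiv
  have h2 := congrArg (fun L => L v) this
  simpa [dirDeriv, Function.comp_def] using h2

/-- Lower bounds near a point persist under mollification with a small kernel. -/
theorem mollify_mono {χ w : (Fin n → ℂ) → ℝ} {x : Fin n → ℂ} {δ c : ℝ}
    (hw : ContinuousOn w (closedBall x δ)) (hχ : Continuous χ) (hχ0 : ∀ y, 0 ≤ χ y)
    (hχ1 : ∫ y, χ y = 1) (hδ : tsupport χ ⊆ closedBall 0 δ)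
    (hc : ∀ t ∈ closedBall x δ, c ≤ w t) : c ≤ mollify χ w x := by
  have hsupp : tsupport (fun t => χ (x - t)) ⊆ closedBall x δ := by
    refine closure_minimal (fun t ht => ?_) isClosed_closedBall
    have := hδ (subset_tsupport _ ht)
    rwa [mem_closedBall, dist_zero_right, ← dist_eq_norm, dist_comm] at this
  have hcs : HasCompactSupport fun t => χ (x - t) :=
    (isCompact_closedBall x δ).of_isClosed_subset (isClosed_tsupport _) hsupp
  have hcont : Continuous fun t => χ (x - t) := hχ.comp (continuous_const.sub continuous_id)
  have h1 : ∫ t, c * χ (x - t) = c := by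
    rw [integral_const_mul, integral_sub_left_eq_self χ volume x, hχ1, mul_one]
  rw [mollify, ← h1]
  refine integral_mono ((hcont.integrable_of_hasCompactSupport hcs).const_mul c)
    (integrable_mul_of_tsupport hw hcont hcs hsupp) fun t => ?_
  by_cases ht : t ∈ closedBall x δ
  · exact mul_le_mul_of_nonneg_right (hc t ht) (hχ0 _)
  · have : χ (x - t) = 0 := by
      by_contra h
      exact ht (hsupp (subset_tsupport _ h))
    simp [this]

/-- A lower bound for `∂∂̄u` in the direction `ζ` along a disc gives a sharpened submean value
inequality for `u` along this disc. The function `u` is mollified in order to make it smooth. -/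
theorem add_le_circleAverage_line {u : (Fin n → ℂ) → ℝ} {b : Fin n → Fin n → (Fin n → ℂ) → ℂ}
    {O : Set (Fin n → ℂ)} (hOopen : IsOpen O) (hu : ContinuousOn u O)
    (hb : ∀ j k, ContinuousOn (b j k) O) (hw : WeakDDbar u b O) {z ζ : Fin n → ℂ} {r : ℝ}
    (hr : 0 < r) (hdisc : ∀ l : ℂ, ‖l‖ ≤ r → z + l • ζ ∈ O) {c : ℝ}
    (hc : ∀ l : ℂ, ‖l‖ ≤ r → c ≤ (coeffForm b (z + l • ζ) ζ).re) :
    u z + c * r ^ 2 ≤ Real.circleAverage (fun l => u (z + l • ζ)) 0 r := by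
  set L : ℂ → Fin n → ℂ := fun l => z + l • ζ with hL
  have hLc : Continuous L := by fun_prop
  set K := L '' closedBall 0 r with hK
  have hKc : IsCompact K := (isCompact_closedBall 0 r).image hLc
  have hKO : K ⊆ O := by
    rintro _ ⟨l, hl, rfl⟩
    exact hdisc l (by simpa using hl)
  have hcoeff : ContinuousOn (fun x => (coeffForm b x ζ).re) O := by
    refine Complex.continuous_re.comp_continuousOn ?_
    exact continuousOn_finsetSum _ fun j _ => continuousOn_finsetSum _ fun k _ =>
      (hb j k).mul continuousOn_const
  suffices h : ∀ ε, 0 < ε → u z + (c - ε) * r ^ 2 ≤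
      Real.circleAverage (fun l => u (z + l • ζ)) 0 r + 2 * ε by
    refine le_of_forall_pos_le_add fun ε hε => ?_
    have h1 := h (ε / (r ^ 2 + 2)) (by positivity)
    have h2 : ε / (r ^ 2 + 2) * (r ^ 2 + 2) = ε := by field_simp
    linarith
  intro ε hε
  obtain ⟨ρ, hρ, hρO⟩ := hKc.exists_cthickening_subset_open hOopen hKO
  set K' := cthickening ρ K with hK'
  have hK'c : IsCompact K' := hKc.cthickening
  obtain ⟨δ₁, hδ₁, hu₁⟩ := Metric.uniformContinuousOn_iff.1
    (hK'c.uniformContinuousOn_of_continuous (hu.mono hρO)) ε hε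
  obtain ⟨δ₂, hδ₂, hb₂⟩ := Metric.uniformContinuousOn_iff.1
    (hK'c.uniformContinuousOn_of_continuous (hcoeff.mono hρO)) ε hε
  obtain ⟨δ, hδ, hδρ, hδ1, hδ2⟩ : ∃ δ, 0 < δ ∧ δ ≤ ρ ∧ δ < δ₁ ∧ δ < δ₂ := by
    refine ⟨min ρ (min (δ₁ / 2) (δ₂ / 2)), by positivity, min_le_left _ _, ?_, ?_⟩
    · exact ((min_le_right _ _).trans (min_le_left _ _)).trans_lt (half_lt_self hδ₁)
    · exact ((min_le_right _ _).trans (min_le_right _ _)).trans_lt (half_lt_self hδ₂)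
  have hball : ∀ x ∈ K, closedBall x δ ⊆ K' := fun x hx =>
    (closedBall_subset_closedBall hδρ).trans (closedBall_subset_cthickening hx ρ)
  have hKK' : K ⊆ K' := self_subset_cthickening K
  let B : ContDiffBump (0 : Fin n → ℂ) := ⟨δ / 2, δ, half_pos hδ, half_lt_self hδ⟩
  let χ : (Fin n → ℂ) → ℝ := B.normed volume
  have hχ : ContDiff ℝ ∞ χ := B.contDiff_normed
  have hχ0 : ∀ y, 0 ≤ χ y := B.nonneg_normed
  have hχ1 : ∫ y, χ y = 1 := B.integral_normed
  have hχc : HasCompactSupport χ := B.hasCompactSupport_normed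
  have hχs : tsupport χ ⊆ closedBall 0 δ := (B.tsupport_normed_eq).subset
  -- `u` is cut off, as it need not be integrable on `O`
  let w : (Fin n → ℂ) → ℝ := K'.indicator u
  have hwK : ∀ t ∈ K', w t = u t := fun t ht => indicator_of_mem ht u
  have hwint : LocallyIntegrable w :=
    (((hu.mono hρO).integrableOn_compact hK'c).integrable_indicator
      hK'c.measurableSet).locallyIntegrable
  have hwcont : ∀ x ∈ K, ContinuousOn w (closedBall x δ) := fun x hx =>
    (hu.mono ((hball x hx).trans hρO)).congr fun t ht => hwK t (hball x hx ht)
  have hlow : ∀ x ∈ K, u x - ε ≤ mollify χ w x := fun x hx => by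
    refine mollify_mono (hwcont x hx) hχ.continuous hχ0 hχ1 hχs fun t ht => ?_
    rw [hwK t (hball x hx ht)]
    have h1 := hu₁ t (hball x hx ht) x (hKK' hx) ((mem_closedBall.1 ht).trans_lt hδ1)
    rw [Real.dist_eq, abs_lt] at h1
    linarith
  have hup : ∀ x ∈ K, mollify χ w x ≤ u x + ε := fun x hx => by
    have h2 : -(u x + ε) ≤ mollify χ (fun t => -w t) x := by
      refine mollify_mono (hwcont x hx).neg hχ.continuous hχ0 hχ1 hχs fun t ht => ?_
      rw [hwK t (hball x hx ht)]
      have h1 := hu₁ t (hball x hx ht) x (hKK' hx) ((mem_closedBall.1 ht).trans_lt hδ1)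
      rw [Real.dist_eq, abs_lt] at h1
      linarith
    have h3 : mollify χ (fun t => -w t) x = -mollify χ w x := by
      simp only [mollify, neg_mul, integral_neg]
    linarith
  have hmol : ContDiff ℝ ∞ (mollify χ w) := contDiff_mollify hwint hχ hχc
  have hmol2 : ContDiff ℝ 2 (mollify χ w) := by exact_mod_cast contDiff_infty.1 hmol 2
  have hdd : ∀ v, dirDeriv v (dirDeriv v (mollify χ w)) = mollify (dirDeriv v (dirDeriv v χ)) w :=
    fun v => by
      rw [dirDeriv_mollify hwint hχ hχc, dirDeriv_mollify hwint (contDiff_dirDeriv hχ v)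
        (hasCompactSupport_dirDeriv hχc v)]
  -- the weak equation, tested against the translated kernel
  have hlap : ∀ x ∈ K, 4 * (c - ε) ≤ dirDeriv ζ (dirDeriv ζ (mollify χ w)) x +
      dirDeriv (Complex.I • ζ) (dirDeriv (Complex.I • ζ) (mollify χ w)) x := by
    intro x hx
    set φ : (Fin n → ℂ) → ℝ := fun t => χ (x - t) with hφ
    have hφd : ContDiff ℝ ∞ φ := hχ.comp (contDiff_const.sub contDiff_id)
    have hφs : tsupport φ ⊆ closedBall x δ := by
      refine closure_minimal (fun t ht => ?_) isClosed_closedBall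
      have := hχs (subset_tsupport _ ht)
      rwa [mem_closedBall, dist_zero_right, ← dist_eq_norm, dist_comm] at this
    have hφc : HasCompactSupport φ :=
      (isCompact_closedBall x δ).of_isClosed_subset (isClosed_tsupport _) hφs
    have hφdd : ∀ v t, dirDeriv v (dirDeriv v φ) t = dirDeriv v (dirDeriv v χ) (x - t) := by
      intro v t
      have e1 : dirDeriv v φ = fun t => -dirDeriv v χ (x - t) :=
        funext fun t => dirDeriv_comp_sub χ (hχ.differentiable (by simp)) x v t
      have e2 := dirDeriv_comp_sub (dirDeriv v χ)
        ((contDiff_dirDeriv hχ v).differentiable (by simp)) x v t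
      rw [e1]
      rw [dirDeriv, fderiv_fun_neg]
      rw [dirDeriv] at e2
      simp [e2]
    have key := integral_mul_laplacian hu hb hw ζ hφd hφc
      ((hφs.trans (hball x hx)).trans hρO)
    have hrhs : c - ε ≤ ∫ t, (coeffForm b t ζ).re * φ t := by
      have hcx : c ≤ (coeffForm b x ζ).re := by
        obtain ⟨l, hl, rfl⟩ := hx
        exact hc l (by simpa using hl)
      refine mollify_mono (w := fun t => (coeffForm b t ζ).re)
        (hcoeff.mono ((hball x hx).trans hρO)) hχ.continuous hχ0 hχ1 hχs fun t ht => ?_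
      have h1 := hb₂ t (hball x hx ht) x (hKK' hx) ((mem_closedBall.1 ht).trans_lt hδ2)
      rw [Real.dist_eq, abs_lt] at h1
      linarith
    have hlhs : ∀ v, mollify (dirDeriv v (dirDeriv v χ)) w x =
        ∫ t, u t * dirDeriv v (dirDeriv v φ) t := by
      intro v
      refine integral_congr_ae (Filter.Eventually.of_forall fun t => ?_)
      simp only [hφdd]
      by_cases ht : t ∈ K'
      · rw [hwK t ht]
      · have h0 : dirDeriv v (dirDeriv v φ) t = 0 := by
          have h1 : t ∉ tsupport φ := fun h => ht (hball x hx (hφs h))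
          have h2 : φ =ᶠ[𝓝 t] 0 := notMem_tsupport_iff_eventuallyEq.1 h1
          have h3 : dirDeriv v φ =ᶠ[𝓝 t] fun _ => 0 := by
            filter_upwards [h2.fderiv (𝕜 := ℝ)] with y hy
            rw [dirDeriv, hy]
            simp
          rw [dirDeriv, h3.fderiv_eq]
          simp
        rw [hφdd] at h0
        rw [h0, mul_zero, mul_zero]
    have hint : ∀ v, Integrable fun t => u t * dirDeriv v (dirDeriv v φ) t := fun v => by
      have h1 : tsupport (dirDeriv v (dirDeriv v φ)) ⊆ tsupport φ := by
        have h2 : ∀ f : (Fin n → ℂ) → ℝ, tsupport (dirDeriv v f) ⊆ tsupport f := fun f => by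
          refine closure_minimal (fun t ht => tsupport_fderiv_subset ℝ (subset_tsupport _ ?_))
            (isClosed_tsupport _)
          intro h
          exact ht (by simp [dirDeriv, h])
        exact (h2 _).trans (h2 _)
      exact integrable_mul_of_tsupport hu (contDiff_dirDeriv (contDiff_dirDeriv hφd v) v).continuous
        (hφc.of_isClosed_subset (isClosed_tsupport _) h1) (h1.trans ((hφs.trans (hball x hx)).trans hρO))
    rw [hdd, hdd, hlhs, hlhs, ← integral_add (hint _) (hint _)]
    have h5 : ∫ t, u t * ((1 / 4) * (dirDeriv ζ (dirDeriv ζ φ) t +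
        dirDeriv (Complex.I • ζ) (dirDeriv (Complex.I • ζ) φ) t)) =
        (1 / 4) * ∫ t, (u t * dirDeriv ζ (dirDeriv ζ φ) t +
          u t * dirDeriv (Complex.I • ζ) (dirDeriv (Complex.I • ζ) φ) t) := by
      rw [← integral_const_mul]
      congr 1
      ext t
      ring
    rw [← key, h5] at hrhs
    linarith
  have hLd : ∀ {f : (Fin n → ℂ) → ℝ}, Differentiable ℝ f → ∀ (v l : ℂ),
      dirDeriv v (fun l => f (L l)) l = dirDeriv (v • ζ) f (L l) := by
    intro f hf v l
    have h1 : HasFDerivAt L ((ContinuousLinearMap.toSpanSingleton ℂ ζ).restrictScalars ℝ) l :=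
      (((ContinuousLinearMap.toSpanSingleton ℂ ζ).restrictScalars ℝ).hasFDerivAt).const_add z
    have h2 := ((hf (L l)).hasFDerivAt.comp l h1).fderiv
    have h3 := congrArg (fun T => T v) h2
    simpa [dirDeriv, Function.comp_def] using h3
  have hLcd : ContDiff ℝ 2 L :=
    contDiff_const.add (((ContinuousLinearMap.toSpanSingleton ℂ ζ).restrictScalars ℝ).contDiff)
  have hLdd : ∀ v l : ℂ, dirDeriv v (dirDeriv v fun l => mollify χ w (L l)) l =
      dirDeriv (v • ζ) (dirDeriv (v • ζ) (mollify χ w)) (L l) := by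
    intro v l
    have e : (dirDeriv v fun l => mollify χ w (L l)) =
        fun l => dirDeriv (v • ζ) (mollify χ w) (L l) :=
      funext fun l => hLd (hmol.differentiable (by simp)) v l
    rw [e]
    exact hLd ((contDiff_dirDeriv hmol _).differentiable (by simp)) v l
  have hfin := add_le_circleAverage_of_laplacian (f := fun l => mollify χ w (L l))
    (hmol2.comp hLcd) (a := 0) hr (c := c - ε) fun l hl => by
      rw [hLdd, hLdd, one_smul]
      exact hlap (L l) ⟨l, ball_subset_closedBall hl, rfl⟩
  have hL0 : L 0 = z := by simp [hL]
  have hz : z ∈ K := ⟨0, by simp [hr.le], hL0⟩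
  have hcircK : ∀ l ∈ sphere (0 : ℂ) r, L l ∈ K := fun l hl =>
    ⟨l, sphere_subset_closedBall hl, rfl⟩
  have hav : Real.circleAverage (fun l => mollify χ w (L l)) 0 r ≤
      Real.circleAverage (fun l => u (L l)) 0 r + ε := by
    have huc : ContinuousOn (fun l => u (L l)) (sphere 0 r) :=
      (hu.mono hKO).comp hLc.continuousOn hcircK
    have h3 : Real.circleAverage (fun l => u (L l) + ε) 0 r =
        Real.circleAverage (fun l => u (L l)) 0 r + ε := by
      rw [Real.circleAverage_fun_add (huc.circleIntegrable hr.le)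
        continuousOn_const.circleIntegrable', Real.circleAverage_const]
    rw [← h3]
    refine Real.circleAverage_mono (hmol.continuous.comp hLc).continuousOn.circleIntegrable'
      ((huc.add continuousOn_const).circleIntegrable hr.le) fun l hl => ?_
    rw [abs_of_pos hr] at hl
    exact hup _ (hcircK l hl)
  have hlz := hlow z hz
  simp only [hL0] at hfin
  linarith

end Mollification

/-! ### Mean value inequalities along a line in `ℂⁿ` -/

section AlongLine

open Metric Real

variable {n : ℕ}

/-- The sesquilinear form with coefficients `b_{jk}`. -/
noncomputable def coeffForm₂ (b : Fin n → Fin n → (Fin n → ℂ) → ℂ) (x ζ η : Fin n → ℂ) : ℂ :=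
  ∑ j, ∑ k, b j k x * (ζ j * conj (η k))

/-- The counterpart of `add_le_circleAverage_line` for upper bounds. -/
theorem circleAverage_line_le_add {u : (Fin n → ℂ) → ℝ} {b : Fin n → Fin n → (Fin n → ℂ) → ℂ}
    {O : Set (Fin n → ℂ)} (hOopen : IsOpen O) (hu : ContinuousOn u O)
    (hb : ∀ j k, ContinuousOn (b j k) O) (hw : WeakDDbar u b O) {z ζ : Fin n → ℂ} {r : ℝ}
    (hr : 0 < r) (hdisc : ∀ l : ℂ, ‖l‖ ≤ r → z + l • ζ ∈ O) {c : ℝ}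
    (hc : ∀ l : ℂ, ‖l‖ ≤ r → (coeffForm b (z + l • ζ) ζ).re ≤ c) :
    circleAverage (fun l => u (z + l • ζ)) 0 r ≤ u z + c * r ^ 2 := by
  have h := add_le_circleAverage_line (u := fun x => -u x) (b := fun j k x => -b j k x) hOopen
    hu.neg (fun j k => (hb j k).neg) hw.neg hr hdisc (c := -c) fun l hl => by
      have h1 := hc l hl
      simp only [coeffForm, Complex.neg_re, neg_mul, Finset.sum_neg_distrib] at h1 ⊢
      linarith
  have h2 : circleAverage (fun l => -u (z + l • ζ)) 0 r =
      -circleAverage (fun l => u (z + l • ζ)) 0 r := by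
    simp [circleAverage_def]
  rw [h2] at h
  linarith

/-- The form representing `∂∂̄u` for a real function `u` is Hermitian. -/
theorem WeakDDbar.conj_symm {u : (Fin n → ℂ) → ℝ} {b : Fin n → Fin n → (Fin n → ℂ) → ℂ}
    {O : Set (Fin n → ℂ)} (hO : IsOpen O) (hb : ∀ j k, ContinuousOn (b j k) O)
    (hw : WeakDDbar u b O) (j k : Fin n) {x : Fin n → ℂ} (hx : x ∈ O) :
    b j k x = conj (b k j x) := by
  have hcont : ContinuousOn (fun x => b j k x - conj (b k j x)) O :=
    (hb j k).sub (Complex.continuous_conj.comp_continuousOn (hb k j))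
  have hint : ∀ g : (Fin n → ℂ) → ℝ, ContDiff ℝ ∞ g → HasCompactSupport g → tsupport g ⊆ O →
      ∫ x, g x • (b j k x - conj (b k j x)) = 0 := by
    intro g hg hc hgO
    set G : (Fin n → ℂ) → ℂ := fun y => (g y : ℂ) with hG
    have hGd : ContDiff ℝ ∞ G := Complex.ofRealCLM.contDiff.comp hg
    have htsupp : tsupport G = tsupport g := by
      have : Function.support G = Function.support g := by
        ext y
        simp [hG]
      rw [tsupport, this, tsupport]
    have hGc : HasCompactSupport G := by rw [HasCompactSupport, htsupp]; exact hc
    have hGO : tsupport G ⊆ O := by rw [htsupp]; exact hgO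
    have hg2 : ContDiff ℝ 2 g := by exact_mod_cast contDiff_infty.1 hg 2
    have hsymm : ∀ y v w, dirDeriv v (dirDeriv w g) y = dirDeriv w (dirDeriv v g) y := by
      intro y v w
      have h1 : IsSymmSndFDerivAt ℝ g y := hg2.contDiffAt.isSymmSndFDerivAt (by simp)
      have hd : DifferentiableAt ℝ (fderiv ℝ g) y :=
        (hg2.fderiv_right (m := 1) (by norm_num)).differentiable (by norm_num) y
      have h2 : ∀ v w, dirDeriv v (dirDeriv w g) y = fderiv ℝ (fderiv ℝ g) y v w := by
        intro v w
        have : HasFDerivAt (fun z => fderiv ℝ g z w) _ y :=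
          hd.hasFDerivAt.clm_apply (hasFDerivAt_const w y)
        change fderiv ℝ (fun z => fderiv ℝ g z w) y v = _
        rw [this.fderiv]
        simp
      rw [h2, h2, h1]
    have hpt : ∀ y, dz j (dzbar k G) y = conj (dz k (dzbar j G) y) := fun y => by
      rw [dz_dzbar_ofReal hg2, dz_dzbar_ofReal hg2, hsymm y (Pi.single k 1) (Pi.single j 1),
        hsymm y (Pi.single k Complex.I) (Pi.single j Complex.I),
        hsymm y (Pi.single k 1) (Pi.single j Complex.I),
        hsymm y (Pi.single k Complex.I) (Pi.single j 1)]
      simp only [map_mul, map_add, Complex.conj_ofReal, Complex.conj_I, map_div₀, map_one,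
        Complex.conj_ofNat]
      push_cast
      ring
    have e1 := hw j k G hGd hGc hGO
    have e2 := congrArg conj (hw k j G hGd hGc hGO)
    rw [← integral_conj, ← integral_conj] at e2
    simp only [map_mul, Complex.conj_ofReal, ← hpt] at e2
    rw [e1] at e2
    have hi1 : Integrable fun x => b j k x * G x :=
      integrable_mul_of_tsupport (hb j k) hGd.continuous hGc hGO
    have hi2 : Integrable fun x => conj (b k j x) * G x :=
      integrable_mul_of_tsupport (Complex.continuous_conj.comp_continuousOn (hb k j))
        hGd.continuous hGc hGO
    have e3 : ∀ x, g x • (b j k x - conj (b k j x)) = b j k x * G x - conj (b k j x) * G x :=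
      fun x => by
        rw [Complex.real_smul]
        ring
    simp only [e3]
    rw [integral_sub hi1 hi2, e2]
    simp only [hG, Complex.conj_ofReal, sub_self]
  have h0 := hO.ae_eq_zero_of_integral_contDiff_smul_eq_zero (μ := volume)
    (hcont.locallyIntegrableOn hO.measurableSet) hint
  have h1 := Measure.eqOn_open_of_ae_eq (f := fun x => b j k x - conj (b k j x)) (g := fun _ => 0)
    ((ae_restrict_iff' hO.measurableSet).2 h0) hO hcont continuousOn_const hx
  exact sub_eq_zero.1 h1

theorem coeffForm₂_conj_symm {b : Fin n → Fin n → (Fin n → ℂ) → ℂ} {x : Fin n → ℂ}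
    (hb : ∀ j k, b j k x = conj (b k j x)) (ζ η : Fin n → ℂ) :
    coeffForm₂ b x ζ η = conj (coeffForm₂ b x η ζ) := by
  simp only [coeffForm₂, map_sum]
  rw [Finset.sum_comm]
  refine Finset.sum_congr rfl fun j _ => Finset.sum_congr rfl fun k _ => ?_
  rw [hb k j]
  simp only [map_mul, Complex.conj_conj]
  ring

/-- Plurisubharmonicity in an open subset of `ℂⁿ`, for continuous functions, as the submean value
property along holomorphic discs. -/
def SubmeanOnDiscs (u : (Fin n → ℂ) → ℝ) (O : Set (Fin n → ℂ)) : Prop :=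
  ∀ (Ω : Set ℂ) (f : ℂ → Fin n → ℂ), IsOpen Ω → DifferentiableOn ℂ f Ω → MapsTo f Ω O →
    ∀ a r, 0 < r → closedBall a r ⊆ Ω → u (f a) ≤ circleAverage (fun x => u (f x)) a r

theorem continuousAt_coeffForm₂ {b : Fin n → Fin n → (Fin n → ℂ) → ℂ} {O : Set (Fin n → ℂ)}
    (hO : IsOpen O) (hb : ∀ j k, ContinuousOn (b j k) O) {X : Type*} [TopologicalSpace X]
    {f g h : X → Fin n → ℂ} {x : X} (hf : ContinuousAt f x) (hg : ContinuousAt g x)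
    (hh : ContinuousAt h x) (hx : f x ∈ O) :
    ContinuousAt (fun y => coeffForm₂ b (f y) (g y) (h y)) x := by
  refine tendsto_finsetSum _ fun j _ => tendsto_finsetSum _ fun k _ => ?_
  have h1 : ContinuousAt (fun y => b j k (f y)) x :=
    ContinuousAt.comp (f := f) ((hb j k).continuousAt (hO.mem_nhds hx)) hf
  exact h1.mul (((continuousAt_apply j _).comp hg).mul
    (Complex.continuous_conj.continuousAt.comp ((continuousAt_apply k _).comp hh)))

theorem continuousAt_coeffForm {b : Fin n → Fin n → (Fin n → ℂ) → ℂ} {O : Set (Fin n → ℂ)}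
    (hO : IsOpen O) (hb : ∀ j k, ContinuousOn (b j k) O) {X : Type*} [TopologicalSpace X]
    {f g : X → Fin n → ℂ} {x : X} (hf : ContinuousAt f x) (hg : ContinuousAt g x)
    (hx : f x ∈ O) : ContinuousAt (fun y => coeffForm b (f y) (g y)) x :=
  continuousAt_coeffForm₂ hO hb hf hg hg hx

theorem coeffForm_nonneg {u : (Fin n → ℂ) → ℝ} {b : Fin n → Fin n → (Fin n → ℂ) → ℂ}
    {O : Set (Fin n → ℂ)} (hO : IsOpen O) (hu : ContinuousOn u O)
    (hb : ∀ j k, ContinuousOn (b j k) O) (hw : WeakDDbar u b O) (hpsh : SubmeanOnDiscs u O)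
    {z : Fin n → ℂ} (hz : z ∈ O) (ζ : Fin n → ℂ) : 0 ≤ (coeffForm b z ζ).re := by
  refine le_of_forall_pos_le_add fun ε hε => ?_
  have hL : Continuous fun l : ℂ => z + l • ζ := by fun_prop
  have hL0 : z + (0 : ℂ) • ζ = z := by simp
  have h1 : ∀ᶠ l in 𝓝 (0 : ℂ), z + l • ζ ∈ O :=
    hL.continuousAt.eventually_mem (hO.mem_nhds (by rwa [hL0]))
  have h2 : ∀ᶠ l in 𝓝 (0 : ℂ), (coeffForm b (z + l • ζ) ζ).re < (coeffForm b z ζ).re + ε := by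
    have hc : ContinuousAt (fun l : ℂ => (coeffForm b (z + l • ζ) ζ).re) 0 :=
      Complex.continuous_re.continuousAt.comp
        (continuousAt_coeffForm hO hb hL.continuousAt continuousAt_const (by rwa [hL0]))
    refine hc.eventually_lt continuousAt_const ?_
    rw [hL0]
    linarith
  obtain ⟨r, hr, hball⟩ := Metric.eventually_nhds_iff_ball.1 (h1.and h2)
  have hmem : ∀ l : ℂ, ‖l‖ ≤ r / 2 → l ∈ ball (0 : ℂ) r := fun l hl => by
    rw [mem_ball_zero_iff]
    linarith
  have h3 := circleAverage_line_le_add hO hu hb hw (half_pos hr) (z := z) (ζ := ζ)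
    (fun l hl => (hball l (hmem l hl)).1) (fun l hl => (hball l (hmem l hl)).2.le)
  have h4 := hpsh (ball 0 r) (fun l => z + l • ζ) isOpen_ball (by fun_prop)
    (fun l hl => (hball l hl).1) 0 (r / 2) (half_pos hr)
    (closedBall_subset_ball (half_lt_self hr))
  simp only [hL0] at h4
  have h5 : 0 ≤ ((coeffForm b z ζ).re + ε) * (r / 2) ^ 2 := by linarith
  exact nonneg_of_mul_nonneg_left h5 (by positivity)

theorem circleAverage_comm {f : ℂ → ℂ → ℝ} {a c : ℂ} {r s : ℝ}
    (hf : Continuous fun p : ℝ × ℝ => f (circleMap a r p.1) (circleMap c s p.2)) :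
    circleAverage (fun x => circleAverage (fun l => f x l) c s) a r =
      circleAverage (fun l => circleAverage (fun x => f x l) a r) c s := by
  simp only [circleAverage_def, intervalIntegral.integral_smul]
  congr 2
  simp only [intervalIntegral.integral_of_le two_pi_pos.le]
  refine integral_integral_swap ?_
  rw [Measure.prod_restrict]
  have : IntegrableOn (fun p : ℝ × ℝ => f (circleMap a r p.1) (circleMap c s p.2))
      (Icc 0 (2 * π) ×ˢ Icc 0 (2 * π)) (volume.prod volume) :=
    hf.continuousOn.integrableOn_compact (isCompact_Icc.prod isCompact_Icc)
  exact this.mono_set (Set.prod_mono Ioc_subset_Icc_self Ioc_subset_Icc_self)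

/-- Averaging over `l` a family of functions of `x` with the submean value property. -/
theorem circleAverage_le_circleAverage_circleAverage {f : ℂ → ℂ → ℝ} {a c : ℂ} {r s : ℝ}
    (hf : Continuous fun p : ℝ × ℝ => f (circleMap a r p.1) (circleMap c s p.2))
    (ha : CircleIntegrable (f a) c s)
    (hsub : ∀ l ∈ sphere c |s|, f a l ≤ circleAverage (fun x => f x l) a r) :
    circleAverage (f a) c s ≤ circleAverage (fun x => circleAverage (f x) c s) a r := by
  rw [circleAverage_comm hf]
  refine circleAverage_mono ha ?_ hsub
  have h1 : Continuous fun p : ℝ × ℝ => f (circleMap a r p.2) (circleMap c s p.1) :=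
    hf.comp continuous_swap
  have : Continuous fun θ : ℝ => circleAverage (fun x => f x (circleMap c s θ)) a r :=
    (intervalIntegral.continuous_parametric_intervalIntegral_of_continuous' (μ := volume)
      h1 0 (2 * π)).const_smul (2 * π)⁻¹
  exact this.intervalIntegrable _ _

/-- A function `u` is harmonic along a line whose tangent vector is null for `∂∂̄u`. -/
theorem circleAverage_line_of_null {u : (Fin n → ℂ) → ℝ} {b : Fin n → Fin n → (Fin n → ℂ) → ℂ}
    {O : Set (Fin n → ℂ)} (hO : IsOpen O) (hu : ContinuousOn u O)
    (hb : ∀ j k, ContinuousOn (b j k) O) (hw : WeakDDbar u b O)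
    {γ₀ w : Fin n → ℂ} {Ω : Set ℂ} (hγ : ∀ x ∈ Ω, γ₀ + x • w ∈ O)
    (hnull : ∀ x ∈ Ω, (coeffForm b (γ₀ + x • w) w).re = 0) {a : ℂ} {r : ℝ} (hr : 0 < r)
    (haΩ : closedBall a r ⊆ Ω) :
    circleAverage (fun x => u (γ₀ + x • w)) a r = u (γ₀ + a • w) := by
  have heq : ∀ l : ℂ, γ₀ + a • w + l • w = γ₀ + (a + l) • w := fun l => by
    rw [add_smul, add_assoc]
  have hshift : circleAverage (fun x => u (γ₀ + x • w)) a r =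
      circleAverage (fun l => u (γ₀ + a • w + l • w)) 0 r := by
    rw [← circleAverage_map_add_const]
    congr 1
    ext l
    rw [heq, add_comm a l]
  have hmem : ∀ l : ℂ, ‖l‖ ≤ r → a + l ∈ Ω := fun l hl => haΩ (by simpa using hl)
  have h1 := add_le_circleAverage_line hO hu hb hw (z := γ₀ + a • w) (ζ := w) hr (c := 0)
    (fun l hl => by rw [heq]; exact hγ _ (hmem l hl))
    (fun l hl => by rw [heq]; exact (hnull _ (hmem l hl)).ge)
  have h2 := circleAverage_line_le_add hO hu hb hw (z := γ₀ + a • w) (ζ := w) hr (c := 0)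
    (fun l hl => by rw [heq]; exact hγ _ (hmem l hl))
    (fun l hl => by rw [heq]; exact (hnull _ (hmem l hl)).le)
  rw [hshift]
  linarith

/-- The coefficients of `b` along `γ x + l ζ x` converge for `l → 0`, uniformly for `x` in a compact
set. -/
theorem eventually_abs_coeffForm_sub_lt {b : Fin n → Fin n → (Fin n → ℂ) → ℂ}
    {O : Set (Fin n → ℂ)} (hO : IsOpen O) (hb : ∀ j k, ContinuousOn (b j k) O)
    {γ ζ : ℂ → Fin n → ℂ} {K : Set ℂ} (hK : IsCompact K) (hγc : ∀ x ∈ K, ContinuousAt γ x)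
    (hγ : ∀ x ∈ K, γ x ∈ O) (hζ : ∀ x ∈ K, ContinuousAt ζ x) {η : ℝ} (hη : 0 < η) :
    ∀ᶠ l in 𝓝 (0 : ℂ), ∀ x ∈ K, γ x + l • ζ x ∈ O ∧
      |(coeffForm b (γ x + l • ζ x) (ζ x)).re - (coeffForm b (γ x) (ζ x)).re| < η := by
  refine hK.eventually_forall_of_forall_eventually fun x hx => ?_
  have hζ2 : ContinuousAt (fun p : ℂ × ℂ => ζ p.2) (0, x) :=
    ContinuousAt.comp (f := Prod.snd) (hζ x hx) continuousAt_snd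
  have hγ2 : ContinuousAt (fun p : ℂ × ℂ => γ p.2) (0, x) :=
    ContinuousAt.comp (f := Prod.snd) (hγc x hx) continuousAt_snd
  have hG : ContinuousAt (fun p : ℂ × ℂ => γ p.2 + p.1 • ζ p.2) (0, x) :=
    hγ2.add (continuousAt_fst.smul hζ2)
  have hG0 : γ x + (0 : ℂ) • ζ x = γ x := by simp
  have hGO : γ x + (0 : ℂ) • ζ x ∈ O := by rw [hG0]; exact hγ x hx
  have h1 : ∀ᶠ p : ℂ × ℂ in 𝓝 (0, x), γ p.2 + p.1 • ζ p.2 ∈ O :=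
    hG.eventually_mem (hO.mem_nhds hGO)
  have hΘ : ContinuousAt (fun p : ℂ × ℂ => |(coeffForm b (γ p.2 + p.1 • ζ p.2) (ζ p.2)).re -
      (coeffForm b (γ p.2) (ζ p.2)).re|) (0, x) :=
    ((Complex.continuous_re.continuousAt.comp (continuousAt_coeffForm hO hb hG hζ2 hGO)).sub
      (Complex.continuous_re.continuousAt.comp
        (continuousAt_coeffForm hO hb hγ2 hζ2 (hγ x hx)))).abs
  refine h1.and (hΘ.eventually_lt continuousAt_const ?_)
  simp [hη]

/-- The submean value property of `x ↦ b(γ x)(ζ x, ζ x)`, for a holomorphic vector field `ζ` along a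
line `γ` whose tangent vector is null for `∂∂̄u = b`. Indeed, `u ∘ γ` is harmonic, so that the means
of `u(γ x + l ζ x) - u(γ x)` over the circles `|l| = ε` are functions of `x` with the submean value
property; divided by `ε²`, they converge to `b(γ x)(ζ x, ζ x)`. -/
theorem coeffForm_le_circleAverage {u : (Fin n → ℂ) → ℝ} {b : Fin n → Fin n → (Fin n → ℂ) → ℂ}
    {O : Set (Fin n → ℂ)} (hO : IsOpen O) (hu : ContinuousOn u O)
    (hb : ∀ j k, ContinuousOn (b j k) O) (hw : WeakDDbar u b O) (hpsh : SubmeanOnDiscs u O)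
    {γ₀ w : Fin n → ℂ} {Ω : Set ℂ} (hΩ : IsOpen Ω) (hγ : ∀ x ∈ Ω, γ₀ + x • w ∈ O)
    (hnull : ∀ x ∈ Ω, (coeffForm b (γ₀ + x • w) w).re = 0) {ζ : ℂ → Fin n → ℂ}
    (hζ : DifferentiableOn ℂ ζ Ω) {a : ℂ} {r : ℝ} (hr : 0 < r) (haΩ : closedBall a r ⊆ Ω) :
    (coeffForm b (γ₀ + a • w) (ζ a)).re ≤
      circleAverage (fun x => (coeffForm b (γ₀ + x • w) (ζ x)).re) a r := by
  set γ : ℂ → Fin n → ℂ := fun x => γ₀ + x • w with hγdef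
  have hγc : Continuous γ := by fun_prop
  set Q : ℂ → ℝ := fun x => (coeffForm b (γ x) (ζ x)).re with hQ
  have hζc : ∀ x ∈ Ω, ContinuousAt ζ x := fun x hx =>
    hζ.continuousOn.continuousAt (hΩ.mem_nhds hx)
  have hQc : ContinuousOn Q Ω := fun x hx =>
    (Complex.continuous_re.continuousAt.comp (continuousAt_coeffForm hO hb hγc.continuousAt
      (hζc x hx) (hγ x hx))).continuousWithinAt
  have hsphΩ : sphere a r ⊆ Ω := sphere_subset_closedBall.trans haΩ
  have hharm : circleAverage (fun x => u (γ x)) a r = u (γ a) :=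
    circleAverage_line_of_null hO hu hb hw hγ hnull hr haΩ
  suffices h : ∀ η, 0 < η → Q a ≤ circleAverage Q a r + 2 * η by
    refine le_of_forall_pos_le_add fun ε hε => ?_
    have := h (ε / 2) (half_pos hε)
    linarith
  intro η hη
  have hunif := eventually_abs_coeffForm_sub_lt hO hb (isCompact_closedBall a r)
    (fun x _ => hγc.continuousAt) (fun x hx => hγ x (haΩ hx)) (fun x hx => hζc x (haΩ hx)) hη
  obtain ⟨ε', hε', hball⟩ := Metric.eventually_nhds_iff_ball.1 hunif
  set ε := ε' / 2 with hεdef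
  have hε : 0 < ε := half_pos hε'
  have hgood : ∀ l : ℂ, ‖l‖ ≤ ε → ∀ x ∈ closedBall a r, γ x + l • ζ x ∈ O ∧
      |(coeffForm b (γ x + l • ζ x) (ζ x)).re - Q x| < η := fun l hl => hball l (by
    rw [mem_ball_zero_iff]
    linarith)
  set M : ℂ → ℝ := fun x => circleAverage (fun l => u (γ x + l • ζ x)) 0 ε with hM
  have hMlow : ∀ x ∈ closedBall a r, u (γ x) + (Q x - η) * ε ^ 2 ≤ M x := fun x hx =>
    add_le_circleAverage_line hO hu hb hw hε (fun l hl => (hgood l hl x hx).1) fun l hl => by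
      have := (abs_lt.1 (hgood l hl x hx).2).1
      linarith
  have hMup : ∀ x ∈ closedBall a r, M x ≤ u (γ x) + (Q x + η) * ε ^ 2 := fun x hx =>
    circleAverage_line_le_add hO hu hb hw hε (fun l hl => (hgood l hl x hx).1) fun l hl => by
      have := (abs_lt.1 (hgood l hl x hx).2).2
      linarith
  have hcont2 : Continuous fun p : ℝ × ℝ =>
      u (γ (circleMap a r p.1) + circleMap 0 ε p.2 • ζ (circleMap a r p.1)) := by
    have hζθ : Continuous fun θ : ℝ => ζ (circleMap a r θ) :=
      hζ.continuousOn.comp_continuous (continuous_circleMap a r) fun θ =>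
        hsphΩ (circleMap_mem_sphere a hr.le θ)
    refine hu.comp_continuous ?_ fun p => (hgood _ (by simp [abs_of_pos hε]) _
      (sphere_subset_closedBall (circleMap_mem_sphere a hr.le p.1))).1
    exact (hγc.comp ((continuous_circleMap a r).comp continuous_fst)).add
      (((continuous_circleMap 0 ε).comp continuous_snd).smul (hζθ.comp continuous_fst))
  have hMint : CircleIntegrable M a r := by
    have : Continuous fun θ : ℝ => M (circleMap a r θ) :=
      (intervalIntegral.continuous_parametric_intervalIntegral_of_continuous' (μ := volume)
        hcont2 0 (2 * π)).const_smul (2 * π)⁻¹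
    exact this.intervalIntegrable _ _
  -- for fixed `l` the function `x ↦ u (γ x + l ζ x)` is subharmonic
  have hfix : ∀ l ∈ sphere (0 : ℂ) ε, u (γ a + l • ζ a) ≤
      circleAverage (fun x => u (γ x + l • ζ x)) a r := fun l hl => by
    have hdiff : DifferentiableOn ℂ (fun x => γ x + l • ζ x) Ω := by
      refine DifferentiableOn.add ?_ (hζ.const_smul l)
      exact Differentiable.differentiableOn (by fun_prop)
    refine hpsh (Ω ∩ (fun x => γ x + l • ζ x) ⁻¹' O) (fun x => γ x + l • ζ x)
      (hdiff.continuousOn.isOpen_inter_preimage hΩ hO) (hdiff.mono inter_subset_left)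
      (fun x hx => hx.2) a r hr fun x hx => ⟨haΩ hx, (hgood l ?_ x hx).1⟩
    rw [mem_sphere_zero_iff_norm.1 hl]
  have hMa : M a ≤ circleAverage M a r := by
    refine circleAverage_le_circleAverage_circleAverage (f := fun x l => u (γ x + l • ζ x)) hcont2
      ?_ fun l hl => hfix l (by rwa [abs_of_pos hε] at hl)
    refine ContinuousOn.circleIntegrable hε.le (hu.comp (by fun_prop) fun l hl => ?_)
    exact (hgood l (by rw [mem_sphere_zero_iff_norm.1 hl]) a (mem_closedBall_self hr.le)).1
  have hQint : CircleIntegrable Q a r := (hQc.mono hsphΩ).circleIntegrable hr.le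
  have huint : CircleIntegrable (fun x => u (γ x)) a r :=
    (hu.comp hγc.continuousOn fun x hx => hγ x (hsphΩ hx)).circleIntegrable hr.le
  have hsumc : circleAverage (fun x => u (γ x) + (Q x + η) * ε ^ 2) a r =
      u (γ a) + (circleAverage Q a r + η) * ε ^ 2 := by
    have h1 : CircleIntegrable (fun x => (Q x + η) * ε ^ 2) a r :=
      ContinuousOn.circleIntegrable hr.le
        (((hQc.mono hsphΩ).add continuousOn_const).mul continuousOn_const)
    rw [circleAverage_fun_add huint h1, hharm]
    congr 1
    have h2 : (fun x => (Q x + η) * ε ^ 2) = fun x => (ε ^ 2) • (Q x + η) := by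
      ext x
      rw [smul_eq_mul, mul_comm]
    rw [h2, circleAverage_fun_smul, circleAverage_fun_add hQint (circleIntegrable_const η a r),
      circleAverage_const, smul_eq_mul, mul_comm]
  have hup : circleAverage M a r ≤ u (γ a) + (circleAverage Q a r + η) * ε ^ 2 := by
    rw [← hsumc]
    refine circleAverage_mono hMint ?_ fun x hx => hMup x (sphere_subset_closedBall (by
      rwa [abs_of_pos hr] at hx))
    exact ContinuousOn.circleIntegrable hr.le
      ((hu.comp hγc.continuousOn fun x hx => hγ x (hsphΩ hx)).add
        (((hQc.mono hsphΩ).add continuousOn_const).mul continuousOn_const))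
  have hlow := hMlow a (mem_closedBall_self hr.le)
  have hfinal : (Q a - η) * ε ^ 2 ≤ (circleAverage Q a r + η) * ε ^ 2 := by linarith
  have := le_of_mul_le_mul_right hfinal (by positivity)
  linarith

end AlongLine

/-! ### Gram determinants along a line -/

section GramAlongLine

open Metric Real
open scoped ComplexOrder

variable {n m : ℕ}

/-- The Gram matrix at `x` of the vectors `v_j` for the sesquilinear form with coefficients `b`. -/
noncomputable def gramMatrix (b : Fin n → Fin n → (Fin n → ℂ) → ℂ) (x : Fin n → ℂ)
    (v : Fin m → Fin n → ℂ) : Matrix (Fin m) (Fin m) ℂ :=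
  Matrix.of fun j k => coeffForm₂ b x (v j) (v k)

theorem coeffForm₂_sum_smul (b : Fin n → Fin n → (Fin n → ℂ) → ℂ) (x : Fin n → ℂ) {ι : Type*}
    (s : Finset ι) (c d : ι → ℂ) (v w : ι → Fin n → ℂ) :
    coeffForm₂ b x (∑ i ∈ s, c i • v i) (∑ i ∈ s, d i • w i) =
      ∑ i ∈ s, ∑ l ∈ s, c i * conj (d l) * coeffForm₂ b x (v i) (w l) := by
  simp only [coeffForm₂, Finset.sum_apply, Pi.smul_apply, smul_eq_mul, map_sum, map_mul,
    Finset.sum_mul_sum]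
  simp only [Finset.mul_sum]
  calc _ = ∑ j, ∑ i ∈ s, ∑ k, ∑ l ∈ s,
        b j k x * (c i * v i j * (conj (d l) * conj (w l k))) :=
        Finset.sum_congr rfl fun j _ => Finset.sum_comm
    _ = ∑ i ∈ s, ∑ j, ∑ k, ∑ l ∈ s,
        b j k x * (c i * v i j * (conj (d l) * conj (w l k))) := Finset.sum_comm
    _ = ∑ i ∈ s, ∑ j, ∑ l ∈ s, ∑ k,
        b j k x * (c i * v i j * (conj (d l) * conj (w l k))) :=
        Finset.sum_congr rfl fun i _ => Finset.sum_congr rfl fun j _ => Finset.sum_comm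
    _ = ∑ i ∈ s, ∑ l ∈ s, ∑ j, ∑ k,
        b j k x * (c i * v i j * (conj (d l) * conj (w l k))) :=
        Finset.sum_congr rfl fun i _ => Finset.sum_comm
    _ = _ := Finset.sum_congr rfl fun i _ => Finset.sum_congr rfl fun l _ =>
        Finset.sum_congr rfl fun j _ => Finset.sum_congr rfl fun k _ => by ring

theorem hermQuad_transpose_gramMatrix (b : Fin n → Fin n → (Fin n → ℂ) → ℂ) (x : Fin n → ℂ)
    (v : Fin m → Fin n → ℂ) (c : Fin m → ℂ) :
    hermQuad (gramMatrix b x v).transpose c = (coeffForm b x (∑ i, c i • v i)).re := by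
  rw [hermQuad_eq_sum, show coeffForm b x (∑ i, c i • v i) =
    coeffForm₂ b x (∑ i, c i • v i) (∑ i, c i • v i) from rfl, coeffForm₂_sum_smul,
    Finset.sum_comm]
  congr 1
  refine Finset.sum_congr rfl fun i _ => Finset.sum_congr rfl fun j _ => ?_
  simp only [Matrix.transpose_apply, gramMatrix, Matrix.of_apply]
  ring

theorem gramMatrix_isHermitian {b : Fin n → Fin n → (Fin n → ℂ) → ℂ} {x : Fin n → ℂ}
    (hb : ∀ j k, b j k x = conj (b k j x)) (v : Fin m → Fin n → ℂ) :
    (gramMatrix b x v).IsHermitian :=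
  Matrix.IsHermitian.ext fun i j => (coeffForm₂_conj_symm hb (v i) (v j)).symm

/-- Multiplying the vectors by scalars `c_i` multiplies the Gram determinant by `∏ |c_i|²`. -/
theorem det_gramMatrix_smul (b : Fin n → Fin n → (Fin n → ℂ) → ℂ) (x : Fin n → ℂ)
    (v : Fin m → Fin n → ℂ) (c : Fin m → ℂ) :
    (gramMatrix b x fun i => c i • v i).det.re = ‖∏ i, c i‖ ^ 2 * (gramMatrix b x v).det.re := by
  have h : gramMatrix b x (fun i => c i • v i) =
      Matrix.of fun i j => c i * (Matrix.of fun i j => conj (c j) * gramMatrix b x v i j) i j := by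
    ext i j
    simp only [gramMatrix, Matrix.of_apply]
    have := coeffForm₂_sum_smul b x (Finset.univ : Finset (Fin 1)) (fun _ => c i) (fun _ => c j)
      (fun _ => v i) (fun _ => v j)
    simp only [Finset.univ_unique, Finset.sum_singleton] at this
    rw [this, mul_assoc]
  rw [h, Matrix.det_mul_column, Matrix.det_mul_row, ← mul_assoc, ← map_prod, Complex.mul_conj']
  norm_cast
  rw [Complex.re_ofReal_mul]

/-- The Gram determinant of holomorphic vector fields along a null line has the submean value
property. -/
theorem det_gramMatrix_le_circleAverage {u : (Fin n → ℂ) → ℝ}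
    {b : Fin n → Fin n → (Fin n → ℂ) → ℂ}
    {O : Set (Fin n → ℂ)} (hO : IsOpen O) (hu : ContinuousOn u O)
    (hb : ∀ j k, ContinuousOn (b j k) O) (hw : WeakDDbar u b O) (hpsh : SubmeanOnDiscs u O)
    {γ₀ w : Fin n → ℂ} {Ω : Set ℂ} (hΩ : IsOpen Ω) (hγ : ∀ x ∈ Ω, γ₀ + x • w ∈ O)
    (hnull : ∀ x ∈ Ω, (coeffForm b (γ₀ + x • w) w).re = 0) {ζ : Fin m → ℂ → Fin n → ℂ}
    (hζ : ∀ i, DifferentiableOn ℂ (ζ i) Ω) {a : ℂ} {r : ℝ} (hr : 0 < r)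
    (haΩ : closedBall a r ⊆ Ω) :
    (gramMatrix b (γ₀ + a • w) fun i => ζ i a).det.re ≤
      circleAverage (fun x => (gramMatrix b (γ₀ + x • w) fun i => ζ i x).det.re) a r := by
  have ha : a ∈ Ω := haΩ (mem_closedBall_self hr.le)
  have hcirc : ∀ θ, circleMap a r θ ∈ Ω := fun θ =>
    haΩ (sphere_subset_closedBall (circleMap_mem_sphere a hr.le θ))
  have hherm : ∀ x ∈ Ω, (gramMatrix b (γ₀ + x • w) fun i => ζ i x).transpose.IsHermitian :=
    fun x hx => (gramMatrix_isHermitian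
      (fun j k => WeakDDbar.conj_symm hO hb hw j k (hγ x hx)) _).transpose
  have hpos : ∀ x ∈ Ω, ∀ c, 0 ≤ hermQuad (gramMatrix b (γ₀ + x • w) fun i => ζ i x).transpose c :=
    fun x hx c => by
      rw [hermQuad_transpose_gramMatrix]
      exact coeffForm_nonneg hO hu hb hw hpsh (hγ x hx) _
  have hcont : Continuous fun θ : ℝ =>
      (gramMatrix b (γ₀ + circleMap a r θ • w) fun i => ζ i (circleMap a r θ)).transpose := by
    have h1 : ∀ i, Continuous fun θ : ℝ => ζ i (circleMap a r θ) := fun i =>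
      (hζ i).continuousOn.comp_continuous (continuous_circleMap a r) hcirc
    have h2 : Continuous fun θ : ℝ => γ₀ + circleMap a r θ • w :=
      continuous_const.add ((continuous_circleMap a r).smul continuous_const)
    refine continuous_pi fun i => continuous_pi fun j => continuous_iff_continuousAt.2 fun θ => ?_
    exact continuousAt_coeffForm₂ hO hb h2.continuousAt (h1 j).continuousAt (h1 i).continuousAt
      (hγ _ (hcirc θ))
  have hper : Function.Periodic (fun θ : ℝ =>
      (gramMatrix b (γ₀ + circleMap a r θ • w) fun i => ζ i (circleMap a r θ)).transpose)
      (2 * π) := fun θ => by simp only [periodic_circleMap a r θ]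
  have key := det_le_integral_det hcont hper (fun θ => hherm _ (hcirc θ))
    (fun θ => hpos _ (hcirc θ)) (hherm a ha) (hpos a ha) fun q => by
      have hr0 : (r : ℂ) ≠ 0 := by exact_mod_cast hr.ne'
      -- the polynomials are evaluated at the variable `(x - a) / r` of the unit disc
      have h := coeffForm_le_circleAverage hO hu hb hw hpsh hΩ hγ hnull
        (ζ := fun x => ∑ i, (q i).eval ((x - a) / r) • ζ i x)
        (DifferentiableOn.fun_sum fun i _ => DifferentiableOn.smul
          (((q i).differentiable.comp (by fun_prop :
            Differentiable ℂ fun x : ℂ => (x - a) / r)).differentiableOn) (hζ i)) hr haΩ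
      simp only [hermQuad_transpose_gramMatrix]
      rw [circleAverage_def, smul_eq_mul] at h
      have h3 : ∀ θ : ℝ, (circleMap a r θ - a) / r = Complex.exp (θ * Complex.I) := fun θ => by
        rw [circleMap_sub_center, circleMap_zero, mul_div_cancel_left₀ _ hr0]
      simpa only [sub_self, zero_div, h3] using h
  simpa only [Matrix.det_transpose, circleAverage_def, smul_eq_mul] using key

theorem det_gramMatrix_nonneg {u : (Fin n → ℂ) → ℝ}
    {b : Fin n → Fin n → (Fin n → ℂ) → ℂ}
    {O : Set (Fin n → ℂ)} (hO : IsOpen O) (hu : ContinuousOn u O)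
    (hb : ∀ j k, ContinuousOn (b j k) O) (hw : WeakDDbar u b O) (hpsh : SubmeanOnDiscs u O)
    {x : Fin n → ℂ} (hx : x ∈ O) (v : Fin m → Fin n → ℂ) : 0 ≤ (gramMatrix b x v).det.re := by
  have hherm := (gramMatrix_isHermitian
    (fun j k => WeakDDbar.conj_symm hO hb hw j k hx) v).transpose
  have hpos : (gramMatrix b x v).transpose.PosSemidef := by
    refine Matrix.PosSemidef.of_dotProduct_mulVec_nonneg hherm fun c => ?_
    have him : (star c ⬝ᵥ (gramMatrix b x v).transpose.mulVec c).im = 0 := by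
      simpa using hherm.im_star_dotProduct_mulVec_self c
    have hre : 0 ≤ hermQuad (gramMatrix b x v).transpose c := by
      rw [hermQuad_transpose_gramMatrix]
      exact coeffForm_nonneg hO hu hb hw hpsh hx _
    exact Complex.le_def.2 ⟨hre, by simpa using him.symm⟩
  have := hpos.det_nonneg
  rw [Matrix.det_transpose] at this
  simpa using (Complex.le_def.1 this).1

theorem normSq_le_circleAverage {g : ℂ → ℂ} {Ω : Set ℂ} (hg : DifferentiableOn ℂ g Ω) {a : ℂ}
    {r : ℝ} (hr : 0 < r) (haΩ : closedBall a r ⊆ Ω) :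
    ‖g a‖ ^ 2 ≤ circleAverage (fun x => ‖g x‖ ^ 2) a r := by
  have hg2 : DiffContOnCl ℂ (fun x => g x ^ 2) (ball a |r|) := by
    rw [abs_of_pos hr]
    refine DifferentiableOn.diffContOnCl ?_
    rw [closure_ball a hr.ne']
    exact (hg.mono haΩ).pow 2
  have h := hg2.circleAverage
  rw [← norm_pow, ← h, circleAverage_def, norm_smul, circleAverage_def, smul_eq_mul,
    norm_of_nonneg (by positivity : (0 : ℝ) ≤ (2 * π)⁻¹)]
  gcongr
  refine (intervalIntegral.norm_integral_le_integral_norm two_pi_pos.le).trans_eq ?_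
  simp only [norm_pow]

/-- The submean value property of weighted Gram determinants. The weight `|g|²` is absorbed by the vector fields; there is none to absorb it when `m = 0`,
where the claim is that `|g|²` is subharmonic. -/
theorem normSq_mul_det_gramMatrix_le_circleAverage {u : (Fin n → ℂ) → ℝ}
    {b : Fin n → Fin n → (Fin n → ℂ) → ℂ}
    {O : Set (Fin n → ℂ)} (hO : IsOpen O) (hu : ContinuousOn u O)
    (hb : ∀ j k, ContinuousOn (b j k) O) (hw : WeakDDbar u b O) (hpsh : SubmeanOnDiscs u O)
    {γ₀ w : Fin n → ℂ} {Ω : Set ℂ} (hΩ : IsOpen Ω) (hγ : ∀ x ∈ Ω, γ₀ + x • w ∈ O)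
    (hnull : ∀ x ∈ Ω, (coeffForm b (γ₀ + x • w) w).re = 0) {ζ : Fin m → ℂ → Fin n → ℂ}
    (hζ : ∀ i, DifferentiableOn ℂ (ζ i) Ω) {g : ℂ → ℂ} (hg : DifferentiableOn ℂ g Ω) {a : ℂ}
    {r : ℝ} (hr : 0 < r) (haΩ : closedBall a r ⊆ Ω) :
    ‖g a‖ ^ 2 * (gramMatrix b (γ₀ + a • w) fun i => ζ i a).det.re ≤
      circleAverage (fun x => ‖g x‖ ^ 2 *
        (gramMatrix b (γ₀ + x • w) fun i => ζ i x).det.re) a r := by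
  cases m with
  | zero => simpa using normSq_le_circleAverage hg hr haΩ
  | succ m =>
    have h := det_gramMatrix_le_circleAverage hO hu hb hw hpsh hΩ hγ hnull
      (ζ := fun i x => (Function.update (fun _ => (1 : ℂ)) 0 (g x) : Fin (m + 1) → ℂ) i • ζ i x)
      (fun i => by
        by_cases hi : i = 0
        · subst hi
          simp only [Function.update_self]
          exact DifferentiableOn.smul hg (hζ 0)
        · simpa [Function.update_of_ne hi] using hζ i) hr haΩ
    have hprod : ∀ x, ∏ i, (Function.update (fun _ => (1 : ℂ)) 0 (g x) : Fin (m + 1) → ℂ) i = g x :=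
      fun x => by simp [Finset.prod_update_of_mem]
    simpa only [det_gramMatrix_smul, hprod] using h

end GramAlongLine

/-! ### Passage to local coordinates -/

section LocalCoordinates

variable {n : ℕ} {Z : Type*} [TopologicalSpace Z] [ChartedSpace (Fin n → ℂ) Z]

theorem mdifferentiable_of_mem_maximalAtlas {E M : Type*} [NormedAddCommGroup E] [NormedSpace ℂ E]
    [TopologicalSpace M] [ChartedSpace E M] [IsManifold 𝓘(ℂ, E) ω M] {e : OpenPartialHomeomorph M E}
    (he : e ∈ IsManifold.maximalAtlas 𝓘(ℂ, E) ω M) :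
    e.MDifferentiable 𝓘(ℂ, E) 𝓘(ℂ, E) :=
  ⟨(contMDiffOn_of_mem_maximalAtlas he).mdifferentiableOn (by simp),
    (contMDiffOn_symm_of_mem_maximalAtlas he).mdifferentiableOn (by simp)⟩

theorem HasContinuousDDbar.continuousOn_comp_symm {U : Z → ℝ} {ψ : Form11 n Z}
    (hU : HasContinuousDDbar U ψ) (e : OpenPartialHomeomorph Z (Fin n → ℂ)) :
    ContinuousOn (fun x => U (e.symm x)) e.target :=
  hU.continuous.comp_continuousOn e.continuousOn_symm

theorem HasContinuousDDbar.weakDDbar {U : Z → ℝ} {ψ : Form11 n Z}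
    (hU : HasContinuousDDbar U ψ) {e : OpenPartialHomeomorph Z (Fin n → ℂ)}
    (he : e ∈ IsManifold.maximalAtlas 𝓘(ℂ, Fin n → ℂ) ω Z) :
    WeakDDbar (fun x => U (e.symm x)) (ψ.coeff e) e.target :=
  hU.integral_eq e he

theorem Plurisubharmonic.submeanOnDiscs [IsManifold 𝓘(ℂ, Fin n → ℂ) ω Z] {U : Z → ℝ}
    (hU : Plurisubharmonic n fun z => (U z : EReal)) (hc : Continuous U)
    {e : OpenPartialHomeomorph Z (Fin n → ℂ)}
    (he : e ∈ IsManifold.maximalAtlas 𝓘(ℂ, Fin n → ℂ) ω Z) :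
    SubmeanOnDiscs (fun x => U (e.symm x)) e.target := by
  intro Ω f hΩ hf hfO a r hr haΩ
  have h1 := hU.comp_holomorphic Ω (fun x => e.symm (f x)) hΩ
    ((mdifferentiable_of_mem_maximalAtlas he).2.comp
      (mdifferentiableOn_iff_differentiableOn.2 hf) hfO)
  exact h1.le_circleAverage (w := fun x => U (e.symm (f x)))
    (hc.comp_continuousOn (e.continuousOn_symm.comp hf.continuousOn hfO)) hr haΩ

/-- A form of bidegree `(1,1)` in local coordinates. -/
theorem Form11.eq_coeffForm₂ [IsManifold 𝓘(ℂ, Fin n → ℂ) ω Z] (ψ : Form11 n Z)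
    {e : OpenPartialHomeomorph Z (Fin n → ℂ)}
    (he : e ∈ IsManifold.maximalAtlas 𝓘(ℂ, Fin n → ℂ) ω Z) {z : Z} (hz : z ∈ e.source)
    (ζ η : TangentSpace 𝓘(ℂ, Fin n → ℂ) z) :
    ψ z ζ η = coeffForm₂ (ψ.coeff e) (e z)
      (mfderiv 𝓘(ℂ, Fin n → ℂ) 𝓘(ℂ, Fin n → ℂ) e z ζ : Fin n → ℂ)
      (mfderiv 𝓘(ℂ, Fin n → ℂ) 𝓘(ℂ, Fin n → ℂ) e z η : Fin n → ℂ) := by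
  have hd := mdifferentiable_of_mem_maximalAtlas he
  let D : (Fin n → ℂ) →L[ℂ] (Fin n → ℂ) :=
    mfderiv 𝓘(ℂ, Fin n → ℂ) 𝓘(ℂ, Fin n → ℂ) e.symm (e z)
  let D' : (Fin n → ℂ) →L[ℂ] (Fin n → ℂ) := mfderiv 𝓘(ℂ, Fin n → ℂ) 𝓘(ℂ, Fin n → ℂ) e z
  have hinv : ∀ v, D (D' v) = v := fun v => congrArg (fun L => L v) (hd.symm_comp_deriv hz)
  have hexp : ∀ v, v = ∑ j, D' v j • D (Pi.single j 1) := fun v => by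
    conv_lhs => rw [← hinv v, pi_eq_sum_univ' (D' v), map_sum]
    simp only [map_smul]
  let B : (Fin n → ℂ) →ₗ[ℂ] (Fin n → ℂ) →ₗ⋆[ℂ] ℂ := ψ z
  have hcoeff : ∀ j k, ψ.coeff e j k (e z) = B (D (Pi.single j 1)) (D (Pi.single k 1)) := by
    have hpt : ∀ z', z' = z → ∀ v w : Fin n → ℂ, ψ z' v w = B v w := by
      rintro _ rfl v w
      rfl
    exact fun j k => hpt _ (e.left_inv hz) _ _
  change B ζ η = coeffForm₂ (ψ.coeff e) (e z) (D' ζ) (D' η)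
  conv_lhs => rw [hexp ζ, hexp η]
  simp only [coeffForm₂, hcoeff, map_sum, map_smul, LinearMap.sum_apply, LinearMap.smul_apply,
    LinearMap.map_smulₛₗ, smul_eq_mul, Finset.mul_sum]
  rw [Finset.sum_comm]
  exact Finset.sum_congr rfl fun j _ => Finset.sum_congr rfl fun k _ => by ring

variable {Y : Type*} [TopologicalSpace Y] [ChartedSpace ℂ Y]

/-- A vector field along `ι`, written in coordinates `c` on `Y` and `e` on `Z`. -/
noncomputable def coordField (ι : Y → Z) (c : OpenPartialHomeomorph Y ℂ)
    (e : OpenPartialHomeomorph Z (Fin n → ℂ))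
    (ζ : ∀ y, TangentSpace 𝓘(ℂ, Fin n → ℂ) (ι y)) (x : ℂ) : Fin n → ℂ :=
  mfderiv 𝓘(ℂ, Fin n → ℂ) 𝓘(ℂ, Fin n → ℂ) e (ι (c.symm x)) (ζ (c.symm x))

theorem differentiableOn_coordField [IsManifold 𝓘(ℂ, Fin n → ℂ) ω Z] [IsManifold 𝓘(ℂ, ℂ) ω Y]
    {ι : Y → Z} {c : OpenPartialHomeomorph Y ℂ} {e : OpenPartialHomeomorph Z (Fin n → ℂ)}
    (hc : c ∈ IsManifold.maximalAtlas 𝓘(ℂ, ℂ) ω Y)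
    (he : e ∈ IsManifold.maximalAtlas 𝓘(ℂ, Fin n → ℂ) ω Z)
    (hι : MapsTo ι c.source e.source) {ζ : ∀ y, TangentSpace 𝓘(ℂ, Fin n → ℂ) (ι y)} {V : Set Y}
    (hζ : MDifferentiableOn 𝓘(ℂ, ℂ) (𝓘(ℂ, Fin n → ℂ).tangent)
      (fun y => (⟨ι y, ζ y⟩ : TangentBundle 𝓘(ℂ, Fin n → ℂ) Z)) V) :
    DifferentiableOn ℂ (coordField ι c e ζ) (c.target ∩ c.symm ⁻¹' V) := by
  have : IsManifold 𝓘(ℂ, Fin n → ℂ) 1 Z := IsManifold.of_le (n := ω) (by simp)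
  have hT : ContMDiffOn (𝓘(ℂ, Fin n → ℂ).tangent) (𝓘(ℂ, Fin n → ℂ).tangent) 1
      (tangentMapWithin 𝓘(ℂ, Fin n → ℂ) 𝓘(ℂ, Fin n → ℂ) e e.source)
      (Bundle.TotalSpace.proj ⁻¹' e.source) :=
    (contMDiffOn_of_mem_maximalAtlas he).contMDiffOn_tangentMapWithin (by simp)
      e.open_source.uniqueMDiffOn
  have hsnd := (contMDiff_snd_tangentBundle_modelSpace (n := 1) (Fin n → ℂ)
    𝓘(ℂ, Fin n → ℂ)).mdifferentiable (by simp)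
  have h1 : MDifferentiableOn 𝓘(ℂ, ℂ) (𝓘(ℂ, Fin n → ℂ).tangent)
      (fun x => (⟨ι (c.symm x), ζ (c.symm x)⟩ : TangentBundle 𝓘(ℂ, Fin n → ℂ) Z))
      (c.target ∩ c.symm ⁻¹' V) :=
    hζ.comp ((mdifferentiable_of_mem_maximalAtlas hc).2.mono inter_subset_left) fun x hx => hx.2
  have h2 := hsnd.comp_mdifferentiableOn ((hT.mdifferentiableOn (by simp)).comp h1
    fun x hx => hι (c.map_target hx.1))
  refine (mdifferentiableOn_iff_differentiableOn.1 h2).congr fun x hx => ?_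
  have hs : ι (c.symm x) ∈ e.source := hι (c.map_target hx.1)
  exact congrArg (fun L : (Fin n → ℂ) →L[ℂ] (Fin n → ℂ) => L (ζ (c.symm x)))
    (mfderivWithin_of_isOpen e.open_source hs).symm

/-- Coordinates `c` on `Y` and `e` on `Z` in which the immersed curve `ι : Y → Z` is the piece
`x ↦ x • w` of a line. -/
structure IsStraightening (ι : Y → Z) (c : OpenPartialHomeomorph Y ℂ)
    (e : OpenPartialHomeomorph Z (Fin n → ℂ)) (w : Fin n → ℂ) : Prop where
  dom_mem : c ∈ IsManifold.maximalAtlas 𝓘(ℂ, ℂ) ω Y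
  cod_mem : e ∈ IsManifold.maximalAtlas 𝓘(ℂ, Fin n → ℂ) ω Z
  mapsTo : MapsTo ι c.source e.source
  apply_eq : ∀ y ∈ c.source, e (ι y) = c y • w

theorem exists_isStraightening {ι : Y → Z}
    (hι : IsImmersion 𝓘(ℂ, ℂ) 𝓘(ℂ, Fin n → ℂ) ω ι) (y₀ : Y) :
    ∃ c e w, IsStraightening (n := n) ι c e w ∧ y₀ ∈ c.source := by
  have h := hι.isImmersionAt y₀
  refine ⟨h.domChart, h.codChart, h.equiv (1, 0), ⟨h.domChart_mem_maximalAtlas,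
    h.codChart_mem_maximalAtlas, h.source_subset_preimage_source, fun y hy => ?_⟩,
    h.mem_domChart_source⟩
  have h1 := h.writtenInCharts (show h.domChart y ∈ (h.domChart.extend 𝓘(ℂ, ℂ)).target by
    simpa using h.domChart.map_source hy)
  simp only [Function.comp_apply, OpenPartialHomeomorph.extend_coe,
    OpenPartialHomeomorph.extend_coe_symm, modelWithCornersSelf_coe,
    modelWithCornersSelf_coe_symm, id_eq, h.domChart.left_inv hy] at h1
  rw [h1, ← map_smul]
  simp

namespace IsStraightening

variable {ι : Y → Z} {c : OpenPartialHomeomorph Y ℂ} {e : OpenPartialHomeomorph Z (Fin n → ℂ)}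
  {w : Fin n → ℂ}

theorem apply_symm (h : IsStraightening ι c e w) {x : ℂ} (hx : x ∈ c.target) :
    e (ι (c.symm x)) = x • w := by
  rw [h.apply_eq _ (c.map_target hx), c.right_inv hx]

theorem smul_mem_target (h : IsStraightening ι c e w) {x : ℂ} (hx : x ∈ c.target) :
    x • w ∈ e.target := by
  rw [← h.apply_symm hx]
  exact e.map_source (h.mapsTo (c.map_target hx))

variable [IsManifold 𝓘(ℂ, Fin n → ℂ) ω Z]

theorem form_eq (h : IsStraightening ι c e w) (ψ : Form11 n Z) {x : ℂ} (hx : x ∈ c.target)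
    (ζ η : ∀ y, TangentSpace 𝓘(ℂ, Fin n → ℂ) (ι y)) :
    ψ (ι (c.symm x)) (ζ (c.symm x)) (η (c.symm x)) =
      coeffForm₂ (ψ.coeff e) (x • w) (coordField ι c e ζ x) (coordField ι c e η x) := by
  rw [← h.apply_symm hx]
  exact ψ.eq_coeffForm₂ h.cod_mem (h.mapsTo (c.map_target hx)) _ _

variable [IsManifold 𝓘(ℂ, ℂ) ω Y]

/-- The direction `w` of the line is the image of a tangent vector of the curve. -/
theorem exists_mem_tangentOf (h : IsStraightening ι c e w)
    (hι : MDifferentiable 𝓘(ℂ, ℂ) 𝓘(ℂ, Fin n → ℂ) ι) {x : ℂ} (hx : x ∈ c.target) :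
    ∃ v ∈ tangentOf n ι (c.symm x),
      mfderiv 𝓘(ℂ, Fin n → ℂ) 𝓘(ℂ, Fin n → ℂ) e (ι (c.symm x)) v = w := by
  have hc := mdifferentiable_of_mem_maximalAtlas h.dom_mem
  have he := mdifferentiable_of_mem_maximalAtlas h.cod_mem
  refine ⟨mfderiv 𝓘(ℂ, ℂ) 𝓘(ℂ, Fin n → ℂ) ι (c.symm x)
    (mfderiv 𝓘(ℂ, ℂ) 𝓘(ℂ, ℂ) c.symm x (1 : ℂ)), ⟨_, rfl⟩, ?_⟩
  have h1 : MDifferentiableAt 𝓘(ℂ, ℂ) 𝓘(ℂ, ℂ) c.symm x := hc.mdifferentiableAt_symm hx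
  have h2 : MDifferentiableAt 𝓘(ℂ, ℂ) 𝓘(ℂ, Fin n → ℂ) (ι ∘ c.symm) x := (hι _).comp x h1
  have h3 : MDifferentiableAt 𝓘(ℂ, Fin n → ℂ) 𝓘(ℂ, Fin n → ℂ) e ((ι ∘ c.symm) x) :=
    he.mdifferentiableAt (h.mapsTo (c.map_target hx))
  have h4 := mfderiv_comp x h3 h2
  have h5 := mfderiv_comp x (hι (c.symm x)) h1
  have h6 : mfderiv 𝓘(ℂ, ℂ) 𝓘(ℂ, Fin n → ℂ) (e ∘ ι ∘ c.symm) x =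
      fderiv ℂ (fun x : ℂ => x • w) x := by
    rw [← mfderiv_eq_fderiv]
    refine Filter.EventuallyEq.mfderiv_eq ?_
    filter_upwards [c.open_target.mem_nhds hx] with x' hx'
    exact h.apply_symm hx'
  have h7 : fderiv ℂ (fun x : ℂ => x • w) x (1 : ℂ) = w := by
    have : HasFDerivAt (fun x : ℂ => x • w) ((ContinuousLinearMap.id ℂ ℂ).smulRight w) x :=
      ((ContinuousLinearMap.id ℂ ℂ).smulRight w).hasFDerivAt
    rw [this.fderiv]
    simp
  rw [h5] at h4
  have h8 := congrArg (fun L : ℂ →L[ℂ] (Fin n → ℂ) => L 1) (h4.symm.trans h6)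
  exact h8.trans h7

theorem coeffForm_eq_zero (h : IsStraightening ι c e w)
    (hι : MDifferentiable 𝓘(ℂ, ℂ) 𝓘(ℂ, Fin n → ℂ) ι) {ψ : Form11 n Z}
    (hψ : TangentSubsetKer ι ψ) {x : ℂ} (hx : x ∈ c.target) :
    coeffForm (ψ.coeff e) (x • w) w = 0 := by
  obtain ⟨v, hv, hvw⟩ := h.exists_mem_tangentOf hι hx
  have h1 := ψ.eq_coeffForm₂ h.cod_mem (h.mapsTo (c.map_target hx)) v v
  rw [(hψ _ v hv).1 v, hvw, h.apply_symm hx] at h1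
  exact h1.symm

end IsStraightening

end LocalCoordinates

/-! ### Logarithmically subharmonic functions on a curve -/

section Curve

open Metric Real

variable {Y : Type*} [TopologicalSpace Y] [ChartedSpace ℂ Y]

/-- On the open set `W`, the function `v ≥ 0` is continuous and, written in the coordinate `c`, all
its products `|g|² v` with squared absolute values of holomorphic functions have the submean value
property. -/
structure IsWeightedSubmean (v : Y → ℝ) (c : OpenPartialHomeomorph Y ℂ) (W : Set Y) : Prop where
  mem_maximalAtlas : c ∈ IsManifold.maximalAtlas 𝓘(ℂ, ℂ) ω Y
  isOpen : IsOpen W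
  subset_source : W ⊆ c.source
  continuousOn : ContinuousOn v W
  nonneg : ∀ y ∈ W, 0 ≤ v y
  le_circleAverage : ∀ (Ω : Set ℂ) (g : ℂ → ℂ), IsOpen Ω → Ω ⊆ c.target ∩ c.symm ⁻¹' W →
    DifferentiableOn ℂ g Ω → ∀ a r, 0 < r → closedBall a r ⊆ Ω →
      ‖g a‖ ^ 2 * v (c.symm a) ≤ circleAverage (fun x => ‖g x‖ ^ 2 * v (c.symm x)) a r

theorem IsWeightedSubmean.congr {v v' : Y → ℝ} {c : OpenPartialHomeomorph Y ℂ} {W : Set Y}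
    (h : IsWeightedSubmean v c W) (hv : EqOn v' v W) : IsWeightedSubmean v' c W where
  mem_maximalAtlas := h.mem_maximalAtlas
  isOpen := h.isOpen
  subset_source := h.subset_source
  continuousOn := h.continuousOn.congr hv
  nonneg y hy := by
    rw [hv hy]
    exact h.nonneg y hy
  le_circleAverage Ω g hΩ hΩW hg a r hr har := by
    have h1 : circleAverage (fun x => ‖g x‖ ^ 2 * v' (c.symm x)) a r =
        circleAverage (fun x => ‖g x‖ ^ 2 * v (c.symm x)) a r := by
      refine circleAverage_congr_sphere fun x hx => ?_
      rw [abs_of_pos hr] at hx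
      rw [hv (hΩW (har (sphere_subset_closedBall hx))).2]
    rw [h1, hv (hΩW (har (mem_closedBall_self hr.le))).2]
    exact h.le_circleAverage Ω g hΩ hΩW hg a r hr har

theorem norm_exp_half_sq (q : ℂ) : ‖Complex.exp (q / 2)‖ ^ 2 = exp q.re := by
  rw [Complex.norm_exp, ← exp_nat_mul]
  congr 1
  simp
  ring

/-- The maximum principle for the products of `v` with exponentials of harmonic functions. -/
theorem IsWeightedSubmean.eventually_eq_of_isLocalMax [IsManifold 𝓘(ℂ, ℂ) ω Y] {v : Y → ℝ}
    {c : OpenPartialHomeomorph Y ℂ} {W : Set Y} (h : IsWeightedSubmean v c W)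
    {q : Y → ℂ} {V : Set Y} (hV : IsOpen V) (hq : MDifferentiableOn 𝓘(ℂ, ℂ) 𝓘(ℂ, ℂ) q V) {y₀ : Y}
    (hyW : y₀ ∈ W) (hyV : y₀ ∈ V)
    (hmax : ∀ᶠ y in 𝓝 y₀, v y * exp (q y).re ≤ v y₀ * exp (q y₀).re) :
    ∀ᶠ y in 𝓝 y₀, v y * exp (q y).re = v y₀ * exp (q y₀).re := by
  have hyc : y₀ ∈ c.source := h.subset_source hyW
  set Ω : Set ℂ := c.target ∩ c.symm ⁻¹' (V ∩ W) with hΩdef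
  have hΩ : IsOpen Ω := c.isOpen_inter_preimage_symm (hV.inter h.isOpen)
  have hΩW : Ω ⊆ c.target ∩ c.symm ⁻¹' W := fun x hx => ⟨hx.1, hx.2.2⟩
  have hat : c y₀ ∈ c.target := c.map_source hyc
  have haΩ : c y₀ ∈ Ω := ⟨hat, by simpa only [mem_preimage, c.left_inv hyc] using ⟨hyV, hyW⟩⟩
  -- `|g|²` is the absolute value of `exp q`
  set g : ℂ → ℂ := fun x => Complex.exp (q (c.symm x) / 2) with hgdef
  have hg : DifferentiableOn ℂ g Ω := by
    have h1 : DifferentiableOn ℂ (fun x => q (c.symm x)) Ω :=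
      mdifferentiableOn_iff_differentiableOn.1
        (hq.comp ((mdifferentiable_of_mem_maximalAtlas h.mem_maximalAtlas).2.mono
          inter_subset_left) fun x hx => hx.2.1)
    exact (h1.div_const 2).cexp
  set G : ℂ → ℝ := fun x => ‖g x‖ ^ 2 * v (c.symm x) with hGdef
  have hG : ∀ x, G x = v (c.symm x) * exp (q (c.symm x)).re := fun x => by
    rw [hGdef]
    simp only [hgdef]
    rw [norm_exp_half_sq, mul_comm]
  have hGcont : ContinuousOn G Ω :=
    (hg.continuousOn.norm.pow 2).mul
      (h.continuousOn.comp (c.continuousOn_symm.mono inter_subset_left) fun x hx => hx.2.2)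
  have hmax' : ∀ᶠ x in 𝓝 (c y₀), G x ≤ G (c y₀) := by
    have h1 : Filter.Tendsto c.symm (𝓝 (c y₀)) (𝓝 y₀) := c.tendsto_symm hyc
    filter_upwards [h1.eventually hmax] with x hx
    rwa [hG, hG, c.left_inv hyc]
  obtain ⟨R, hR, hball⟩ := Metric.eventually_nhds_iff_ball.1 (hmax'.and (hΩ.mem_nhds haΩ))
  have hconst := eq_of_isMax_of_le_circleAverage (hGcont.mono fun x hx => (hball x hx).2)
    (fun r hr hrR => h.le_circleAverage Ω g hΩ hΩW hg _ r hr
      ((closedBall_subset_ball hrR).trans fun x hx => (hball x hx).2))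
    (fun x hx => (hball x hx).1)
  filter_upwards [(c.continuousAt hyc).eventually_mem (ball_mem_nhds _ hR),
    c.open_source.mem_nhds hyc] with y hy hyc'
  have := hconst _ hy
  rwa [hG, hG, c.left_inv hyc, c.left_inv hyc'] at this

/-- The criterion for logarithmic subharmonicity on a curve. The coordinate `c` in which mean values
are known is not the coordinate `e` in which subharmonicity is to be shown; the maximum principle
transfers from one to the other. -/
theorem subharmonicOnCurve_log [IsManifold 𝓘(ℂ, ℂ) ω Y] {v : Y → ℝ} {Y' : Set Y}
    (h : ∀ y₀ ∈ Y', ∃ c W, y₀ ∈ W ∧ IsWeightedSubmean v c W) :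
    SubharmonicOnCurve (fun y => ENNReal.log (ENNReal.ofReal (v y))) Y' := by
  intro e he
  refine subharmonicOn_log (v := fun x => v (e.symm x)) (fun x hx => ?_) (fun x hx => ?_)
    fun x hx p hp => ?_
  · obtain ⟨c, W, hyW, hW⟩ := h _ hx.2
    exact (ContinuousAt.comp (f := e.symm) (hW.continuousOn.continuousAt (hW.isOpen.mem_nhds hyW))
      (e.symm.continuousAt hx.1)).continuousWithinAt
  · obtain ⟨c, W, hyW, hW⟩ := h _ hx.2
    exact hW.nonneg _ hyW
  · obtain ⟨c, W, hyW, hW⟩ := h _ hx.2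
    have hye : e.symm x ∈ e.source := e.map_target hx.1
    have hq : MDifferentiableOn 𝓘(ℂ, ℂ) 𝓘(ℂ, ℂ) (fun y => p.eval (e y)) e.source :=
      (mdifferentiable_iff_differentiable.2 p.differentiable).comp_mdifferentiableOn
        (mdifferentiable_of_mem_maximalAtlas he).1
    have hmax : ∀ᶠ y in 𝓝 (e.symm x), v y * exp (p.eval (e y)).re ≤
        v (e.symm x) * exp (p.eval (e (e.symm x))).re := by
      have h1 := (e.continuousAt hye).tendsto
      rw [e.right_inv hx.1] at h1 ⊢
      filter_upwards [h1.eventually hp, e.open_source.mem_nhds hye] with y hy hy'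
      rwa [e.left_inv hy'] at hy
    have h2 := hW.eventually_eq_of_isLocalMax e.open_source hq hyW hye hmax
    rw [e.right_inv hx.1] at h2
    filter_upwards [(e.symm.continuousAt hx.1).eventually h2, e.open_target.mem_nhds hx.1]
      with z hz hz'
    rwa [e.right_inv hz'] at hz

end Curve

/-! ### Gram determinants on the curve -/

section GramOnCurve

open Metric Real

variable {n : ℕ} {Z : Type*} [TopologicalSpace Z] [ChartedSpace (Fin n → ℂ) Z]
  [IsManifold 𝓘(ℂ, Fin n → ℂ) ω Z]
  {Y : Type*} [TopologicalSpace Y] [ChartedSpace ℂ Y]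

/-- The Gram matrix of vector fields along `ι`, for a form of bidegree `(1,1)`. -/
noncomputable def fieldGram (ι : Y → Z) (ψ : Form11 n Z) {k : ℕ}
    (ζ : Fin k → ∀ y, TangentSpace 𝓘(ℂ, Fin n → ℂ) (ι y)) (y : Y) :
    Matrix (Fin k) (Fin k) ℂ :=
  Matrix.of fun i j => ψ (ι y) (ζ i y) (ζ j y)

theorem IsStraightening.fieldGram_eq {ι : Y → Z} {c : OpenPartialHomeomorph Y ℂ}
    {e : OpenPartialHomeomorph Z (Fin n → ℂ)} {w : Fin n → ℂ} (h : IsStraightening ι c e w)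
    (ψ : Form11 n Z) {k : ℕ} (ζ : Fin k → ∀ y, TangentSpace 𝓘(ℂ, Fin n → ℂ) (ι y)) {x : ℂ}
    (hx : x ∈ c.target) :
    fieldGram ι ψ ζ (c.symm x) =
      gramMatrix (ψ.coeff e) (x • w) fun i => coordField ι c e (ζ i) x := by
  ext i j
  exact h.form_eq ψ hx (ζ i) (ζ j)

variable [IsManifold 𝓘(ℂ, ℂ) ω Y]

/-- Gram determinants of holomorphic vector fields along the curve, weighted by `|f|²`, satisfy the
criterion for logarithmic subharmonicity. -/
theorem IsStraightening.isWeightedSubmean {ι : Y → Z} {c : OpenPartialHomeomorph Y ℂ}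
    {e : OpenPartialHomeomorph Z (Fin n → ℂ)} {w : Fin n → ℂ} (h : IsStraightening ι c e w)
    (hι : MDifferentiable 𝓘(ℂ, ℂ) 𝓘(ℂ, Fin n → ℂ) ι)
    {U : Z → ℝ} {ψ : Form11 n Z} (hU : HasContinuousDDbar U ψ)
    (hpsh : Plurisubharmonic n (fun z => (U z : EReal))) (hψ : TangentSubsetKer ι ψ) {k : ℕ}
    {ζ : Fin k → ∀ y, TangentSpace 𝓘(ℂ, Fin n → ℂ) (ι y)} {V : Set Y} (hV : IsOpen V)
    (hζ : ∀ i, MDifferentiableOn 𝓘(ℂ, ℂ) (𝓘(ℂ, Fin n → ℂ).tangent)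
      (fun y => (⟨ι y, ζ i y⟩ : TangentBundle 𝓘(ℂ, Fin n → ℂ) Z)) V)
    {f : Y → ℂ} (hf : MDifferentiableOn 𝓘(ℂ, ℂ) 𝓘(ℂ, ℂ) f V) :
    IsWeightedSubmean (fun y => ‖f y‖ ^ 2 * (fieldGram ι ψ ζ y).det.re) c (c.source ∩ V) := by
  have hO := e.open_target
  have hu := hU.continuousOn_comp_symm e
  have hb := hU.continuousOn_coeff e h.cod_mem
  have hw := hU.weakDDbar h.cod_mem
  have hp := hpsh.submeanOnDiscs hU.continuous h.cod_mem
  have hcoord : ∀ i, DifferentiableOn ℂ (coordField ι c e (ζ i)) (c.target ∩ c.symm ⁻¹' V) :=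
    fun i => differentiableOn_coordField h.dom_mem h.cod_mem h.mapsTo (hζ i)
  have hf' : DifferentiableOn ℂ (fun x => f (c.symm x)) (c.target ∩ c.symm ⁻¹' V) :=
    mdifferentiableOn_iff_differentiableOn.1
      (hf.comp ((mdifferentiable_of_mem_maximalAtlas h.dom_mem).2.mono inter_subset_left)
        fun x hx => hx.2)
  refine ⟨h.dom_mem, c.open_source.inter hV, inter_subset_left, ?_, fun y hy => ?_,
    fun Ω g hΩ hΩV hg a r hr har => ?_⟩
  · have hopen : IsOpen (c.target ∩ c.symm ⁻¹' V) := c.isOpen_inter_preimage_symm hV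
    have h1 : ContinuousOn (fun x : ℂ => (gramMatrix (ψ.coeff e) (x • w)
        fun i => coordField ι c e (ζ i) x).det.re) (c.target ∩ c.symm ⁻¹' V) := by
      refine Complex.continuous_re.comp_continuousOn ?_
      refine (continuous_id.matrix_det).comp_continuousOn (continuousOn_pi.2 fun i =>
        continuousOn_pi.2 fun j => fun x hx => ContinuousAt.continuousWithinAt ?_)
      exact continuousAt_coeffForm₂ hO hb (by fun_prop)
        ((hcoord i).continuousOn.continuousAt (hopen.mem_nhds hx))
        ((hcoord j).continuousOn.continuousAt (hopen.mem_nhds hx)) (h.smul_mem_target hx.1)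
    have hmaps : MapsTo c (c.source ∩ V) (c.target ∩ c.symm ⁻¹' V) := fun y hy =>
      ⟨c.map_source hy.1, by simpa only [mem_preimage, c.left_inv hy.1] using hy.2⟩
    have h2 := h1.comp (c.continuousOn.mono inter_subset_left) hmaps
    refine ((hf.continuousOn.mono inter_subset_right).norm.pow 2).mul (h2.congr fun y hy => ?_)
    have := h.fieldGram_eq ψ ζ (c.map_source hy.1)
    rw [c.left_inv hy.1] at this
    rw [this]
    rfl
  · have := h.fieldGram_eq ψ ζ (c.map_source hy.1)
    rw [c.left_inv hy.1] at this
    rw [this]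
    exact mul_nonneg (by positivity) (det_gramMatrix_nonneg hO hu hb hw hp
      (h.smul_mem_target (c.map_source hy.1)) _)
  · have hΩ' : Ω ⊆ c.target ∩ c.symm ⁻¹' V := fun x hx => ⟨(hΩV hx).1, (hΩV hx).2.2⟩
    have key := normSq_mul_det_gramMatrix_le_circleAverage hO hu hb hw hp (γ₀ := 0) (w := w) hΩ
      (fun x hx => by
        rw [zero_add]
        exact h.smul_mem_target (hΩV hx).1)
      (fun x hx => by
        rw [zero_add, h.coeffForm_eq_zero hι hψ (hΩV hx).1, Complex.zero_re])
      (fun i => (hcoord i).mono hΩ') (hg.mul (hf'.mono hΩ')) hr har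
    have hpt : ∀ x ∈ Ω, ‖g x‖ ^ 2 * (‖f (c.symm x)‖ ^ 2 *
        (fieldGram ι ψ ζ (c.symm x)).det.re) = ‖g x * f (c.symm x)‖ ^ 2 *
          (gramMatrix (ψ.coeff e) (0 + x • w) fun i => coordField ι c e (ζ i) x).det.re :=
      fun x hx => by
        rw [h.fieldGram_eq ψ ζ (hΩV hx).1, norm_mul, zero_add]
        ring
    rw [hpt a (har (mem_closedBall_self hr.le))]
    refine key.trans_eq (circleAverage_congr_sphere fun x hx => ?_)
    rw [abs_of_pos hr] at hx
    exact (hpt x (har (sphere_subset_closedBall hx))).symm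

end GramOnCurve

/-! ### The metrics on the normal bundle and on its determinant -/

section NormalBundle

variable {n : ℕ} {Z : Type*} [TopologicalSpace Z] [ChartedSpace (Fin n → ℂ) Z]
  [IsManifold 𝓘(ℂ, Fin n → ℂ) ω Z]
  {Y : Type*} [TopologicalSpace Y] [ChartedSpace ℂ Y]

/-- Local lifts of finitely many holomorphic sections of the normal bundle. -/
theorem exists_lifts {ι : Y → Z} {k : ℕ} {σ : Fin k → ∀ y, NormalFiber n ι y} {Y' : Set Y}
    (hY' : IsOpen Y') (hσ : ∀ i, IsHolomorphicNormalSection ι (σ i) Y') {y₀ : Y} (hy₀ : y₀ ∈ Y') :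
    ∃ V : Set Y, IsOpen V ∧ y₀ ∈ V ∧ V ⊆ Y' ∧
      ∃ ζ : Fin k → ∀ y, TangentSpace 𝓘(ℂ, Fin n → ℂ) (ι y),
        (∀ i, MDifferentiableOn 𝓘(ℂ, ℂ) (𝓘(ℂ, Fin n → ℂ).tangent)
          (fun y => (⟨ι y, ζ i y⟩ : TangentBundle 𝓘(ℂ, Fin n → ℂ) Z)) V) ∧
        ∀ y ∈ V, ∀ i, σ i y = (tangentOf n ι y).mkQ (ζ i y) := by
  choose V hV hyV _ ζ hζ hσζ using fun i => hσ i y₀ hy₀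
  refine ⟨Y' ∩ ⋂ i, V i, hY'.inter (isOpen_iInter_of_finite hV), ⟨hy₀, mem_iInter.2 hyV⟩,
    inter_subset_left, ζ, fun i => (hζ i).mono fun y hy => mem_iInter.1 hy.2 i,
    fun y hy i => hσζ i y (mem_iInter.1 hy.2 i)⟩

variable [IsManifold 𝓘(ℂ, ℂ) ω Y]

/-- Near every point, the squared norm `|f|² det h(σ_i, σ_j)` is of the kind to which the criterion
for logarithmic subharmonicity applies. -/
theorem exists_isWeightedSubmean {ι : Y → Z}
    (hι : IsImmersion 𝓘(ℂ, ℂ) 𝓘(ℂ, Fin n → ℂ) ω ι) {U : Z → ℝ} {ψ : Form11 n Z}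
    (hU : HasContinuousDDbar U ψ) (hpsh : Plurisubharmonic n (fun z => (U z : EReal)))
    (hψ : TangentSubsetKer ι ψ) {k : ℕ} {σ : Fin k → ∀ y, NormalFiber n ι y} {Y' : Set Y}
    (hY' : IsOpen Y') (hσ : ∀ i, IsHolomorphicNormalSection ι (σ i) Y')
    {f : Y → ℂ} (hf : MDifferentiableOn 𝓘(ℂ, ℂ) 𝓘(ℂ, ℂ) f Y') {y₀ : Y} (hy₀ : y₀ ∈ Y') :
    ∃ c W, y₀ ∈ W ∧ W ⊆ Y' ∧ IsWeightedSubmean (fun y => ‖f y‖ ^ 2 *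
      (Matrix.of fun i j => normalForm ι ψ hψ y (σ i y) (σ j y)).det.re) c W := by
  obtain ⟨V, hV, hyV, hVY', ζ, hζ, hσζ⟩ := exists_lifts hY' hσ hy₀
  obtain ⟨c, e, w, h, hyc⟩ := exists_isStraightening hι y₀
  refine ⟨c, c.source ∩ V, ⟨hyc, hyV⟩, inter_subset_right.trans hVY',
    (h.isWeightedSubmean (hι.contMDiff.mdifferentiable (by simp)) hU hpsh hψ hV hζ
      (hf.mono hVY')).congr fun y hy => ?_⟩
  have : (Matrix.of fun i j => normalForm ι ψ hψ y (σ i y) (σ j y)) = fieldGram ι ψ ζ y := by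
    ext i j
    simp only [Matrix.of_apply, hσζ y hy.2]
    rfl
  simp only [this]

theorem exists_isWeightedSubmean_section {ι : Y → Z}
    (hι : IsImmersion 𝓘(ℂ, ℂ) 𝓘(ℂ, Fin n → ℂ) ω ι) {U : Z → ℝ} {ψ : Form11 n Z}
    (hU : HasContinuousDDbar U ψ) (hpsh : Plurisubharmonic n (fun z => (U z : EReal)))
    (hψ : TangentSubsetKer ι ψ) {σ : ∀ y, NormalFiber n ι y} {Y' : Set Y}
    (hY' : IsOpen Y') (hσ : IsHolomorphicNormalSection ι σ Y') {y₀ : Y} (hy₀ : y₀ ∈ Y') :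
    ∃ c W, y₀ ∈ W ∧ IsWeightedSubmean (fun y => (normalForm ι ψ hψ y (σ y) (σ y)).re) c W := by
  obtain ⟨c, W, hyW, -, hW⟩ := exists_isWeightedSubmean hι hU hpsh hψ (k := 1) (σ := fun _ => σ)
    (f := fun _ => 1) hY' (fun _ => hσ) mdifferentiableOn_const hy₀
  exact ⟨c, W, hyW, hW.congr fun y _ => by simp⟩

theorem isDegenerateHermitianMetric_normalForm {ι : Y → Z}
    (hι : IsImmersion 𝓘(ℂ, ℂ) 𝓘(ℂ, Fin n → ℂ) ω ι) {U : Z → ℝ} {ψ : Form11 n Z}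
    (hU : HasContinuousDDbar U ψ) (hpsh : Plurisubharmonic n (fun z => (U z : EReal)))
    (hψ : TangentSubsetKer ι ψ) : IsDegenerateHermitianMetric ι (normalForm ι ψ hψ) where
  conj_symm y v w := by
    obtain ⟨ζ, rfl⟩ := (tangentOf n ι y).mkQ_surjective v
    obtain ⟨η, rfl⟩ := (tangentOf n ι y).mkQ_surjective w
    obtain ⟨c, e, w, h, hyc⟩ := exists_isStraightening hι y
    have hz := h.mapsTo hyc
    simp only [normalForm, quotientForm_mk]
    rw [ψ.eq_coeffForm₂ h.cod_mem hz, ψ.eq_coeffForm₂ h.cod_mem hz]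
    exact coeffForm₂_conj_symm (fun j k => WeakDDbar.conj_symm e.open_target
      (hU.continuousOn_coeff e h.cod_mem) (hU.weakDDbar h.cod_mem) j k (e.map_source hz)) _ _
  nonneg y v := by
    obtain ⟨ζ, rfl⟩ := (tangentOf n ι y).mkQ_surjective v
    obtain ⟨c, e, w, h, hyc⟩ := exists_isStraightening hι y
    have hz := h.mapsTo hyc
    simp only [normalForm, quotientForm_mk]
    rw [ψ.eq_coeffForm₂ h.cod_mem hz]
    exact coeffForm_nonneg e.open_target (hU.continuousOn_comp_symm e)
      (hU.continuousOn_coeff e h.cod_mem) (hU.weakDDbar h.cod_mem)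
      (hpsh.submeanOnDiscs hU.continuous h.cod_mem) (e.map_source hz) _
  continuousOn Y' σ hY' hσ y₀ hy₀ := by
    obtain ⟨c, W, hyW, hW⟩ := exists_isWeightedSubmean_section hι hU hpsh hψ hY' hσ hy₀
    exact (hW.continuousOn.continuousAt (hW.isOpen.mem_nhds hyW)).continuousWithinAt

end NormalBundle

theorem exteriorForm_smul_ιMulti {V : Type*} [AddCommGroup V] [Module ℂ V]
    (H : V →ₗ[ℂ] V →ₗ⋆[ℂ] ℂ) (r : ℕ) (f : ℂ) (v : Fin r → V) :
    (exteriorForm H r (f • exteriorPower.ιMulti ℂ r v) (f • exteriorPower.ιMulti ℂ r v)).re =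
      ‖f‖ ^ 2 * (Matrix.of fun j k => H (v j) (v k)).det.re := by
  simp only [LinearMap.map_smulₛₗ, LinearMap.smul_apply, RingHom.id_apply, smul_eq_mul,
    exteriorForm_ιMulti]
  rw [mul_left_comm, ← mul_assoc, Complex.mul_conj']
  norm_cast
  rw [Complex.re_ofReal_mul]

theorem proposition2p2 {m : ℕ}
    {Z : Type*} [TopologicalSpace Z] [ChartedSpace (Fin (m + 1) → ℂ) Z]
    [IsManifold 𝓘(ℂ, Fin (m + 1) → ℂ) ω Z]
    {Y : Type*} [TopologicalSpace Y] [ChartedSpace ℂ Y] [IsManifold 𝓘(ℂ, ℂ) ω Y]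
    (ι : Y → Z) (hι : IsImmersion 𝓘(ℂ, ℂ) 𝓘(ℂ, Fin (m + 1) → ℂ) ω ι)
    (hinj : Function.Injective ι)
    (U : Z → ℝ) (ddbarU : Form11 (m + 1) Z) (hU : HasContinuousDDbar U ddbarU)
    (hpsh : Plurisubharmonic (m + 1) (fun z => (U z : EReal)))
    (hker : TangentSubsetKer ι ddbarU) :
    IsDegenerateHermitianMetric ι (normalForm ι ddbarU hker) ∧
    (∀ (Y' : Set Y) (σ : ∀ y, NormalFiber (m + 1) ι y), IsOpen Y' →
      IsHolomorphicNormalSection ι σ Y' →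
      SubharmonicOnCurve (fun y => logNormSq (normalForm ι ddbarU hker y) (σ y)) Y') ∧
    (∀ (Y' : Set Y) (τ : ∀ y, ⋀[ℂ]^m (NormalFiber (m + 1) ι y)), IsOpen Y' →
      IsHolomorphicDetSection ι τ Y' →
      SubharmonicOnCurve
        (fun y => logNormSq (exteriorForm (normalForm ι ddbarU hker y) m) (τ y)) Y') := by
  refine ⟨isDegenerateHermitianMetric_normalForm hι hU hpsh hker, fun Y' σ hY' hσ => ?_,
    fun Y' τ hY' hτ => ?_⟩
  · exact subharmonicOnCurve_log fun y₀ hy₀ =>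
      exists_isWeightedSubmean_section hι hU hpsh hker hY' hσ hy₀
  · refine subharmonicOnCurve_log
      (v := fun y => (exteriorForm (normalForm ι ddbarU hker y) m (τ y) (τ y)).re)
      fun y₀ hy₀ => ?_
    obtain ⟨V, hV, hyV, -, f, σ, hf, hσ, hτ'⟩ := hτ y₀ hy₀
    obtain ⟨c, W, hyW, hWV, hW⟩ := exists_isWeightedSubmean hι hU hpsh hker hV hσ hf hyV
    refine ⟨c, W, hyW, hW.congr fun y hy => ?_⟩
    simp only [hτ' y (hWV hy)]
    exact exteriorForm_smul_ιMulti _ m _ _
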